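/- Fix an odd prime $p$. **Groups.** For a topological group $G$ let $P_0(G)=G$, let $P_{n+1}(G)$ be the closed subgroup generated by $[G,P_n(G)]$ and $P_n(G)^p$, and let $Q_n(G)=G/P_n(G)$; the $p$-class of a finite $p$-group is the least $n$ with $P_n=1$, and $\Phi(G)=P_1(G)$. A GI-automorphism of $G$ is a continuous automorphism that inverts every element of some set of topological generators. A Schur-$\sigma$ group is a (topologically) finitely generated pro-$p$ group $G$ with finite abelianization and $\dim_{\mathbb F_p} H^1(G,\mathbb Z/p)=\dim_{\mathbb F_p} H^2(G,\mathbb Z/p)$ (continuous cohomology) that admits a GI-automorphism. A Schur $\sigma$-ancestor group is a group isomorphic to $Q_n(G)$ for some Schur-$\sigma$ group $G$ and some $n\ge 0$. Let $\Omega$ be the $\sigma$-algebra on the set of isomorphism classes of Schur-$\sigma$ groups generated by the sets $\{G \mid Q_n(G)\cong P\}$, for $n\ge 0$ and $P$ a finite $p$-group. **The measure.** Let $F_g$ be the free pro-$p$ group on $x_1,\dots,x_g$, with the automorphism $\sigma(x_i)=x_i^{-1}$; let $X=\{s\in\Phi(F_g)\mid \sigma(s)=s^{-1}\}$ and $X_n=\{s\in\Phi(Q_n(F_g))\mid\sigma(s)=s^{-1}\}$,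 and let $\mu$ be the probability measure on $X$, on the $\sigma$-algebra generated by the fibres of the maps $X\to Q_n(F_g)$, whose image in each finite set $X_n$ is uniform. Let $\mu_{CL}$ be the Cohen–Lenstra probability measure on isomorphism classes of finite abelian $p$-groups (the mass of $A$ is proportional to $1/|\mathrm{Aut}(A)|$), and $\mu_{CL}(g)$ the mass of the set of groups of rank $g$. The Boston–Bush–Hajir measure is $$\mu_{BBH}(\mathcal A)=\sum_{g\ge 0}\mu_{CL}(g)\;\mu^{g}\bigl(\{(r_1,\dots,r_g)\in X^g \mid F_g/\langle\langle r_1,\dots,r_g\rangle\rangle\in \mathcal A\}\bigr),$$ where $\langle\langle\cdot\rangle\rangle$ denotes the closed normal subgroup generated, for those sets $\mathcal A$ of isomorphism classes of Schur-$\sigma$ groups for which all the sets on the right are measurable. For a finite $p$-group $P$ put $\mu_{BBH,c}(P)=\mu_{BBH}(\{G\mid Q_c(G)\cong P\})$. **Theorem.** Let $H$ be a finite $p$-group of $p$-class $c$ with a GI-automorphism $\sigma$. For each Schur-$\sigma$ group and each Schur $\sigma$-ancestor group $G$ choose any GI-automorphism, and let $\mathrm{Sur}_\sigma(G,H)$ be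 the set of continuous surjective homomorphisms $G\to H$ that carry the chosen automorphism of $G$ to $\sigma$. Every set in $\Omega$ is $\mu_{BBH}$-measurable in the above sense, the function $G\mapsto|\mathrm{Sur}_\sigma(G,H)|$ on isomorphism classes of Schur-$\sigma$ groups is $\Omega$-measurable, and $$\int_G |\mathrm{Sur}_\sigma(G,H)|\,d\mu_{BBH}=\sum_{P}\mu_{BBH,c}(P)\,|\mathrm{Sur}_\sigma(P,H)|=1,$$ where $P$ runs over the isomorphism classes of Schur $\sigma$-ancestor groups of $p$-class $c$. The result does not depend on the choices of GI-automorphisms. -/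

import Mathlib

open scoped ENNReal
open MeasureTheory

namespace BBH

noncomputable section

/-! ## Bundled topological groups and their isomorphism classes -/

/-- A bundled topological group. -/
structure TopGrp where
  /-- The underlying type. -/
  carrier : Type
  [group : Group carrier]
  [top : TopologicalSpace carrier]
  [isTop : IsTopologicalGroup carrier]

instance : CoeSort TopGrp Type := ⟨TopGrp.carrier⟩

attribute [instance] TopGrp.group TopGrp.top TopGrp.isTop

/-- Isomorphism of topological groups, on those that satisfy `P`. -/
def isoSetoid (P : TopGrp → Prop) : Setoid {G : TopGrp // P G} where
  r G G' := Nonempty (G.1 ≃ₜ* G'.1)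
  iseqv :=
    { refl := fun G => ⟨ContinuousMulEquiv.refl G.1⟩
      symm := fun ⟨e⟩ => ⟨e.symm⟩
      trans := fun ⟨e⟩ ⟨f⟩ => ⟨e.trans f⟩ }

/-- The isomorphism classes of the topological groups with the property `P`. -/
def IsoClass (P : TopGrp → Prop) : Type 1 := Quotient (isoSetoid P)

/-- The isomorphism class of a topological group with the property `P`. -/
def IsoClass.mk {P : TopGrp → Prop} (G : TopGrp) (h : P G) : IsoClass P :=
  Quotient.mk (isoSetoid P) ⟨G, h⟩

/-- A representative of an isomorphism class. -/
def IsoClass.rep {P : TopGrp → Prop} (A : IsoClass P) : TopGrp :=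
  (Quotient.out (s := isoSetoid P) A).1

/-! ## Lower `p`-central series, pro-`p` groups, generator-inverting automorphisms -/

section Groups

universe u v

theorem closure_normal_of_conj {G : Type u} [Group G] {S : Set G}
    (hS : ∀ x ∈ S, ∀ k : G, k * x * k⁻¹ ∈ S) : (Subgroup.closure S).Normal := by
  constructor
  intro x hx k
  induction hx using Subgroup.closure_induction with
  | mem x hx => exact Subgroup.subset_closure (hS x hx k)
  | one => simp
  | mul x y _ _ hx hy =>
    have h : k * (x * y) * k⁻¹ = k * x * k⁻¹ * (k * y * k⁻¹) := by group
    rw [h]; exact mul_mem hx hy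
  | inv x _ hx =>
    have h : k * x⁻¹ * k⁻¹ = (k * x * k⁻¹)⁻¹ := by group
    rw [h]; exact inv_mem hx

/-- The lower `p`-central series: `P 0 = G`, and `P (n + 1)` is the closed subgroup generated by
`[G, P n]` and the `p`-th powers of the elements of `P n`. For a pro-`p` group `P 1` is the
Frattini subgroup. -/
def lowerPSeries (p : ℕ) (G : Type u) [Group G] [TopologicalSpace G] [IsTopologicalGroup G] :
    ℕ → Subgroup G
  | 0 => ⊤
  | n + 1 => (Subgroup.closure
      ({x | ∃ g : G, ∃ h ∈ lowerPSeries p G n, x = g * h * g⁻¹ * h⁻¹} ∪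
        {x | ∃ h ∈ lowerPSeries p G n, x = h ^ p})).topologicalClosure

variable (p : ℕ) (G : Type u) [Group G] [TopologicalSpace G] [IsTopologicalGroup G]

instance lowerPSeries_normal (n : ℕ) : (lowerPSeries p G n).Normal := by
  induction n with
  | zero => exact (inferInstance : (⊤ : Subgroup G).Normal)
  | succ n ih =>
    have : (Subgroup.closure
      ({x | ∃ g : G, ∃ h ∈ lowerPSeries p G n, x = g * h * g⁻¹ * h⁻¹} ∪
        {x | ∃ h ∈ lowerPSeries p G n, x = h ^ p})).Normal := by
      apply closure_normal_of_conj
      rintro x (⟨g, h, hh, rfl⟩ | ⟨h, hh, rfl⟩) k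
      · exact Or.inl ⟨k * g * k⁻¹, k * h * k⁻¹, ih.conj_mem h hh k, by group⟩
      · exact Or.inr ⟨k * h * k⁻¹, ih.conj_mem h hh k, conj_pow.symm⟩
    exact Subgroup.is_normal_topologicalClosure _

theorem lowerPSeries_le_comap {G' : Type v} [Group G'] [TopologicalSpace G']
    [IsTopologicalGroup G'] (f : G →ₜ* G') (n : ℕ) :
    lowerPSeries p G n ≤ (lowerPSeries p G' n).comap (f : G →* G') := by
  induction n with
  | zero => intro x _; exact Subgroup.mem_top _
  | succ n ih =>
    apply Subgroup.topologicalClosure_minimal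
    · rw [Subgroup.closure_le]
      rintro x (⟨g, h, hh, rfl⟩ | ⟨h, hh, rfl⟩)
      · exact Subgroup.le_topologicalClosure _
          (Subgroup.subset_closure (Or.inl ⟨f g, f h, ih hh, by simp⟩))
      · exact Subgroup.le_topologicalClosure _
          (Subgroup.subset_closure (Or.inr ⟨f h, ih hh, by simp⟩))
    · exact (Subgroup.isClosed_topologicalClosure _).preimage f.continuous_toFun

/-- `Q_c(G) = G / P_c(G)`. -/
abbrev Q (c : ℕ) : Type u := G ⧸ lowerPSeries p G c

/-- The endomorphism of `Q_c(G)` induced by a continuous endomorphism of `G`. -/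
def Q.map {G : Type u} [Group G] [TopologicalSpace G] [IsTopologicalGroup G] (f : G →ₜ* G)
    (c : ℕ) : Q p G c →* Q p G c :=
  QuotientGroup.map _ _ (f : G →* G) (lowerPSeries_le_comap p G f c)

/-- `G` has `p`-class `c`: the least `n` with `P_n(G) = 1` is `c`. -/
def HasPClass (c : ℕ) : Prop := IsLeast {n : ℕ | lowerPSeries p G n = ⊥} c

/-- A pro-`p` group: a profinite group all of whose open normal subgroups have index a power
of `p`. -/
structure IsProP : Prop where
  compact : CompactSpace G
  t2 : T2Space G
  totallyDisconnected : TotallyDisconnectedSpace G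
  index : ∀ N : Subgroup G, N.Normal → IsOpen (N : Set G) → ∃ k : ℕ, N.index = p ^ k

/-- The set `S` generates `G` topologically. -/
def TopGenerates {G : Type u} [Group G] [TopologicalSpace G] (S : Set G) : Prop :=
  Dense (Subgroup.closure S : Set G)

/-- A generator-inverting automorphism: it inverts a set of topological generators. -/
def IsGI {G : Type u} [Group G] [TopologicalSpace G] (σ : G ≃ₜ* G) : Prop :=
  ∃ S : Set G, TopGenerates S ∧ ∀ x ∈ S, σ x = x⁻¹

/-- The continuous surjections `G → H` that carry the automorphism `τ` of `G` to the
automorphism `σ` of `H`. -/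
def SurSigma {G : Type u} {H : Type v} [Group G] [TopologicalSpace G] [Group H]
    [TopologicalSpace H] (τ : G ≃ₜ* G) (σ : H ≃ₜ* H) : Type (max u v) :=
  {φ : G →ₜ* H // Function.Surjective φ ∧ ∀ x, φ (τ x) = σ (φ x)}

/-- The number of elements of `SurSigma τ σ` (`∞` if there are infinitely many). -/
def surCount {G : Type u} {H : Type v} [Group G] [TopologicalSpace G] [Group H]
    [TopologicalSpace H] (τ : G ≃ₜ* G) (σ : H ≃ₜ* H) : ℝ≥0∞ :=
  (ENat.card (SurSigma τ σ) : ℝ≥0∞)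

/-! ## Continuous cohomology with coefficients in `ℤ/p`, in degrees one and two

Cochains are continuous functions to the discrete trivial module `ℤ/p`, that is, locally
constant functions. -/

/-- `H¹(G, ℤ/p)`: continuous homomorphisms from `G` to `ℤ/p`. -/
def H1 : Submodule (ZMod p) (G → ZMod p) where
  carrier := {f | IsLocallyConstant f ∧ ∀ x y, f (x * y) = f x + f y}
  zero_mem' := ⟨IsLocallyConstant.const 0, by simp⟩
  add_mem' := by
    rintro f g ⟨hf, hf'⟩ ⟨hg, hg'⟩
    refine ⟨hf.add hg, fun x y => ?_⟩
    simp only [Pi.add_apply, hf', hg']; ring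
  smul_mem' := by
    rintro a f ⟨hf, hf'⟩
    refine ⟨hf.comp (fun t => a * t), fun x y => ?_⟩
    simp only [Pi.smul_apply, smul_eq_mul, hf']; ring

/-- Continuous inhomogeneous `2`-cocycles of `G` with values in `ℤ/p`. -/
def Z2 : Submodule (ZMod p) (G × G → ZMod p) where
  carrier := {f | IsLocallyConstant f ∧
    ∀ x y z, f (y, z) - f (x * y, z) + f (x, y * z) - f (x, y) = 0}
  zero_mem' := ⟨IsLocallyConstant.const 0, by simp⟩
  add_mem' := by
    rintro f g ⟨hf, hf'⟩ ⟨hg, hg'⟩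
    refine ⟨hf.add hg, fun x y z => ?_⟩
    simp only [Pi.add_apply]
    linear_combination hf' x y z + hg' x y z
  smul_mem' := by
    rintro a f ⟨hf, hf'⟩
    refine ⟨hf.comp (fun t => a * t), fun x y z => ?_⟩
    simp only [Pi.smul_apply, smul_eq_mul]
    linear_combination a * hf' x y z

/-- The `2`-coboundaries of continuous `1`-cochains `G → ℤ/p`. -/
def B2 : Submodule (ZMod p) (G × G → ZMod p) where
  carrier := {f | ∃ b : G → ZMod p, IsLocallyConstant b ∧
    ∀ x y, f (x, y) = b y - b (x * y) + b x}
  zero_mem' := ⟨0, IsLocallyConstant.const 0, by simp⟩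
  add_mem' := by
    rintro f g ⟨b, hb, hf⟩ ⟨d, hd, hg⟩
    refine ⟨b + d, hb.add hd, fun x y => ?_⟩
    simp only [Pi.add_apply, hf, hg]; ring
  smul_mem' := by
    rintro a f ⟨b, hb, hf⟩
    refine ⟨a • b, hb.comp (fun t => a * t), fun x y => ?_⟩
    simp only [Pi.smul_apply, smul_eq_mul, hf]; ring

/-- `H²(G, ℤ/p)`: continuous `2`-cocycles modulo coboundaries. -/
abbrev H2 : Type u := Z2 p G ⧸ (B2 p G).submoduleOf (Z2 p G)

/-- A Schur `σ`-group: a finitely generated pro-`p` group with finite abelianization, with equal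
generator rank `dim H¹(G, ℤ/p)` and relation rank `dim H²(G, ℤ/p)`, that admits a
generator-inverting automorphism. -/
structure IsSchurSigma : Prop where
  proP : IsProP p G
  fg : ∃ S : Set G, S.Finite ∧ TopGenerates S
  finiteAb : Finite (G ⧸ (commutator G).topologicalClosure)
  rank_eq : Module.rank (ZMod p) (H1 p G) = Module.rank (ZMod p) (H2 p G)
  gi : ∃ σ : G ≃ₜ* G, IsGI σ

end Groups

/-- A Schur `σ`-ancestor group: one isomorphic to `Q_n(G)` for some Schur `σ`-group `G`. -/
def IsAncestor (p : ℕ) (P : TopGrp) : Prop :=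
  ∃ (G : TopGrp) (n : ℕ), IsSchurSigma p G ∧ Nonempty (P ≃ₜ* Q p G n)

/-- The isomorphism classes of Schur `σ`-groups. -/
abbrev SchurClass (p : ℕ) : Type 1 := IsoClass fun G => IsSchurSigma p G

/-- The isomorphism classes of Schur `σ`-ancestor groups of `p`-class `c`. -/
abbrev AncestorClass (p c : ℕ) : Type 1 := IsoClass fun P => IsAncestor p P ∧ HasPClass p P c

/-- The set `{G | Q_c(G) ≅ P}` of isomorphism classes of Schur `σ`-groups. -/
def quotientSet (p c : ℕ) (P : TopGrp) : Set (SchurClass p) :=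
  {A | ∃ (G : TopGrp) (h : IsSchurSigma p G), A = IsoClass.mk G h ∧ Nonempty (Q p G c ≃ₜ* P)}

/-- The `σ`-algebra generated by the sets `{G | Q_c(G) ≅ P}`, for `c` a natural number and `P` a
finite `p`-group. -/
@[reducible] def Omega (p : ℕ) : MeasurableSpace (SchurClass p) :=
  MeasurableSpace.generateFrom {B | ∃ (c : ℕ) (P : TopGrp),
    Finite P ∧ DiscreteTopology P ∧ IsPGroup p P ∧ B = quotientSet p c P}

/-! ## The free pro-`p` group on `g` generators and its automorphism `xᵢ ↦ xᵢ⁻¹`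

The free pro-`p` group is the inverse limit of the quotients of the free group by its normal
subgroups of index a power of `p`. -/

section FreeProP

variable (p g : ℕ)

/-- A normal subgroup of `p`-power index of the free group on `g` generators. -/
structure PIndex where
  /-- The subgroup. -/
  toSubgroup : Subgroup (FreeGroup (Fin g))
  normal : toSubgroup.Normal
  index_eq : ∃ k : ℕ, toSubgroup.index = p ^ k

variable {p g}

instance (N : PIndex p g) : N.toSubgroup.Normal := N.normal

/-- The quotient of the free group by `N`, with the discrete topology. -/
def Level (N : PIndex p g) : Type := FreeGroup (Fin g) ⧸ N.toSubgroup

instance (N : PIndex p g) : Group (Level N) :=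
  inferInstanceAs (Group (FreeGroup (Fin g) ⧸ N.toSubgroup))

instance (N : PIndex p g) : TopologicalSpace (Level N) := ⊥

instance (N : PIndex p g) : DiscreteTopology (Level N) := ⟨rfl⟩

/-- The class of a word in a quotient of the free group. -/
def Level.mk (N : PIndex p g) : FreeGroup (Fin g) →* Level N := QuotientGroup.mk' N.toSubgroup

theorem Level.mk_surjective (N : PIndex p g) : Function.Surjective (Level.mk N) :=
  QuotientGroup.mk'_surjective N.toSubgroup

/-- The map of quotients of the free group induced by an endomorphism `f`. -/
def Level.map (f : FreeGroup (Fin g) →* FreeGroup (Fin g)) (M N : PIndex p g)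
    (h : ∀ w ∈ M.toSubgroup, f w ∈ N.toSubgroup) : Level M →* Level N :=
  QuotientGroup.map M.toSubgroup N.toSubgroup f h

@[simp] theorem Level.map_mk (f : FreeGroup (Fin g) →* FreeGroup (Fin g)) (M N : PIndex p g)
    (h : ∀ w ∈ M.toSubgroup, f w ∈ N.toSubgroup) (w : FreeGroup (Fin g)) :
    Level.map f M N h (Level.mk M w) = Level.mk N (f w) := rfl

/-- The projection of quotients of the free group for `M ≤ N`. -/
def Level.proj (M N : PIndex p g) (h : M.toSubgroup ≤ N.toSubgroup) : Level M →* Level N :=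
  Level.map (MonoidHom.id _) M N h

@[simp] theorem Level.proj_mk (M N : PIndex p g) (h : M.toSubgroup ≤ N.toSubgroup)
    (w : FreeGroup (Fin g)) : Level.proj M N h (Level.mk M w) = Level.mk N w := rfl

variable (p g)

/-- The compatible families in the product of the quotients. -/
def freeProPSubgroup : Subgroup (∀ N : PIndex p g, Level N) where
  carrier := {x | ∀ (M N : PIndex p g) (h : M.toSubgroup ≤ N.toSubgroup),
    Level.proj M N h (x M) = x N}
  one_mem' := fun M N h => map_one _
  mul_mem' := by
    intro x y hx hy M N h
    simp only [Pi.mul_apply, map_mul, hx M N h, hy M N h]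
  inv_mem' := by
    intro x hx M N h
    simp only [Pi.inv_apply, map_inv, hx M N h]

/-- The free pro-`p` group on `g` generators. -/
abbrev FreeProP : Type := ↥(freeProPSubgroup p g)

/-- The canonical map of the free group to the free pro-`p` group. -/
def ofWord : FreeGroup (Fin g) →* FreeProP p g where
  toFun w := ⟨fun N => Level.mk N w, fun _ _ _ => rfl⟩
  map_one' := Subtype.ext (funext fun N => map_one (Level.mk N))
  map_mul' v w := Subtype.ext (funext fun N => map_mul (Level.mk N) v w)

/-- The automorphism `xᵢ ↦ xᵢ⁻¹` of the free group. -/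
def invFree : FreeGroup (Fin g) →* FreeGroup (Fin g) :=
  FreeGroup.lift fun i => (FreeGroup.of i)⁻¹

theorem invFree_invFree (w : FreeGroup (Fin g)) : invFree g (invFree g w) = w := by
  have h : (invFree g).comp (invFree g) = MonoidHom.id _ := by
    ext i; simp [invFree]
  exact DFunLike.congr_fun h w

variable {p g}

/-- The preimage of `N` under `xᵢ ↦ xᵢ⁻¹`. -/
def PIndex.flip (N : PIndex p g) : PIndex p g where
  toSubgroup := N.toSubgroup.comap (invFree g)
  normal := inferInstance
  index_eq := by
    obtain ⟨k, hk⟩ := N.index_eq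
    exact ⟨k, by rw [Subgroup.index_comap_of_surjective _
      (fun w => ⟨invFree g w, invFree_invFree g w⟩), hk]⟩

theorem PIndex.flip_flip (N : PIndex p g) : N.flip.flip = N := by
  rcases N with ⟨N, hN, hN'⟩
  simp only [PIndex.flip, PIndex.mk.injEq]
  ext w
  simp only [Subgroup.mem_comap, invFree_invFree]

/-- The isomorphism of quotients of the free group induced by `xᵢ ↦ xᵢ⁻¹`. -/
def Level.inv (N : PIndex p g) : Level N.flip →* Level N :=
  Level.map (invFree g) N.flip N fun _ h => h

@[simp] theorem Level.inv_mk (N : PIndex p g) (w : FreeGroup (Fin g)) :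
    Level.inv N (Level.mk N.flip w) = Level.mk N (invFree g w) := rfl

variable (p g)

/-- The continuous automorphism `σ` of the free pro-`p` group with `σ(xᵢ) = xᵢ⁻¹`. -/
def sigmaFree : FreeProP p g →ₜ* FreeProP p g where
  toFun x := ⟨fun N => Level.inv N (x.1 N.flip), by
    intro M N h
    have h' : M.flip.toSubgroup ≤ N.flip.toSubgroup := Subgroup.comap_mono h
    have hx : Level.proj M.flip N.flip h' (x.1 M.flip) = x.1 N.flip := x.2 M.flip N.flip h'
    beta_reduce
    rw [← hx]
    obtain ⟨w, hw⟩ := Level.mk_surjective _ (x.1 M.flip)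
    rw [← hw, Level.inv_mk, Level.proj_mk, Level.proj_mk, Level.inv_mk]⟩
  map_one' := Subtype.ext (funext fun N => map_one _)
  map_mul' x y := Subtype.ext (funext fun N => map_mul _ _ _)
  continuous_toFun := by
    refine Continuous.subtype_mk (continuous_pi fun N => ?_) _
    exact continuous_of_discreteTopology.comp
      ((continuous_apply N.flip).comp continuous_subtype_val)

/-- `σ` inverts the free generators. -/
theorem sigmaFree_gen (i : Fin g) :
    sigmaFree p g (ofWord p g (FreeGroup.of i)) = (ofWord p g (FreeGroup.of i))⁻¹ := by
  rw [← map_inv]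
  apply Subtype.ext
  funext N
  change Level.mk N (invFree g (FreeGroup.of i)) = Level.mk N (FreeGroup.of i)⁻¹
  simp [invFree]

/-- `σ` is an involution. -/
theorem sigmaFree_sigmaFree (x : FreeProP p g) : sigmaFree p g (sigmaFree p g x) = x := by
  apply Subtype.ext
  funext N
  have h : N.flip.flip.toSubgroup ≤ N.toSubgroup :=
    le_of_eq (congrArg PIndex.toSubgroup N.flip_flip)
  have hx : Level.proj N.flip.flip N h (x.1 N.flip.flip) = x.1 N := x.2 _ _ h
  change Level.inv N (Level.inv N.flip (x.1 N.flip.flip)) = x.1 N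
  rw [← hx]
  obtain ⟨w, hw⟩ := Level.mk_surjective _ (x.1 N.flip.flip)
  rw [← hw, Level.inv_mk, Level.inv_mk, Level.proj_mk, invFree_invFree]

/-! ## Random relations -/

/-- The set `X` of the `s` in the Frattini subgroup of the free pro-`p` group
with `σ(s) = s⁻¹`. -/
def RelX : Type := {s : FreeProP p g // s ∈ lowerPSeries p (FreeProP p g) 1 ∧
  sigmaFree p g s = s⁻¹}

/-- The set `X_c` of the `s` in the Frattini subgroup of `Q_c` of the free pro-`p` group
with `σ(s) = s⁻¹`. -/
def RelXc (c : ℕ) : Set (Q p (FreeProP p g) c) :=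
  {s | s ∈ lowerPSeries p (Q p (FreeProP p g) c) 1 ∧ Q.map p (sigmaFree p g) c s = s⁻¹}

/-- The fibre of `X → Q_c` of the free pro-`p` group over `s`. -/
def relFibre (c : ℕ) (s : Q p (FreeProP p g) c) : Set (RelX p g) :=
  {x | (QuotientGroup.mk x.1 : Q p (FreeProP p g) c) = s}

/-- The `σ`-algebra on `X` generated by the fibres of the maps to the finite quotients. -/
instance : MeasurableSpace (RelX p g) :=
  MeasurableSpace.generateFrom {B | ∃ c s, B = relFibre p g c s}

variable {p g} in
/-- `μ` is the limit of the uniform probability measures on the finite sets `X_c`: its image in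
every `X_c` is uniform. -/
def IsUniformLimit (μ : Measure (RelX p g)) : Prop :=
  ∀ c, ∀ s ∈ RelXc p g c, μ (relFibre p g c s) = (Nat.card (RelXc p g c) : ℝ≥0∞)⁻¹

open Classical in
/-- The profinite probability measure on `X`: the (unique) limit of the uniform measures on
the `X_c`. -/
def relMeasure : Measure (RelX p g) :=
  if h : ∃ μ : Measure (RelX p g), IsUniformLimit μ then h.choose else 0

variable {p g}

/-- The closed normal subgroup generated by `r₁, …, r_g`. -/
def relSubgroup (r : Fin g → RelX p g) : Subgroup (FreeProP p g) :=
  (Subgroup.normalClosure (Set.range fun i => (r i).1)).topologicalClosure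

instance (r : Fin g → RelX p g) : (relSubgroup r).Normal :=
  Subgroup.is_normal_topologicalClosure _

/-- The group presented by the relations `r₁, …, r_g`. -/
def presented (r : Fin g → RelX p g) : TopGrp where
  carrier := FreeProP p g ⧸ relSubgroup r

variable (p g)

/-- The tuples of relations that present a Schur `σ`-group. -/
def SchurRel : Set (Fin g → RelX p g) := {r | IsSchurSigma p (presented r)}

/-- The isomorphism class of the Schur `σ`-group presented by a tuple of relations. -/
def presentedClass (r : SchurRel p g) : SchurClass p := IsoClass.mk (presented r.1) r.2

end FreeProP

/-! ## The Cohen–Lenstra measure -/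

/-- A finite abelian `p`-group. -/
structure FinAbPGrp (p : ℕ) where
  /-- The underlying type. -/
  carrier : Type
  [group : CommGroup carrier]
  [fin : Finite carrier]
  isPGroup : IsPGroup p carrier

attribute [instance] FinAbPGrp.group FinAbPGrp.fin

/-- Isomorphism of finite abelian `p`-groups. -/
instance finAbSetoid (p : ℕ) : Setoid (FinAbPGrp p) where
  r A B := Nonempty (A.carrier ≃* B.carrier)
  iseqv :=
    { refl := fun A => ⟨MulEquiv.refl A.carrier⟩
      symm := fun ⟨e⟩ => ⟨e.symm⟩
      trans := fun ⟨e⟩ ⟨f⟩ => ⟨e.trans f⟩ }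

/-- The isomorphism classes of finite abelian `p`-groups. -/
def FinAbClass (p : ℕ) : Type 1 := Quotient (finAbSetoid p)

/-- A representative of an isomorphism class of finite abelian `p`-groups. -/
def FinAbClass.rep {p : ℕ} (A : FinAbClass p) : FinAbPGrp p :=
  Quotient.out (s := finAbSetoid p) A

/-- `1 / |Aut A|`. -/
def autWeight {p : ℕ} (A : FinAbClass p) : ℝ≥0∞ := (Nat.card (MulAut A.rep.carrier) : ℝ≥0∞)⁻¹

/-- The Cohen–Lenstra probability of `A`: proportional to `1 / |Aut A|`, with total mass one. -/
def muCL {p : ℕ} (A : FinAbClass p) : ℝ≥0∞ := autWeight A / ∑' B : FinAbClass p, autWeight B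

/-- The Cohen–Lenstra probability of the groups of rank `g`. -/
def muCLRank (p g : ℕ) : ℝ≥0∞ :=
  ∑' A : {A : FinAbClass p // Group.rank A.rep.carrier = g}, muCL A.1

/-! ## The Boston–Bush–Hajir measure -/

/-- The `σ`-algebra of the sets `A` of isomorphism classes of Schur `σ`-groups such that, for
every `g`, the set of tuples of `g` relations that present a group in `A` is measurable. -/
instance (p : ℕ) : MeasurableSpace (SchurClass p) :=
  ⨅ g : ℕ, MeasurableSpace.map (presentedClass p g) inferInstance

/-- The Boston–Bush–Hajir measure: choose a rank `g` according to the Cohen–Lenstra measure and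
then take the group presented by `g` independent random relations from `X`. -/
def muBBH (p : ℕ) : Measure (SchurClass p) :=
  Measure.sum fun g => muCLRank p g •
    ((Measure.pi fun _ : Fin g => relMeasure p g).comap Subtype.val).map (presentedClass p g)

/-- The finite-level weight of `P`: the mass of `{G | Q_c(G) ≅ P}`. -/
def muBBHLevel (p c : ℕ) (P : TopGrp) : ℝ≥0∞ := muBBH p (quotientSet p c P)

end

end BBH

/-!
The integral is computed before any quotient by isomorphism is taken. Fix `g` and let `F` be the
free pro-`p` group on `g` generators. A `σ`-equivariant surjection `F → H` is the same as a
generating `g`-tuple of elements of `H` inverted by `σ`. It carries a random relation to a uniformly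
distributed element of the set `Y` of inverted elements of `Φ(H)`, so it factors through the group
presented by `g` random relations with probability `|Y| ^ (-g)`. Since `p` is odd, the inverted
elements of `H` over an inverted element of `H / Φ(H)` are as many as the elements of `Y`
(`card_inverted_fibre`), and `σ` inverts all of `H / Φ(H)`; by Burnside's basis theorem the number
of equivariant surjections `F → H` is therefore `|Y| ^ g` times the number of surjections
`𝔽_p ^ g → 𝔽_p ^ d`, where `d` is the rank of `H`. The expected number of equivariant surjections
from the presented group is thus the number of surjections `𝔽_p ^ g → 𝔽_p ^ d`
(`lintegral_surCount_presented`). Averaged over `g` this gives the moment of the Cohen–Lenstra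
measure at `𝔽_p ^ d`, which is one (`tsum_muCLRank_mul_numSurj`).

Three points turn this count into the theorem.

* *Independence of the choices.* Two generator-inverting automorphisms of a finite `p`-group are
  involutions whose product is trivial modulo the Frattini subgroup, hence of odd order, and so they
  are conjugate. An equivariant surjection onto a group of `p`-class `c` factors through
  `Q_c`, so the number of them depends only on the isomorphism class of `Q_c(G)`
  (`surCount_eq_of_equiv`). There are countably many finite groups, which gives measurability and
  the expression of the integral as a sum.

* *Random relations present Schur `σ`-groups almost surely* (`measure_compl_schurRel`). If the
  abelianization of the presented group is infinite, then that group maps onto every `ℤ/p^m`, and the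
  number of these maps grows with `m`; but its expected value, given by the count above for
  `H = ℤ/p^m` with the inversion, is bounded. If the abelianization is finite, then the generator
  rank, which is `g` because the relations lie in the Frattini subgroup, is at most the relation rank
  (`card_H1_le_card_H2`), and the latter is at most the number `g` of relations because the
  second cohomology of a free pro-`p` group vanishes (`exists_H2_injective`).

* *The Cohen–Lenstra moments.* Let `w(g)` be the sum of `1 / |Aut A|` over the groups of rank `g`.
  Counting subgroups `M` of finite `p`-power index of `ℤ^g` with weight `|ℤ^g / M| ^ (-g)`, and using
  that `M ↦ p⁻¹ M` matches the subgroups of `p ℤ^g` with all subgroups, gives a recursion for `w`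
  (`rankSum_recursion`), also satisfied by `v(g) = q ^ (g ^ 2) / ((1 - q) ⋯ (1 - q ^ g)) ^ 2` with
  `q = 1 / p`. The recursion for the groups killed by `p ^ n` yields `w ≤ v`, hence that `w` is
  finite, and then `w = v` by induction on `g` (`rankSum_one_eq`). That the sum of
  `w(g) |Sur(𝔽_p ^ g, 𝔽_p ^ d)|` does not depend on `d` is the statement that the series over Durfee
  rectangles does not depend on the shape of the rectangle (`tsum_durfee_eq`).
-/

namespace BBH

/-! ### Finite `p`-groups: the Frattini quotient and generating tuples -/

theorem lowerPSeries_discrete_succ (p : ℕ) (P : Type*) [Group P] [TopologicalSpace P]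
    [DiscreteTopology P] (n : ℕ) :
    lowerPSeries p P (n + 1) = Subgroup.closure
      ({x | ∃ g : P, ∃ h ∈ lowerPSeries p P n, x = g * h * g⁻¹ * h⁻¹} ∪
        {x | ∃ h ∈ lowerPSeries p P n, x = h ^ p}) :=
  le_antisymm (Subgroup.topologicalClosure_minimal _ le_rfl (isClosed_discrete _))
    (Subgroup.le_topologicalClosure _)

/-- A nontrivial finite `p`-group all of whose subgroups are trivial is commutative of
exponent `p`. -/
theorem comm_and_pow_of_subgroups_trivial {p : ℕ} [Fact p.Prime] {Q : Type*} [Group Q] [Finite Q]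
    [Nontrivial Q] (hQ : IsPGroup p Q) (h : ∀ K : Subgroup Q, K = ⊥ ∨ K = ⊤) :
    (∀ x y : Q, x * y = y * x) ∧ ∀ x : Q, x ^ p = 1 := by
  have hc : Subgroup.center Q = ⊤ := by
    have := hQ.center_nontrivial
    exact (h _).resolve_left ((Subgroup.nontrivial_iff_ne_bot _).mp this)
  have hcomm : ∀ x y : Q, x * y = y * x := fun x y =>
    (Subgroup.mem_center_iff.mp (hc ▸ Subgroup.mem_top y) x)
  refine ⟨hcomm, fun x => ?_⟩
  let : CommGroup Q := { (inferInstance : Group Q) with mul_comm := hcomm }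
  have : IsSimpleGroup Q := ⟨fun K _ => h K⟩
  have hp : (Nat.card Q).Prime := IsSimpleGroup.prime_card
  obtain ⟨n, hn⟩ := hQ.exists_card_eq
  have : p = Nat.card Q := by
    rw [hn] at hp ⊢
    have h1 : n = 1 := Nat.Prime.eq_one_of_pow hp
    simp [h1]
  rw [this]
  exact pow_card_eq_one'

/-- The Frattini property: elements of `P_1` are non-generators of a finite `p`-group. -/
theorem eq_top_of_sup_lowerPSeries {p : ℕ} [Fact p.Prime] {P : Type*} [Group P]
    [TopologicalSpace P] [DiscreteTopology P] [Finite P] (hP : IsPGroup p P) (K : Subgroup P)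
    (hK : K ⊔ lowerPSeries p P 1 = ⊤) : K = ⊤ := by
  by_contra hne
  obtain ⟨M, hM, hKM⟩ := (eq_top_or_exists_le_coatom K).resolve_left hne
  have := hP.isNilpotent
  have : M.Normal := Subgroup.NormalizerCondition.normal_of_coatom M
    Group.normalizerCondition_of_isNilpotent hM
  have : Nontrivial (P ⧸ M) := by
    rw [← not_subsingleton_iff_nontrivial, QuotientGroup.subsingleton_iff]
    exact hM.1
  have hsub : ∀ L : Subgroup (P ⧸ M), L = ⊥ ∨ L = ⊤ := by
    intro L
    have hle : M ≤ L.comap (QuotientGroup.mk' M) := by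
      intro x hx
      have : (QuotientGroup.mk' M) x = 1 := (QuotientGroup.eq_one_iff x).mpr hx
      simp [Subgroup.mem_comap, this, L.one_mem]
    rcases hM.le_iff.mp hle with h | h
    · right
      rw [← Subgroup.map_comap_eq_self_of_surjective (QuotientGroup.mk'_surjective M) L, h]
      exact Subgroup.map_top_of_surjective _ (QuotientGroup.mk'_surjective M)
    · left
      rw [← Subgroup.map_comap_eq_self_of_surjective (QuotientGroup.mk'_surjective M) L, h]
      exact QuotientGroup.map_mk'_self M
  obtain ⟨hc, hpow⟩ := comm_and_pow_of_subgroups_trivial (hP.to_quotient M) hsub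
  have hle : lowerPSeries p P 1 ≤ M := by
    rw [lowerPSeries_discrete_succ, Subgroup.closure_le]
    rintro x (⟨g, h, -, rfl⟩ | ⟨h, -, rfl⟩)
    · refine (QuotientGroup.eq_one_iff _).mp ?_
      change (g : P ⧸ M) * h * (g : P ⧸ M)⁻¹ * (h : P ⧸ M)⁻¹ = 1
      rw [hc (g : P ⧸ M) h]
      group
    · exact (QuotientGroup.eq_one_iff _).mp (hpow (h : P ⧸ M))
  exact hM.1 (top_le_iff.mp (hK ▸ sup_le hKM hle))

/-- The number of generating `g`-tuples of a group. -/
noncomputable def numGen (g : ℕ) (P : Type*) [Group P] : ℕ :=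
  Nat.card {f : Fin g → P // Subgroup.closure (Set.range f) = ⊤}

/-- The number of surjective linear maps `𝔽_p^g → 𝔽_p^d`. For `g < d` the factor `i = g` is zero,
so the truncated subtraction does no harm. -/
def numSurj (p g d : ℕ) : ℕ := ∏ i ∈ Finset.range d, (p ^ g - p ^ i)

theorem closure_range_eq_top_iff {p : ℕ} [Fact p.Prime] {P : Type*} [Group P]
    [TopologicalSpace P] [DiscreteTopology P] [Finite P] (hP : IsPGroup p P) {ι : Type*}
    (f : ι → P) : Subgroup.closure (Set.range f) = ⊤ ↔
      Subgroup.closure (Set.range fun i => (f i : P ⧸ lowerPSeries p P 1)) = ⊤ := by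
  have hr : Subgroup.closure (Set.range fun i => (f i : P ⧸ lowerPSeries p P 1)) =
      (Subgroup.closure (Set.range f)).map (QuotientGroup.mk' (lowerPSeries p P 1)) := by
    rw [MonoidHom.map_closure, ← Set.range_comp]; rfl
  rw [hr]
  constructor
  · intro h
    rw [h]
    exact Subgroup.map_top_of_surjective _ (QuotientGroup.mk'_surjective _)
  · intro h
    apply eq_top_of_sup_lowerPSeries hP
    have h2 := congrArg (Subgroup.comap (QuotientGroup.mk' (lowerPSeries p P 1))) h
    rw [Subgroup.comap_map_eq, QuotientGroup.ker_mk', Subgroup.comap_top] at h2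
    exact h2

/-- The number of preimages of a tuple under a quotient map. -/
theorem card_tuple_fibre {P : Type*} [Group P] (N : Subgroup P) {g : ℕ}
    (v : Fin g → P ⧸ N) :
    Nat.card {f : Fin g → P // ∀ i, (f i : P ⧸ N) = v i} = Nat.card N ^ g := by
  have e : {f : Fin g → P // ∀ i, (f i : P ⧸ N) = v i} ≃ (Fin g → N) :=
    { toFun := fun f i => ⟨(v i).out⁻¹ * f.1 i, by
        rw [← QuotientGroup.eq, f.2 i, QuotientGroup.out_eq']⟩
      invFun := fun n => ⟨fun i => (v i).out * n i, fun i => by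
        rw [QuotientGroup.mk_mul_of_mem _ (n i).2, QuotientGroup.out_eq']⟩
      left_inv := fun f => by ext i; simp
      right_inv := fun n => by ext i; simp }
  rw [Nat.card_congr e, Nat.card_fun]
  simp

theorem numGen_eq_mul {p : ℕ} [Fact p.Prime] (g : ℕ) {P : Type*} [Group P]
    [TopologicalSpace P] [DiscreteTopology P] [Finite P] (hP : IsPGroup p P) :
    numGen g P = Nat.card (lowerPSeries p P 1) ^ g * numGen g (P ⧸ lowerPSeries p P 1) := by
  classical
  set N := lowerPSeries p P 1
  let S := {f : Fin g → P ⧸ N // Subgroup.closure (Set.range f) = ⊤}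
  let q : {f : Fin g → P // Subgroup.closure (Set.range f) = ⊤} → S := fun f =>
    ⟨fun i => (f.1 i : P ⧸ N), (closure_range_eq_top_iff hP f.1).mp f.2⟩
  have : Fintype S := Fintype.ofFinite S
  unfold numGen
  rw [← Nat.card_congr (Equiv.sigmaFiberEquiv q), Nat.card_sigma]
  have : ∀ v : S, Nat.card {f // q f = v} = Nat.card N ^ g := by
    intro v
    rw [← card_tuple_fibre N v.1]
    refine Nat.card_congr
      { toFun := fun f => ⟨f.1.1, fun i => congrFun (congrArg Subtype.val f.2) i⟩
        invFun := fun f => ⟨⟨f.1, (closure_range_eq_top_iff hP f.1).mpr ?_⟩, ?_⟩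
        left_inv := fun f => rfl
        right_inv := fun f => rfl }
    · rw [funext f.2]; exact v.2
    · exact Subtype.ext (funext f.2)
  simp only [this, Finset.sum_const, Finset.card_univ, smul_eq_mul]
  rw [mul_comm, ← Nat.card_eq_fintype_card (α := S)]

/-- Transposing matrices, the spanning `g`-tuples of `K^d` correspond to the linearly
independent `d`-tuples of `K^g`. -/
theorem card_span_eq_top (K : Type*) [Field K] [Fintype K] (g d : ℕ) :
    Nat.card {f : Fin g → (Fin d → K) // Submodule.span K (Set.range f) = ⊤} =
      ∏ i ∈ Finset.range d, (Fintype.card K ^ g - Fintype.card K ^ i) := by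
  have h1 : Nat.card {f : Fin g → (Fin d → K) // Submodule.span K (Set.range f) = ⊤} =
      Nat.card {s : Fin d → (Fin g → K) // LinearIndependent K s} := by
    refine Nat.card_congr (Equiv.subtypeEquiv
      ⟨fun f i j => f j i, fun f i j => f j i, fun _ => rfl, fun _ => rfl⟩ fun f => ?_)
    let A : Matrix (Fin d) (Fin g) K := Matrix.of fun i j => f j i
    have hA : LinearIndependent K A.row ↔ A.rank = d := by
      constructor
      · intro h; simpa using h.rank_matrix
      · intro h
        rw [linearIndependent_iff_card_eq_finrank_span, Set.finrank,
          ← Matrix.rank_eq_finrank_span_row, h, Fintype.card_fin]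
    have hB : A.rank = d ↔ Submodule.span K (Set.range f) = ⊤ := by
      rw [Matrix.rank_eq_finrank_span_cols]
      constructor
      · intro h
        exact Submodule.eq_top_of_finrank_eq (by rw [Module.finrank_fin_fun]; exact h)
      · intro h
        have : Submodule.span K (Set.range A.col) = ⊤ := h
        rw [this, finrank_top, Module.finrank_fin_fun]
    exact hB.symm.trans hA.symm
  rw [h1]
  by_cases hd : d ≤ g
  · have : Module.Finite K (Fin g → K) := inferInstance
    have := card_linearIndependent (K := K) (V := Fin g → K) (k := d) (by simpa using hd)
    rw [this, Module.finrank_fin_fun, Finset.prod_range]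
  · rw [Finset.prod_eq_zero (Finset.mem_range.mpr (not_le.mp hd)) (by simp)]
    rw [Nat.card_eq_zero]
    left
    constructor
    rintro ⟨s, hs⟩
    have := hs.fintype_card_le_finrank
    simp at this
    omega

/-- In a group of exponent `p` that is commutative, written additively, the generating tuples are
the spanning tuples of a vector space over `ZMod p`. -/
theorem exists_numGen_elementary {p : ℕ} [Fact p.Prime] {V : Type*} [CommGroup V] [Finite V]
    (hV : ∀ x : V, x ^ p = 1) :
    ∃ d, Nat.card V = p ^ d ∧ ∀ g, numGen g V = numSurj p g d := by
  let : Module (ZMod p) (Additive V) := AddCommGroup.zmodModule (n := p) (fun x => hV x.toMul)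
  have : Module.Finite (ZMod p) (Additive V) := Module.Finite.of_finite
  let b := Module.finBasis (ZMod p) (Additive V)
  refine ⟨Module.finrank (ZMod p) (Additive V), ?_, fun g => ?_⟩
  · have := Module.natCard_eq_pow_finrank (K := ZMod p) (V := Additive V)
    rw [Nat.card_zmod] at this
    rw [← this]; rfl
  · have hs := card_span_eq_top (ZMod p) g (Module.finrank (ZMod p) (Additive V))
    rw [ZMod.card] at hs
    rw [numSurj, ← hs, numGen]
    let e := b.equivFun
    refine Nat.card_congr (Equiv.subtypeEquiv
      (Equiv.arrowCongr (Equiv.refl _) (Additive.ofMul.trans e.toEquiv)) fun f => ?_)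
    have h1 : Set.range ((Equiv.arrowCongr (Equiv.refl (Fin g))
        (Additive.ofMul.trans e.toEquiv)) f) = e '' (Set.range (Additive.ofMul ∘ f)) := by
      rw [← Set.range_comp]; rfl
    rw [h1]
    change _ ↔ Submodule.span (ZMod p) (e.toLinearMap '' _) = ⊤
    rw [← Submodule.map_span]
    have h2 : Submodule.map e.toLinearMap
        (Submodule.span (ZMod p) (Set.range (Additive.ofMul ∘ f))) = ⊤ ↔
        Submodule.span (ZMod p) (Set.range (Additive.ofMul ∘ f)) = ⊤ := by
      constructor
      · intro h
        apply Submodule.map_injective_of_injective e.injective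
        rw [h, Submodule.map_top, LinearMap.range_eq_top.mpr e.surjective]
      · intro h
        rw [h, Submodule.map_top, LinearMap.range_eq_top.mpr e.surjective]
    rw [h2]
    have h3 : ∀ x : V, x ∈ Subgroup.closure (Set.range f) ↔
        Additive.ofMul x ∈ Submodule.span (ZMod p) (Set.range (Additive.ofMul ∘ f)) := by
      intro x
      constructor
      · intro hx
        induction hx using Subgroup.closure_induction with
        | mem x hx =>
          obtain ⟨i, rfl⟩ := hx
          exact Submodule.subset_span ⟨i, rfl⟩
        | one => exact Submodule.zero_mem _
        | mul x y _ _ hx hy => exact Submodule.add_mem _ hx hy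
        | inv x _ hx => exact Submodule.neg_mem _ hx
      · intro hx
        have : ∀ y : Additive V, y ∈ Submodule.span (ZMod p) (Set.range (Additive.ofMul ∘ f)) →
            y.toMul ∈ Subgroup.closure (Set.range f) := by
          intro y hy
          induction hy using Submodule.span_induction with
          | mem x hx =>
            obtain ⟨i, rfl⟩ := hx
            exact Subgroup.subset_closure ⟨i, rfl⟩
          | zero => exact Subgroup.one_mem _
          | add x y _ _ hx hy => exact Subgroup.mul_mem _ hx hy
          | smul a x _ hx =>
            have : a • x = a.val • x := by
              rw [← Nat.cast_smul_eq_nsmul (ZMod p), ZMod.natCast_zmod_val]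
            rw [this]
            exact Subgroup.pow_mem _ hx _
        exact this _ hx
    constructor
    · intro h
      rw [eq_top_iff]
      intro y _
      exact (h3 y.toMul).mp (h ▸ Subgroup.mem_top _)
    · intro h
      rw [eq_top_iff]
      intro y _
      exact (h3 y).mpr (h ▸ Submodule.mem_top)

theorem frattiniQuotient_comm {p : ℕ} {G : Type*} [Group G] [TopologicalSpace G]
    [IsTopologicalGroup G] (x y : G ⧸ lowerPSeries p G 1) : x * y = y * x := by
  obtain ⟨x, rfl⟩ := QuotientGroup.mk_surjective x
  obtain ⟨y, rfl⟩ := QuotientGroup.mk_surjective y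
  have h : x * y * x⁻¹ * y⁻¹ ∈ lowerPSeries p G 1 :=
    Subgroup.le_topologicalClosure _ (Subgroup.subset_closure
      (Or.inl ⟨x, y, Subgroup.mem_top _, rfl⟩))
  have h2 := (QuotientGroup.eq_one_iff _).mpr h
  change (x : G ⧸ lowerPSeries p G 1) * y * (x : G ⧸ lowerPSeries p G 1)⁻¹ *
    (y : G ⧸ lowerPSeries p G 1)⁻¹ = 1 at h2
  rw [mul_inv_eq_one, mul_inv_eq_iff_eq_mul] at h2
  exact h2

theorem frattiniQuotient_pow {p : ℕ} {G : Type*} [Group G] [TopologicalSpace G]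
    [IsTopologicalGroup G] (x : G ⧸ lowerPSeries p G 1) : x ^ p = 1 := by
  obtain ⟨x, rfl⟩ := QuotientGroup.mk_surjective x
  have h : x ^ p ∈ lowerPSeries p G 1 :=
    Subgroup.le_topologicalClosure _ (Subgroup.subset_closure
      (Or.inr ⟨x, Subgroup.mem_top _, rfl⟩))
  exact_mod_cast (QuotientGroup.eq_one_iff _).mpr h

/-- The generating tuples of the Frattini quotient, a vector space over `𝔽_p`. -/
theorem exists_numGen_frattiniQuotient {p : ℕ} [Fact p.Prime] {P : Type*} [Group P]
    [TopologicalSpace P] [IsTopologicalGroup P] [Finite P] :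
    ∃ d, Nat.card (P ⧸ lowerPSeries p P 1) = p ^ d ∧
      ∀ g, numGen g (P ⧸ lowerPSeries p P 1) = numSurj p g d := by
  let _ : CommGroup (P ⧸ lowerPSeries p P 1) :=
    { (inferInstance : Group (P ⧸ lowerPSeries p P 1)) with mul_comm := frattiniQuotient_comm }
  exact exists_numGen_elementary (p := p) (V := P ⧸ lowerPSeries p P 1) frattiniQuotient_pow

/-! ### Elements inverted by an involution -/

theorem exists_half {L : Type*} [Group L] (hL : Odd (Nat.card L)) :
    ∃ k : ℕ, ∀ y : L, y ^ k * y ^ k = y := by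
  obtain ⟨m, hm⟩ := hL
  refine ⟨m + 1, fun y => ?_⟩
  have : y ^ (Nat.card L) = 1 := pow_card_eq_one'
  rw [← pow_add, show m + 1 + (m + 1) = Nat.card L + 1 by omega, pow_succ, this, one_mul]

/-- The elements inverted by an involution `α` that lie over a given element inverted by `β`:
writing the latter as a square `l = z * z` of an inverted element, `k ↦ n * k * α(n)⁻¹` with
`n` over `z` matches the fibre over `1` with the fibre over `l`. -/
theorem card_inverted_fibre {K L : Type*} [Group K] [Group L]
    (hL : Odd (Nat.card L)) (α : K →* K) (hα : ∀ k, α (α k) = k) (β : L →* L) (π : K →* L)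
    (hπ : Function.Surjective π) (hc : ∀ k, π (α k) = β (π k)) (l : L) (hl : β l = l⁻¹) :
    Nat.card {k // α k = k⁻¹ ∧ π k = l} = Nat.card {k // α k = k⁻¹ ∧ π k = 1} := by
  obtain ⟨m, hm⟩ := exists_half hL
  have hz : β (l ^ m) = (l ^ m)⁻¹ := by rw [map_pow, hl, inv_pow]
  obtain ⟨n, hn⟩ := hπ (l ^ m)
  refine Nat.card_congr
    { toFun := fun k => ⟨n⁻¹ * k.1 * α n, ?_, ?_⟩
      invFun := fun k => ⟨n * k.1 * (α n)⁻¹, ?_, ?_⟩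
      left_inv := fun k => Subtype.ext ?_
      right_inv := fun k => Subtype.ext ?_ }
  · simp [hα, k.2.1, mul_assoc]
  · rw [map_mul, map_mul, map_inv, hc, hn, k.2.2, hz]
    nth_rewrite 2 [← hm l]
    group
  · simp [hα, k.2.1, mul_assoc]
  · rw [map_mul, map_mul, map_inv, hc, hn, k.2.2, hz]
    simp [hm]
  · group
  · group

/-- An equivariant surjection of groups with involution, the target finite of odd order, has
fibres of constant size over the inverted elements. -/
theorem card_inverted_eq_mul {K L : Type*} [Group K] [Group L] [Finite L]
    (hL : Odd (Nat.card L)) (α : K →* K) (hα : ∀ k, α (α k) = k) (β : L →* L) (π : K →* L)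
    (hπ : Function.Surjective π) (hc : ∀ k, π (α k) = β (π k)) [Finite K] :
    Nat.card {k // α k = k⁻¹} =
      Nat.card {l // β l = l⁻¹} * Nat.card {k // α k = k⁻¹ ∧ π k = 1} := by
  classical
  have : Fintype {l // β l = l⁻¹} := Fintype.ofFinite _
  let q : {k // α k = k⁻¹} → {l // β l = l⁻¹} := fun k => ⟨π k.1, by rw [← hc, k.2, map_inv]⟩
  rw [← Nat.card_congr (Equiv.sigmaFiberEquiv q), Nat.card_sigma]
  have h : ∀ l, Nat.card {k // q k = l} = Nat.card {k // α k = k⁻¹ ∧ π k = 1} := by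
    intro l
    rw [← card_inverted_fibre hL α hα β π hπ hc l.1 l.2]
    exact Nat.card_congr
      { toFun := fun k => ⟨k.1.1, k.1.2, congrArg Subtype.val k.2⟩
        invFun := fun k => ⟨⟨k.1, k.2.1⟩, Subtype.ext k.2.2⟩
        left_inv := fun k => rfl
        right_inv := fun k => rfl }
  simp only [h, Finset.sum_const, Finset.card_univ, smul_eq_mul, Nat.card_eq_fintype_card]

theorem odd_card_of_isPGroup {p : ℕ} [Fact p.Prime] (hp : Odd p) {P : Type*} [Group P] [Finite P]
    (hP : IsPGroup p P) : Odd (Nat.card P) := by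
  obtain ⟨n, hn⟩ := hP.exists_card_eq
  rw [hn]
  exact hp.pow

/-! ### Conjugacy of generator-inverting automorphisms -/

/-- An automorphism of order two of a finite `p`-group of odd order that is trivial on the
Frattini quotient is trivial: every coset of the Frattini subgroup has a fixed point. -/
theorem eq_one_of_sq_eq_one {p : ℕ} [Fact p.Prime] (hp : Odd p) {P : Type*} [Group P]
    [TopologicalSpace P] [DiscreteTopology P] [Finite P] (hP : IsPGroup p P) (β : MulAut P)
    (h2 : β * β = 1) (hβ : ∀ x, x⁻¹ * β x ∈ lowerPSeries p P 1) : β = 1 := by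
  obtain ⟨m, hm⟩ := exists_half (odd_card_of_isPGroup hp hP)
  have hββ : ∀ x, β (β x) = x := fun x => by rw [← MulAut.mul_apply, h2]; rfl
  let K : Subgroup P :=
    { carrier := {x | β x = x}
      one_mem' := map_one β
      mul_mem' := fun {a b} ha hb => by
        simp only [Set.mem_ofPred_eq] at *
        rw [map_mul, ha, hb]
      inv_mem' := fun {a} ha => by
        simp only [Set.mem_ofPred_eq] at *
        rw [map_inv, ha] }
  have hK : K ⊔ lowerPSeries p P 1 = ⊤ := by
    rw [eq_top_iff]
    intro x _
    have hu : β (x⁻¹ * β x) = (x⁻¹ * β x)⁻¹ := by simp [hββ]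
    have hz : β ((x⁻¹ * β x) ^ m) = ((x⁻¹ * β x) ^ m)⁻¹ := by rw [map_pow, hu, inv_pow]
    have hfix : x * (x⁻¹ * β x) ^ m ∈ K := by
      change β (x * (x⁻¹ * β x) ^ m) = x * (x⁻¹ * β x) ^ m
      rw [map_mul, hz]
      have h3 := hm (x⁻¹ * β x)
      have h4 : β x = x * ((x⁻¹ * β x) ^ m * (x⁻¹ * β x) ^ m) := by rw [h3]; group
      rw [mul_inv_eq_iff_eq_mul, mul_assoc]
      exact h4
    have : x = x * (x⁻¹ * β x) ^ m * ((x⁻¹ * β x) ^ m)⁻¹ := by group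
    rw [this]
    exact Subgroup.mul_mem_sup hfix (inv_mem (pow_mem (hβ x) m))
  have hKtop := eq_top_of_sup_lowerPSeries hP K hK
  ext x
  exact (hKtop ▸ Subgroup.mem_top x : x ∈ K)

theorem isGI_closure_eq_top {P : Type*} [Group P] [TopologicalSpace P] [DiscreteTopology P]
    {S : Set P} (hS : TopGenerates S) : Subgroup.closure S = ⊤ := by
  have := dense_discrete.mp hS
  exact SetLike.coe_injective (by simpa using this)

/-- A generator-inverting automorphism is an involution. -/
theorem IsGI.involutive {G : Type*} [Group G] [TopologicalSpace G] [T2Space G] {σ : G ≃ₜ* G}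
    (h : IsGI σ) (x : G) : σ (σ x) = x := by
  obtain ⟨S, hS, hinv⟩ := h
  have hcl : IsClosed {x | σ (σ x) = x} :=
    isClosed_eq (σ.continuous.comp σ.continuous) continuous_id
  have hsub : (Subgroup.closure S : Set G) ⊆ {x | σ (σ x) = x} := by
    intro y hy
    induction hy using Subgroup.closure_induction with
    | mem y hy => simp [hinv y hy]
    | one => simp
    | mul a b _ _ ha hb =>
      simp only [Set.mem_ofPred_eq] at *
      rw [map_mul, map_mul, ha, hb]
    | inv a _ ha =>
      simp only [Set.mem_ofPred_eq] at *
      rw [map_inv, map_inv, ha]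
  exact hcl.closure_subset_iff.mpr hsub (hS x)

/-- A generator-inverting automorphism inverts the Frattini quotient. -/
theorem IsGI.mul_mem {p : ℕ} {P : Type*} [Group P] [TopologicalSpace P]
    [DiscreteTopology P] {σ : P ≃ₜ* P} (h : IsGI σ) (x : P) :
    σ x * x ∈ lowerPSeries p P 1 := by
  obtain ⟨S, hS, hinv⟩ := h
  have hx : x ∈ Subgroup.closure S := isGI_closure_eq_top hS ▸ Subgroup.mem_top x
  have key : ∀ y, σ y * y ∈ lowerPSeries p P 1 ↔
      (QuotientGroup.mk (σ y) : P ⧸ lowerPSeries p P 1) = (QuotientGroup.mk y)⁻¹ := by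
    intro y
    rw [← QuotientGroup.eq_one_iff, QuotientGroup.mk_mul, mul_eq_one_iff_eq_inv]
  rw [key]
  induction hx using Subgroup.closure_induction with
  | mem y hy => rw [hinv y hy]; rfl
  | one => simp
  | mul a b _ _ ha hb =>
    rw [map_mul, QuotientGroup.mk_mul, QuotientGroup.mk_mul, mul_inv_rev, ha, hb]
    exact frattiniQuotient_comm _ _
  | inv a _ ha => rw [map_inv, QuotientGroup.mk_inv, QuotientGroup.mk_inv, ha]

/-- Any two generator-inverting automorphisms of a finite `p`-group, `p` odd, are conjugate:
they generate a dihedral group whose rotations are trivial on the Frattini quotient, hence of odd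
order. -/
theorem IsGI.conj {p : ℕ} [Fact p.Prime] (hp : Odd p) {P : Type*} [Group P]
    [TopologicalSpace P] [DiscreteTopology P] [Finite P] (hP : IsPGroup p P) {τ τ' : P ≃ₜ* P}
    (h : IsGI τ) (h' : IsGI τ') : ∃ ψ : P ≃ₜ* P, ∀ x, ψ (τ x) = τ' (ψ x) := by
  let t : MulAut P := τ.toMulEquiv
  let t' : MulAut P := τ'.toMulEquiv
  have ht : t * t = 1 := MulEquiv.ext fun x => h.involutive x
  have ht' : t' * t' = 1 := MulEquiv.ext fun x => h'.involutive x
  set a : MulAut P := t' * t with ha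
  let N : Subgroup (MulAut P) :=
    { carrier := {β | ∀ x, x⁻¹ * β x ∈ lowerPSeries p P 1}
      one_mem' := fun x => by simp
      mul_mem' := fun {β γ} hβ hγ x => by
        have := Subgroup.mul_mem _ (hγ x) (hβ (γ x))
        simpa [mul_assoc] using this
      inv_mem' := fun {β} hβ x => by
        have := Subgroup.inv_mem _ (hβ (β⁻¹ x))
        simpa using this }
  have haN : a ∈ N := by
    intro x
    have h1 : τ' (τ x) * τ x ∈ lowerPSeries p P 1 := h'.mul_mem (p := p) (τ x)
    have h2 : τ x * x ∈ lowerPSeries p P 1 := h.mul_mem (p := p) x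
    have h3 : τ' (τ x) * x⁻¹ ∈ lowerPSeries p P 1 := by
      have := Subgroup.mul_mem _ h1 (Subgroup.inv_mem _
        (((lowerPSeries_normal p P 1).mem_comm_iff).mp h2))
      simpa [mul_assoc] using this
    exact ((lowerPSeries_normal p P 1).mem_comm_iff).mp h3
  have hodd : Odd (orderOf a) := by
    by_contra hev
    rw [Nat.not_odd_iff_even] at hev
    obtain ⟨m, hm⟩ := hev
    have hpos : 0 < orderOf a := orderOf_pos a
    have h1 : a ^ m = 1 := by
      refine eq_one_of_sq_eq_one hp hP _ ?_ (N.pow_mem haN m)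
      rw [← pow_add, ← hm, pow_orderOf_eq_one]
    have := orderOf_le_of_pow_eq_one (by omega) h1
    omega
  obtain ⟨m, hm⟩ := hodd
  have hconj : t * a * t⁻¹ = a⁻¹ := by
    have i1 : t⁻¹ = t := inv_eq_of_mul_eq_one_left ht
    have i2 : t'⁻¹ = t' := inv_eq_of_mul_eq_one_left ht'
    rw [ha, mul_inv_rev, i1, i2, mul_assoc, mul_assoc, ht, mul_one]
  have hat : t' = a * t := by rw [ha, mul_assoc, ht, mul_one]
  -- conjugation by `a ^ j` turns `t` into `a ^ (2 * j) * t`, so take `2 * j ≡ 1` modulo the order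
  have hk : a ^ (m + 1) * t = t' * a ^ (m + 1) := by
    have h1 : t * a ^ (m + 1) = (a ^ (m + 1))⁻¹ * t := by
      have := congrArg (· ^ (m + 1)) hconj
      simp only [conj_pow, inv_pow] at this
      rw [← this]; group
    rw [hat, mul_assoc, h1, ← mul_assoc]
    congr 1
    rw [eq_mul_inv_iff_mul_eq, ← pow_add, show m + 1 + (m + 1) = orderOf a + 1 by omega, pow_succ,
      pow_orderOf_eq_one, one_mul]
  refine ⟨⟨a ^ (m + 1), continuous_of_discreteTopology, continuous_of_discreteTopology⟩,
    fun x => ?_⟩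
  exact DFunLike.congr_fun hk x

/-! ### The number of equivariant surjections depends only on `Q_c` -/

/-- The map induced on `Q_c` by a continuous homomorphism. -/
def qMap (p : ℕ) {G G' : Type*} [Group G] [TopologicalSpace G] [IsTopologicalGroup G] [Group G']
    [TopologicalSpace G'] [IsTopologicalGroup G'] (f : G →ₜ* G') (c : ℕ) :
    Q p G c →ₜ* Q p G' c where
  toMonoidHom := QuotientGroup.map _ _ (f : G →* G') (lowerPSeries_le_comap p G f c)
  continuous_toFun := by
    refine (QuotientGroup.isQuotientMap_mk _).continuous_iff.mpr ?_
    exact QuotientGroup.continuous_mk.comp f.continuous_toFun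

@[simp] theorem qMap_mk (p : ℕ) {G G' : Type*} [Group G] [TopologicalSpace G]
    [IsTopologicalGroup G] [Group G'] [TopologicalSpace G'] [IsTopologicalGroup G']
    (f : G →ₜ* G') (c : ℕ) (x : G) :
    qMap p f c (QuotientGroup.mk x) = QuotientGroup.mk (f x) := rfl

/-- The isomorphism induced on `Q_c` by an isomorphism. -/
def qEquiv (p : ℕ) {G G' : Type*} [Group G] [TopologicalSpace G] [IsTopologicalGroup G] [Group G']
    [TopologicalSpace G'] [IsTopologicalGroup G'] (e : G ≃ₜ* G') (c : ℕ) :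
    Q p G c ≃ₜ* Q p G' c where
  toFun := qMap p (e : G →ₜ* G') c
  invFun := qMap p (e.symm : G' →ₜ* G) c
  left_inv := fun x => by
    obtain ⟨x, rfl⟩ := QuotientGroup.mk_surjective x
    simp
  right_inv := fun x => by
    obtain ⟨x, rfl⟩ := QuotientGroup.mk_surjective x
    simp
  map_mul' := map_mul _
  continuous_toFun := (qMap p (e : G →ₜ* G') c).continuous_toFun
  continuous_invFun := (qMap p (e.symm : G' →ₜ* G) c).continuous_toFun

theorem TopGenerates.image {G G' : Type*} [Group G] [TopologicalSpace G] [Group G']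
    [TopologicalSpace G'] {S : Set G} (hS : TopGenerates S) (f : G →* G') (hf : Continuous f)
    (hs : Function.Surjective f) : TopGenerates (f '' S) := by
  unfold TopGenerates
  rw [← MonoidHom.map_closure, Subgroup.coe_map]
  exact hs.denseRange.dense_image hf hS

theorem IsGI.descend {G G' : Type*} [Group G] [TopologicalSpace G] [Group G']
    [TopologicalSpace G'] {σ : G ≃ₜ* G} (h : IsGI σ) (f : G →* G') (hf : Continuous f)
    (hs : Function.Surjective f) (σ' : G' ≃ₜ* G') (hc : ∀ x, f (σ x) = σ' (f x)) : IsGI σ' := by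
  obtain ⟨S, hS, hinv⟩ := h
  refine ⟨f '' S, hS.image f hf hs, ?_⟩
  rintro _ ⟨x, hx, rfl⟩
  rw [← hc, hinv x hx, map_inv]

theorem IsGI.qEquiv {p : ℕ} {G : Type*} [Group G] [TopologicalSpace G] [IsTopologicalGroup G]
    {σ : G ≃ₜ* G} (h : IsGI σ) (c : ℕ) : IsGI (qEquiv p σ c) :=
  h.descend (QuotientGroup.mk' _) QuotientGroup.continuous_mk (QuotientGroup.mk'_surjective _) _
    fun _ => rfl

theorem surCount_congr {G G' H : Type*} [Group G] [TopologicalSpace G] [Group G']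
    [TopologicalSpace G'] [Group H] [TopologicalSpace H] (e : G ≃ₜ* G') (τ : G ≃ₜ* G)
    (τ' : G' ≃ₜ* G') (he : ∀ x, e (τ x) = τ' (e x)) (σ : H ≃ₜ* H) :
    surCount τ σ = surCount τ' σ := by
  unfold surCount
  congr 1
  have he' : ∀ y, e.symm (τ' y) = τ (e.symm y) := fun y => by
    apply e.injective
    rw [he, e.apply_symm_apply, e.apply_symm_apply]
  let a : SurSigma τ σ → SurSigma τ' σ := fun φ =>
    ⟨φ.1.comp (e.symm : G' →ₜ* G), φ.2.1.comp e.symm.surjective, fun x => by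
      change φ.1 (e.symm (τ' x)) = σ (φ.1 (e.symm x))
      rw [he', φ.2.2]⟩
  let b : SurSigma τ' σ → SurSigma τ σ := fun φ =>
    ⟨φ.1.comp (e : G →ₜ* G'), φ.2.1.comp e.surjective, fun x => by
      change φ.1 (e (τ x)) = σ (φ.1 (e x))
      rw [he, φ.2.2]⟩
  refine ENat.card_congr ⟨a, b, fun φ => Subtype.ext (ContinuousMonoidHom.ext fun x => ?_),
    fun φ => Subtype.ext (ContinuousMonoidHom.ext fun x => ?_)⟩
  · exact congrArg φ.1 (e.symm_apply_apply x)
  · exact congrArg φ.1 (e.apply_symm_apply x)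

/-- The continuous homomorphism induced on a quotient. -/
def quotLift {G H : Type*} [Group G] [TopologicalSpace G] [Group H] [TopologicalSpace H]
    (N : Subgroup G) [N.Normal] (f : G →ₜ* H) (h : ∀ x ∈ N, f x = 1) : (G ⧸ N) →ₜ* H where
  toMonoidHom := QuotientGroup.lift N (f : G →* H) h
  continuous_toFun := (QuotientGroup.isQuotientMap_mk _).continuous_iff.mpr f.continuous_toFun

/-- The projection to a quotient, as a continuous homomorphism. -/
def quotMk {G : Type*} [Group G] [TopologicalSpace G] (N : Subgroup G) [N.Normal] :
    G →ₜ* (G ⧸ N) where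
  toMonoidHom := QuotientGroup.mk' N
  continuous_toFun := QuotientGroup.continuous_mk

theorem quotMk_surjective {G : Type*} [Group G] [TopologicalSpace G] (N : Subgroup G) [N.Normal] :
    Function.Surjective (quotMk N) := QuotientGroup.mk'_surjective N

/-- Equivariant surjections from a quotient are those that kill the subgroup. -/
def surSigmaQuotEquiv {G H : Type*} [Group G] [TopologicalSpace G] [Group H] [TopologicalSpace H]
    (N : Subgroup G) [N.Normal] (τ : G →ₜ* G) (τ' : (G ⧸ N) ≃ₜ* (G ⧸ N))
    (hτ : ∀ x : G, τ' (x : G ⧸ N) = (τ x : G)) (σ : H ≃ₜ* H) :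
    SurSigma τ' σ ≃ {φ : G →ₜ* H // (Function.Surjective φ ∧ ∀ x, φ (τ x) = σ (φ x)) ∧
      ∀ x ∈ N, φ x = 1} where
  toFun φ := ⟨φ.1.comp (quotMk N), ⟨φ.2.1.comp (quotMk_surjective N), fun x => by
    change φ.1 ((τ x : G) : G ⧸ N) = σ (φ.1 (x : G ⧸ N))
    rw [← hτ, φ.2.2]⟩, fun x hx => by
    change φ.1 (x : G ⧸ N) = 1
    rw [(QuotientGroup.eq_one_iff x).mpr hx, map_one]⟩
  invFun φ := ⟨quotLift N φ.1 φ.2.2,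
    fun y => by
      obtain ⟨x, hx⟩ := φ.2.1.1 y
      exact ⟨(x : G ⧸ N), hx⟩, fun x => by
      obtain ⟨x, rfl⟩ := QuotientGroup.mk_surjective x
      rw [hτ]
      exact φ.2.1.2 x⟩
  left_inv φ := Subtype.ext (ContinuousMonoidHom.ext fun x => by
    obtain ⟨x, rfl⟩ := QuotientGroup.mk_surjective x
    rfl)
  right_inv φ := rfl

/-- A homomorphism to a group with `P_c = 1` kills `P_c`. -/
theorem map_eq_one_of_mem_lowerPSeries {p c : ℕ} {G H : Type*} [Group G] [TopologicalSpace G]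
    [IsTopologicalGroup G] [Group H] [TopologicalSpace H] [IsTopologicalGroup H]
    (hH : lowerPSeries p H c = ⊥) (φ : G →ₜ* H) (x : G) (hx : x ∈ lowerPSeries p G c) :
    φ x = 1 := by
  have : φ x ∈ lowerPSeries p H c := lowerPSeries_le_comap p G φ c hx
  rwa [hH, Subgroup.mem_bot] at this

theorem surCount_qEquiv {p c : ℕ} {G H : Type*} [Group G] [TopologicalSpace G]
    [IsTopologicalGroup G] [Group H] [TopologicalSpace H] [IsTopologicalGroup H]
    (hH : lowerPSeries p H c = ⊥) (τ : G ≃ₜ* G) (σ : H ≃ₜ* H) :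
    surCount (qEquiv p τ c) σ = surCount τ σ := by
  unfold surCount
  congr 1
  refine (ENat.card_congr (surSigmaQuotEquiv (lowerPSeries p G c) (τ : G →ₜ* G) _
    (fun x => rfl) σ)).trans (ENat.card_congr (Equiv.subtypeEquivRight fun φ => ?_))
  exact ⟨fun h => h.1, fun h => ⟨h, map_eq_one_of_mem_lowerPSeries hH φ⟩⟩

/-- The number of equivariant surjections to a group of `p`-class at most `c` depends neither on
the generator-inverting automorphism nor on more than the isomorphism class of a finite quotient
`P` isomorphic to `Q_c`. -/
theorem surCount_eq_of_equiv {p : ℕ} [Fact p.Prime] (hp : Odd p) {c : ℕ} {G P H : Type*} [Group G]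
    [TopologicalSpace G] [IsTopologicalGroup G] [Group P] [TopologicalSpace P]
    [DiscreteTopology P] [Finite P] (hP : IsPGroup p P) [Group H] [TopologicalSpace H]
    [IsTopologicalGroup H] (hH : lowerPSeries p H c = ⊥) {τ : G ≃ₜ* G} (hτ : IsGI τ)
    {ρ : P ≃ₜ* P} (hρ : IsGI ρ) (e : Q p G c ≃ₜ* P) (σ : H ≃ₜ* H) :
    surCount τ σ = surCount ρ σ := by
  rw [← surCount_qEquiv hH]
  let ρ' : P ≃ₜ* P := (e.symm.trans (qEquiv p τ c)).trans e
  have hc : ∀ x, e (qEquiv p τ c x) = ρ' (e x) := fun x => by simp [ρ']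
  have h1 : IsGI ρ' := (hτ.qEquiv (p := p) c).descend (e : Q p G c →* P) e.continuous e.surjective _ hc
  rw [surCount_congr e _ ρ' hc]
  obtain ⟨ψ, hψ⟩ := IsGI.conj hp hP h1 hρ
  exact surCount_congr ψ _ _ hψ σ

/-! ### Finiteness of the quotients `Q_n` -/

theorem lowerPSeries_isClosed (p : ℕ) (G : Type*) [Group G] [TopologicalSpace G]
    [IsTopologicalGroup G] (n : ℕ) : IsClosed (lowerPSeries p G n : Set G) := by
  cases n with
  | zero => exact isClosed_univ
  | succ n => exact Subgroup.isClosed_topologicalClosure _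

theorem finite_frattiniQuotient {p : ℕ} [Fact p.Prime] (Γ : Type*) [Group Γ] [TopologicalSpace Γ]
    [IsTopologicalGroup Γ] [Group.FG Γ] : Finite (Γ ⧸ lowerPSeries p Γ 1) := by
  let _ : CommGroup (Γ ⧸ lowerPSeries p Γ 1) :=
    { (inferInstance : Group (Γ ⧸ lowerPSeries p Γ 1)) with mul_comm := frattiniQuotient_comm }
  have : Group.FG (Γ ⧸ lowerPSeries p Γ 1) := QuotientGroup.fg _
  refine CommGroup.finite_of_fg_isMulTorsion _ fun x => ?_
  exact isOfFinOrder_iff_pow_eq_one.mpr ⟨p, (Fact.out : p.Prime).pos, frattiniQuotient_pow x⟩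

theorem exists_finiteIndex_le_lowerPSeries {p : ℕ} [Fact p.Prime] {G : Type*} [Group G]
    [TopologicalSpace G] [IsTopologicalGroup G] (Γ : Subgroup G) [Group.FG Γ] (n : ℕ) :
    ∃ M : Subgroup Γ, M.FiniteIndex ∧ ∀ x ∈ M, (x : G) ∈ lowerPSeries p G n := by
  induction n with
  | zero => exact ⟨⊤, inferInstance, fun x _ => Subgroup.mem_top _⟩
  | succ n ih =>
    obtain ⟨M, hM, hle⟩ := ih
    have : Group.FG M := Subgroup.fg_of_index_ne_zero M
    let _ : TopologicalSpace M := ⊥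
    have : DiscreteTopology M := ⟨rfl⟩
    have hfin := finite_frattiniQuotient (p := p) M
    refine ⟨(lowerPSeries p M 1).map M.subtype, ⟨?_⟩, ?_⟩
    · rw [Subgroup.index_map_subtype]
      exact mul_ne_zero (Subgroup.finiteIndex_of_finite_quotient).index_ne_zero hM.index_ne_zero
    · rintro _ ⟨x, hx, rfl⟩
      rw [SetLike.mem_coe, lowerPSeries_discrete_succ] at hx
      induction hx using Subgroup.closure_induction with
      | mem x hx =>
        refine Subgroup.le_topologicalClosure _ (Subgroup.subset_closure ?_)
        rcases hx with ⟨a, b, -, rfl⟩ | ⟨a, -, rfl⟩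
        · exact Or.inl ⟨a, b, hle b b.2, by simp⟩
        · exact Or.inr ⟨a, hle a a.2, by simp⟩
      | one => exact Subgroup.one_mem _
      | mul x y _ _ hx hy => exact Subgroup.mul_mem _ hx hy
      | inv x _ hx => exact Subgroup.inv_mem _ hx

/-- A dense subgroup whose image in a Hausdorff quotient is finite fills this quotient. -/
theorem finite_quotient_of_dense {G : Type*} [Group G] [TopologicalSpace G] [IsTopologicalGroup G]
    (Γ : Subgroup G) (hΓ : Dense (Γ : Set G)) (N : Subgroup G) [N.Normal]
    (hN : IsClosed (N : Set G)) (M : Subgroup Γ) [M.FiniteIndex] (hM : ∀ x ∈ M, (x : G) ∈ N) :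
    Finite (G ⧸ N) := by
  have : T1Space (G ⧸ N) := QuotientGroup.t1Space_iff.mpr hN
  let q : Γ →* G ⧸ N := (QuotientGroup.mk' N).comp Γ.subtype
  have hle : M ≤ q.ker := fun x hx => (QuotientGroup.eq_one_iff _).mpr (hM x hx)
  have : q.ker.FiniteIndex := Subgroup.finiteIndex_of_le hle
  have hfin : (q.range : Set (G ⧸ N)).Finite :=
    have : Finite q.range := Finite.of_equiv _ (QuotientGroup.quotientKerEquivRange q).toEquiv
    Set.toFinite _
  have hd : Dense (q.range : Set (G ⧸ N)) := by
    have : (q.range : Set (G ⧸ N)) = QuotientGroup.mk '' (Γ : Set G) := by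
      ext y
      constructor
      · rintro ⟨x, rfl⟩; exact ⟨x, x.2, rfl⟩
      · rintro ⟨x, hx, rfl⟩; exact ⟨⟨x, hx⟩, rfl⟩
    rw [this]
    exact QuotientGroup.mk_surjective.denseRange.dense_image QuotientGroup.continuous_mk hΓ
  have huniv : (q.range : Set (G ⧸ N)) = Set.univ := by
    rw [← hd.closure_eq, hfin.isClosed.closure_eq]
  exact Set.finite_univ_iff.mp (huniv ▸ hfin)

theorem finite_Q {p : ℕ} [Fact p.Prime] {G : Type*} [Group G] [TopologicalSpace G]
    [IsTopologicalGroup G] {S : Set G} (hS : S.Finite) (hgen : TopGenerates S) (n : ℕ) :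
    Finite (Q p G n) := by
  have : Group.FG (Subgroup.closure S) := by
    have : Finite S := hS
    exact Group.closure_finite_fg S
  obtain ⟨M, hM, hle⟩ := exists_finiteIndex_le_lowerPSeries (p := p) (Subgroup.closure S) n
  exact finite_quotient_of_dense _ hgen _ (lowerPSeries_isClosed p G n) M hle

theorem discrete_Q {p : ℕ} {G : Type*} [Group G] [TopologicalSpace G]
    [IsTopologicalGroup G] (n : ℕ) [Finite (Q p G n)] : DiscreteTopology (Q p G n) := by
  have : T1Space (Q p G n) := QuotientGroup.t1Space_iff.mpr (lowerPSeries_isClosed p G n)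
  infer_instance

theorem pow_mem_lowerPSeries (p : ℕ) {G : Type*} [Group G] [TopologicalSpace G]
    [IsTopologicalGroup G] (n : ℕ) (x : G) : x ^ p ^ n ∈ lowerPSeries p G n := by
  induction n with
  | zero => exact Subgroup.mem_top _
  | succ n ih =>
    rw [pow_succ, pow_mul]
    exact Subgroup.le_topologicalClosure _ (Subgroup.subset_closure (Or.inr ⟨_, ih, rfl⟩))

theorem isPGroup_Q (p : ℕ) {G : Type*} [Group G] [TopologicalSpace G]
    [IsTopologicalGroup G] (n : ℕ) : IsPGroup p (Q p G n) := by
  intro x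
  obtain ⟨x, rfl⟩ := QuotientGroup.mk_surjective x
  exact ⟨n, (QuotientGroup.eq_one_iff _).mpr (pow_mem_lowerPSeries p n x)⟩

/-! ### Quotients of pro-`p` groups -/

theorem IsProP.quotient {p : ℕ} {G : Type*} [Group G] [TopologicalSpace G]
    [IsTopologicalGroup G] (hG : IsProP p G) (N : Subgroup G) [N.Normal]
    (hN : IsClosed (N : Set G)) : IsProP p (G ⧸ N) := by
  have := hG.compact
  have := hG.t2
  have := hG.totallyDisconnected
  have : IsClosed (N : Set G) := hN
  have hT3 : T3Space (G ⧸ N) := inferInstance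
  refine ⟨inferInstance, inferInstance, ?_, ?_⟩
  · rw [totallyDisconnectedSpace_iff_connectedComponent_one]
    refine Set.Subset.antisymm (fun y hy => ?_)
      (Set.singleton_subset_iff.mpr mem_connectedComponent)
    obtain ⟨x, rfl⟩ := QuotientGroup.mk_surjective y
    by_contra hx
    have hxN : x ∉ N := fun h => hx ((QuotientGroup.eq_one_iff x).mpr h)
    have hV : IsOpen ((fun z => x⁻¹ * z) ⁻¹' (N : Set G)ᶜ) :=
      hN.isOpen_compl.preimage (continuous_const_mul _)
    obtain ⟨U, hU⟩ := ProfiniteGrp.exist_openNormalSubgroup_sub_open_nhds_of_one hV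
      (by simpa using hxN)
    let W : Subgroup (G ⧸ N) := U.toSubgroup.map (QuotientGroup.mk' N)
    have hW : IsOpen (W : Set (G ⧸ N)) := QuotientGroup.isOpenMap_coe _ U.isOpen'
    have hclopen : IsClopen (W : Set (G ⧸ N)) := ⟨W.isClosed_of_isOpen hW, hW⟩
    obtain ⟨u, hu, hux⟩ := hclopen.connectedComponent_subset W.one_mem hy
    exact hU hu (QuotientGroup.eq.mp hux.symm)
  · intro M hM hopen
    obtain ⟨k, hk⟩ := hG.index (M.comap (QuotientGroup.mk' N)) inferInstance
      (hopen.preimage QuotientGroup.continuous_mk)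
    exact ⟨k, by rw [← hk, Subgroup.index_comap_of_surjective _ (QuotientGroup.mk'_surjective N)]⟩

/-! ### The free pro-`p` group -/

section Free

variable {p g : ℕ}

theorem PIndex.finiteIndex [Fact p.Prime] (N : PIndex p g) : N.toSubgroup.FiniteIndex := by
  obtain ⟨k, hk⟩ := N.index_eq
  exact ⟨by rw [hk]; exact pow_ne_zero _ (Fact.out : p.Prime).ne_zero⟩

instance Level.finite [Fact p.Prime] (N : PIndex p g) : Finite (Level N) := by
  have := N.finiteIndex
  exact inferInstanceAs (Finite (FreeGroup (Fin g) ⧸ N.toSubgroup))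

theorem isClosed_freeProPSubgroup :
    IsClosed (freeProPSubgroup p g : Set (∀ N : PIndex p g, Level N)) := by
  have : (freeProPSubgroup p g : Set (∀ N : PIndex p g, Level N)) =
      ⋂ (M : PIndex p g) (N : PIndex p g) (h : M.toSubgroup ≤ N.toSubgroup),
        {x | Level.proj M N h (x M) = x N} := by
    ext x; simp [freeProPSubgroup]
  rw [this]
  refine isClosed_iInter fun M => isClosed_iInter fun N => isClosed_iInter fun h => ?_
  exact isClosed_eq (continuous_of_discreteTopology.comp (continuous_apply M)) (continuous_apply N)

instance [Fact p.Prime] : CompactSpace (FreeProP p g) :=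
  isCompact_iff_compactSpace.mp isClosed_freeProPSubgroup.isCompact

/-- The intersection of two normal subgroups of `p`-power index. -/
def PIndex.inf [Fact p.Prime] (M N : PIndex p g) : PIndex p g where
  toSubgroup := M.toSubgroup ⊓ N.toSubgroup
  normal := inferInstance
  index_eq := by
    obtain ⟨k, hk⟩ := M.index_eq
    obtain ⟨l, hl⟩ := N.index_eq
    have h1 : (M.toSubgroup ⊓ N.toSubgroup).index ∣ p ^ (k + l) := by
      rw [pow_add, ← hk, ← hl, ← Subgroup.relIndex_mul_index (inf_le_right :
        M.toSubgroup ⊓ N.toSubgroup ≤ N.toSubgroup), Subgroup.inf_relIndex_right]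
      exact mul_dvd_mul (Subgroup.relIndex_dvd_index_of_normal _ _) dvd_rfl
    obtain ⟨m, -, hm⟩ := (Nat.dvd_prime_pow Fact.out).mp h1
    exact ⟨m, hm⟩

theorem exists_pIndex_le [Fact p.Prime] (I : Finset (PIndex p g)) :
    ∃ M : PIndex p g, ∀ N ∈ I, M.toSubgroup ≤ N.toSubgroup := by
  classical
  induction I using Finset.induction_on with
  | empty => exact ⟨⟨⊤, inferInstance, 0, by simp⟩, by simp⟩
  | insert N I _ ih =>
    obtain ⟨M, hM⟩ := ih
    refine ⟨M.inf N, fun L hL => ?_⟩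
    rcases Finset.mem_insert.mp hL with rfl | hL
    · exact inf_le_right
    · exact inf_le_left.trans (hM L hL)

/-- The kernels of the projections to the levels are a neighbourhood basis. -/
theorem exists_level_subset [Fact p.Prime] {U : Set (FreeProP p g)} (hU : IsOpen U)
    {x : FreeProP p g} (hx : x ∈ U) :
    ∃ M : PIndex p g, ∀ y : FreeProP p g, y.1 M = x.1 M → y ∈ U := by
  obtain ⟨V, hV, rfl⟩ := isOpen_induced_iff.mp hU
  obtain ⟨I, u, hu, hsub⟩ := isOpen_pi_iff.mp hV x.1 hx
  obtain ⟨M, hM⟩ := exists_pIndex_le I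
  refine ⟨M, fun y hy => hsub fun N hN => ?_⟩
  have h1 := x.2 M N (hM N hN)
  have h2 := y.2 M N (hM N hN)
  rw [hy, h1] at h2
  rw [← h2]
  exact (hu N hN).2

theorem denseRange_ofWord [Fact p.Prime] : DenseRange (ofWord p g) := by
  intro x
  rw [mem_closure_iff]
  intro U hU hx
  obtain ⟨M, hM⟩ := exists_level_subset hU hx
  obtain ⟨w, hw⟩ := Level.mk_surjective M (x.1 M)
  exact ⟨ofWord p g w, hM _ hw, w, rfl⟩

variable (p g) in
/-- The free generators. -/
def freeGen (i : Fin g) : FreeProP p g := ofWord p g (FreeGroup.of i)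

theorem topGenerates_freeGen [Fact p.Prime] : TopGenerates (Set.range (freeGen p g)) := by
  have : (Subgroup.closure (Set.range (freeGen p g)) : Set (FreeProP p g)) =
      Set.range (ofWord p g) := by
    rw [← MonoidHom.coe_range, MonoidHom.range_eq_map, ← FreeGroup.closure_range_of,
      MonoidHom.map_closure, ← Set.range_comp]
    rfl
  unfold TopGenerates
  rw [this]
  exact denseRange_ofWord

theorem freeProP_hom_ext [Fact p.Prime] {E : Type*} [Group E] [TopologicalSpace E] [T2Space E]
    {φ ψ : FreeProP p g →ₜ* E} (h : ∀ i, φ (freeGen p g i) = ψ (freeGen p g i)) : φ = ψ := by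
  have h1 : (φ : FreeProP p g →* E).comp (ofWord p g) =
      (ψ : FreeProP p g →* E).comp (ofWord p g) := FreeGroup.ext_hom _ _ h
  apply DFunLike.coe_injective
  exact denseRange_ofWord.equalizer φ.continuous_toFun ψ.continuous_toFun
    (funext fun w => DFunLike.congr_fun h1 w)

/-- The universal property of the free pro-`p` group, for finite `p`-groups. -/
theorem exists_freeProP_hom [Fact p.Prime] {E : Type*} [Group E] [TopologicalSpace E]
    [Finite E] (hE : IsPGroup p E) (f : Fin g → E) :
    ∃ φ : FreeProP p g →ₜ* E, ∀ i, φ (freeGen p g i) = f i := by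
  let F : FreeGroup (Fin g) →* E := FreeGroup.lift f
  have hidx : ∃ k, F.ker.index = p ^ k := by
    rw [Subgroup.index_ker]
    exact (hE.to_subgroup _).exists_card_eq
  let N : PIndex p g := ⟨F.ker, inferInstance, hidx⟩
  let ev : FreeProP p g →* Level N := (Pi.evalMonoidHom _ N).comp (freeProPSubgroup p g).subtype
  let q : Level N →* E := QuotientGroup.kerLift F
  refine ⟨⟨q.comp ev, ?_⟩, fun i => ?_⟩
  · exact (continuous_of_discreteTopology (f := q)).comp
      ((continuous_apply N).comp continuous_subtype_val)
  · exact (FreeGroup.lift_apply_of : F (FreeGroup.of i) = f i)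

theorem isProP_freeProP [Fact p.Prime] : IsProP p (FreeProP p g) := by
  refine ⟨inferInstance, inferInstance, inferInstance, fun U hU hopen => ?_⟩
  obtain ⟨M, hM⟩ := exists_level_subset hopen U.one_mem
  have hsurj : Function.Surjective ((QuotientGroup.mk' U).comp (ofWord p g)) := by
    intro y
    obtain ⟨x, rfl⟩ := QuotientGroup.mk_surjective y
    have hV : IsOpen ((fun y => x⁻¹ * y) ⁻¹' (U : Set (FreeProP p g))) :=
      hopen.preimage (continuous_const_mul _)
    obtain ⟨w, hw⟩ := denseRange_ofWord.exists_mem_open hV ⟨x, by simp [U.one_mem]⟩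
    exact ⟨w, (QuotientGroup.eq.mpr hw).symm⟩
  have hle : M.toSubgroup ≤ ((QuotientGroup.mk' U).comp (ofWord p g)).ker := by
    intro w hw
    refine (QuotientGroup.eq_one_iff _).mpr (hM _ ?_)
    exact (QuotientGroup.eq_one_iff _).mpr hw
  have hidx : ((QuotientGroup.mk' U).comp (ofWord p g)).ker.index = U.index := by
    rw [Subgroup.index_ker, MonoidHom.range_eq_top.mpr hsurj, Subgroup.card_top]
    rfl
  obtain ⟨k, hk⟩ := M.index_eq
  have := Subgroup.index_dvd_of_le hle
  rw [hk, hidx] at this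
  obtain ⟨m, -, hm⟩ := (Nat.dvd_prime_pow Fact.out).mp this
  exact ⟨m, hm⟩

instance finite_Q_freeProP [Fact p.Prime] (n : ℕ) : Finite (Q p (FreeProP p g) n) :=
  finite_Q (Set.finite_range (freeGen p g)) topGenerates_freeGen n

instance discrete_Q_freeProP [Fact p.Prime] (n : ℕ) : DiscreteTopology (Q p (FreeProP p g) n) :=
  discrete_Q n

end Free

/-! ### The groups presented by relations -/

theorem lowerPSeries_le_map (p : ℕ) {G E : Type*} [Group G] [TopologicalSpace G]
    [IsTopologicalGroup G] [Group E] [TopologicalSpace E] [DiscreteTopology E] (f : G →* E)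
    (hf : Function.Surjective f) (n : ℕ) : lowerPSeries p E n ≤ (lowerPSeries p G n).map f := by
  induction n with
  | zero => exact (Subgroup.map_top_of_surjective f hf).ge
  | succ n ih =>
    rw [lowerPSeries_discrete_succ, Subgroup.closure_le]
    rintro _ (⟨a, b, hb, rfl⟩ | ⟨b, hb, rfl⟩)
    · obtain ⟨a, rfl⟩ := hf a
      obtain ⟨b, hb', rfl⟩ := ih hb
      exact ⟨a * b * a⁻¹ * b⁻¹, Subgroup.le_topologicalClosure _
        (Subgroup.subset_closure (Or.inl ⟨a, b, hb', rfl⟩)), by simp⟩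
    · obtain ⟨b, hb', rfl⟩ := ih hb
      exact ⟨b ^ p, Subgroup.le_topologicalClosure _
        (Subgroup.subset_closure (Or.inr ⟨b, hb', rfl⟩)), by simp⟩

theorem lowerPSeries_Q {p : ℕ} {G : Type*} [Group G] [TopologicalSpace G]
    [IsTopologicalGroup G] (n : ℕ) [DiscreteTopology (Q p G n)] :
    lowerPSeries p (Q p G n) n = ⊥ := by
  rw [eq_bot_iff]
  refine (lowerPSeries_le_map p (QuotientGroup.mk' (lowerPSeries p G n))
    (QuotientGroup.mk'_surjective _) n).trans ?_
  rw [QuotientGroup.map_mk'_self]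

section

variable {p g : ℕ}

variable (p g) in
/-- `σ` as an automorphism of the free pro-`p` group. -/
def sigmaEquiv : FreeProP p g ≃ₜ* FreeProP p g where
  toFun := sigmaFree p g
  invFun := sigmaFree p g
  left_inv := sigmaFree_sigmaFree p g
  right_inv := sigmaFree_sigmaFree p g
  map_mul' := map_mul _
  continuous_toFun := (sigmaFree p g).continuous_toFun
  continuous_invFun := (sigmaFree p g).continuous_toFun

theorem isGI_sigmaEquiv [Fact p.Prime] : IsGI (sigmaEquiv p g) := by
  refine ⟨_, topGenerates_freeGen, ?_⟩
  rintro _ ⟨i, rfl⟩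
  exact sigmaFree_gen p g i

theorem isClosed_relSubgroup (r : Fin g → RelX p g) :
    IsClosed (relSubgroup r : Set (FreeProP p g)) := Subgroup.isClosed_topologicalClosure _

theorem rel_mem_relSubgroup (r : Fin g → RelX p g) (i : Fin g) : (r i).1 ∈ relSubgroup r :=
  Subgroup.le_topologicalClosure _ (Subgroup.subset_normalClosure ⟨i, rfl⟩)

/-- The relation subgroup is the least closed normal subgroup containing the relations. -/
theorem relSubgroup_le (r : Fin g → RelX p g) (N : Subgroup (FreeProP p g)) [N.Normal]
    (hN : IsClosed (N : Set (FreeProP p g))) (h : ∀ i, (r i).1 ∈ N) : relSubgroup r ≤ N := by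
  refine Subgroup.topologicalClosure_minimal _ (Subgroup.normalClosure_le_normal ?_) hN
  rintro _ ⟨i, rfl⟩
  exact h i

theorem relSubgroup_le_ker (r : Fin g → RelX p g) {E : Type*} [Group E] [TopologicalSpace E]
    [T1Space E] (φ : FreeProP p g →ₜ* E) (h : ∀ i, φ (r i).1 = 1) :
    ∀ x ∈ relSubgroup r, φ x = 1 := by
  intro x hx
  have hle := relSubgroup_le r (φ : FreeProP p g →* E).ker
    (by exact (isClosed_singleton (x := (1 : E))).preimage φ.continuous_toFun) h
  exact hle hx

theorem sigmaFree_mem_relSubgroup (r : Fin g → RelX p g) :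
    relSubgroup r ≤ (relSubgroup r).comap (sigmaFree p g : FreeProP p g →* FreeProP p g) := by
  refine relSubgroup_le r _ ((isClosed_relSubgroup r).preimage (sigmaFree p g).continuous_toFun)
    fun i => ?_
  change sigmaFree p g (r i).1 ∈ relSubgroup r
  rw [(r i).2.2]
  exact inv_mem (rel_mem_relSubgroup r i)

/-- The endomorphism of the presented group induced by `σ`. -/
def presentedHom (r : Fin g → RelX p g) : presented r →ₜ* presented r where
  toMonoidHom := QuotientGroup.map _ _ (sigmaFree p g : FreeProP p g →* FreeProP p g)
    (sigmaFree_mem_relSubgroup r)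
  continuous_toFun := (QuotientGroup.isQuotientMap_mk (relSubgroup r)).continuous_iff.mpr
    (QuotientGroup.continuous_mk.comp (sigmaFree p g).continuous_toFun)

theorem presentedHom_presentedHom (r : Fin g → RelX p g) (x : presented r) :
    presentedHom r (presentedHom r x) = x := by
  obtain ⟨x, rfl⟩ := QuotientGroup.mk_surjective (s := relSubgroup r) x
  exact congrArg QuotientGroup.mk (sigmaFree_sigmaFree p g x)

/-- The automorphism of the presented group induced by `σ`. -/
def presentedSigma (r : Fin g → RelX p g) : presented r ≃ₜ* presented r where
  toFun := presentedHom r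
  invFun := presentedHom r
  left_inv := presentedHom_presentedHom r
  right_inv := presentedHom_presentedHom r
  map_mul' := map_mul _
  continuous_toFun := (presentedHom r).continuous_toFun
  continuous_invFun := (presentedHom r).continuous_toFun

theorem isGI_presentedSigma [Fact p.Prime] (r : Fin g → RelX p g) : IsGI (presentedSigma r) :=
  isGI_sigmaEquiv.descend (QuotientGroup.mk' (relSubgroup r)) QuotientGroup.continuous_mk
    (QuotientGroup.mk'_surjective _) _ fun _ => rfl

theorem isProP_presented [Fact p.Prime] (r : Fin g → RelX p g) : IsProP p (presented r) :=
  isProP_freeProP.quotient (relSubgroup r) (isClosed_relSubgroup r)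

theorem fg_presented [Fact p.Prime] (r : Fin g → RelX p g) :
    ∃ S : Set (presented r), S.Finite ∧ TopGenerates S :=
  ⟨_, (Set.finite_range (freeGen p g)).image (QuotientGroup.mk' (relSubgroup r)),
    topGenerates_freeGen.image (QuotientGroup.mk' (relSubgroup r)) QuotientGroup.continuous_mk
    (QuotientGroup.mk'_surjective _)⟩

instance [Fact p.Prime] (r : Fin g → RelX p g) (c : ℕ) : Finite (Q p (presented r) c) := by
  obtain ⟨S, hS, hgen⟩ := fg_presented r
  exact finite_Q hS hgen c

instance [Fact p.Prime] (r : Fin g → RelX p g) (c : ℕ) : DiscreteTopology (Q p (presented r) c) :=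
  discrete_Q c

/-- `Q_c` of the presented group depends only on the relations modulo `P_c`. -/
theorem exists_qHom_of_rel_eq [Fact p.Prime] {c : ℕ} (r r' : Fin g → RelX p g)
    (h : ∀ i, ((r i).1 : Q p (FreeProP p g) c) = (r' i).1) :
    ∃ f : Q p (presented r) c →ₜ* Q p (presented r') c, ∀ x : FreeProP p g,
      f (QuotientGroup.mk (QuotientGroup.mk x : FreeProP p g ⧸ relSubgroup r)) =
        QuotientGroup.mk (QuotientGroup.mk x : FreeProP p g ⧸ relSubgroup r') := by
  let q' : FreeProP p g →ₜ* Q p (presented r') c :=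
    (quotMk (lowerPSeries p (presented r') c)).comp (quotMk (relSubgroup r'))
  have hbot : lowerPSeries p (Q p (presented r') c) c = ⊥ := lowerPSeries_Q c
  have hq : ∀ i, q' (r i).1 = 1 := by
    intro i
    have h1 := map_eq_one_of_mem_lowerPSeries hbot q' _ (QuotientGroup.eq.mp (h i))
    rw [map_mul, map_inv, inv_mul_eq_one] at h1
    rw [h1]
    have h2 : quotMk (relSubgroup r') (r' i).1 = 1 :=
      (QuotientGroup.eq_one_iff _).mpr (rel_mem_relSubgroup r' i)
    change quotMk (lowerPSeries p (presented r') c) (quotMk (relSubgroup r') (r' i).1) = 1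
    rw [h2]
    exact map_one _
  let f1 : presented r →ₜ* Q p (presented r') c :=
    quotLift (relSubgroup r) q' (relSubgroup_le_ker r q' hq)
  exact ⟨quotLift _ f1 (map_eq_one_of_mem_lowerPSeries hbot f1), fun x => rfl⟩

theorem nonempty_qEquiv_of_rel_eq [Fact p.Prime] {c : ℕ} (r r' : Fin g → RelX p g)
    (h : ∀ i, ((r i).1 : Q p (FreeProP p g) c) = (r' i).1) :
    Nonempty (Q p (presented r) c ≃ₜ* Q p (presented r') c) := by
  obtain ⟨f, hf⟩ := exists_qHom_of_rel_eq r r' h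
  obtain ⟨f', hf'⟩ := exists_qHom_of_rel_eq r' r fun i => (h i).symm
  refine ⟨⟨⟨⟨f, f', fun x => ?_, fun x => ?_⟩, map_mul f⟩, f.continuous_toFun,
    f'.continuous_toFun⟩⟩
  · obtain ⟨y, rfl⟩ := QuotientGroup.mk_surjective x
    obtain ⟨z, rfl⟩ := QuotientGroup.mk_surjective (s := relSubgroup r) y
    exact (congrArg f' (hf z)).trans (hf' z)
  · obtain ⟨y, rfl⟩ := QuotientGroup.mk_surjective x
    obtain ⟨z, rfl⟩ := QuotientGroup.mk_surjective (s := relSubgroup r') y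
    exact (congrArg f (hf' z)).trans (hf z)

/-- Equivariant surjections from the presented group to a finite group are the equivariant
surjections from the free pro-`p` group that kill the relations. -/
theorem surCount_presentedSigma (r : Fin g → RelX p g) {H : Type*} [Group H] [TopologicalSpace H]
    [T1Space H] (σ : H ≃ₜ* H) :
    surCount (presentedSigma r) σ =
      (ENat.card {φ : SurSigma (sigmaEquiv p g) σ // ∀ i, φ.1 (r i).1 = 1} : ℝ≥0∞) := by
  unfold surCount
  congr 1
  refine (ENat.card_congr (surSigmaQuotEquiv (relSubgroup r) (sigmaFree p g) (presentedSigma r)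
    (fun x => rfl) σ)).trans (ENat.card_congr
    { toFun := fun φ => ⟨⟨φ.1, φ.2.1⟩, fun i => φ.2.2 _ (rel_mem_relSubgroup r i)⟩
      invFun := fun φ => ⟨φ.1.1, φ.1.2, relSubgroup_le_ker r φ.1.1 φ.2⟩
      left_inv := fun φ => rfl
      right_inv := fun φ => rfl })

end

/-! ### Second cohomology of free pro-`p` groups -/

/-- The central extension of `P` by `ℤ/p` with factor set `f`. -/
structure TwistedProd (p : ℕ) {P : Type*} (f : P × P → ZMod p) where
  /-- The coordinate in `ℤ/p`. -/
  fst : ZMod p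
  /-- The coordinate in `P`. -/
  snd : P

namespace TwistedProd

variable {p : ℕ} {P : Type*} [Group P] {f : P × P → ZMod p}

/-- The group law `(a, x)(b, y) = (a + b + f(x, y), xy)`. -/
@[reducible] def group (hf : ∀ x y z, f (y, z) - f (x * y, z) + f (x, y * z) - f (x, y) = 0) :
    Group (TwistedProd p f) :=
  letI : Mul (TwistedProd p f) := ⟨fun u v => ⟨u.fst + v.fst + f (u.snd, v.snd), u.snd * v.snd⟩⟩
  letI : One (TwistedProd p f) := ⟨⟨-f (1, 1), 1⟩⟩
  letI : Inv (TwistedProd p f) := ⟨fun u => ⟨-u.fst - f (u.snd⁻¹, u.snd) - f (1, 1), u.snd⁻¹⟩⟩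
  Group.ofLeftAxioms
    (fun u v w => by
      change TwistedProd.mk (u.fst + v.fst + f (u.snd, v.snd) + w.fst +
          f (u.snd * v.snd, w.snd)) _ = TwistedProd.mk (u.fst + (v.fst + w.fst +
          f (v.snd, w.snd)) + f (u.snd, v.snd * w.snd)) _
      have h := hf u.snd v.snd w.snd
      congr 1
      · linear_combination -h
      · exact mul_assoc _ _ _)
    (fun u => by
      obtain ⟨a, x⟩ := u
      change TwistedProd.mk (-f (1, 1) + a + f (1, x)) _ = _
      have h := hf 1 1 x
      simp only [one_mul] at h
      congr 1
      · linear_combination h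
      · exact one_mul _)
    (fun u => by
      change TwistedProd.mk (-u.fst - f (u.snd⁻¹, u.snd) - f (1, 1) + u.fst +
        f (u.snd⁻¹, u.snd)) _ = TwistedProd.mk (-f (1, 1)) _
      congr 1
      · ring
      · exact inv_mul_cancel _)

variable (p f) in
/-- The underlying set of the extension. -/
def equivProd : TwistedProd p f ≃ ZMod p × P where
  toFun u := (u.fst, u.snd)
  invFun u := ⟨u.1, u.2⟩
  left_inv _ := rfl
  right_inv _ := rfl

end TwistedProd

section

variable {p g : ℕ}

/-- The projection to a level, as a continuous homomorphism. -/
def levelProj (M : PIndex p g) : FreeProP p g →ₜ* Level M where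
  toMonoidHom := (Pi.evalMonoidHom _ M).comp (freeProPSubgroup p g).subtype
  continuous_toFun := (continuous_apply M).comp continuous_subtype_val

theorem levelProj_surjective (M : PIndex p g) : Function.Surjective (levelProj M) := fun y => by
  obtain ⟨w, rfl⟩ := Level.mk_surjective M y
  exact ⟨ofWord p g w, rfl⟩

/-- A locally constant function of two variables on the free pro-`p` group factors through
some level. -/
theorem exists_level_factor [Fact p.Prime] {α : Type*} {f : FreeProP p g × FreeProP p g → α}
    (hf : IsLocallyConstant f) : ∃ M : PIndex p g, ∀ x y x' y', levelProj M x = levelProj M x' →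
      levelProj M y = levelProj M y' → f (x, y) = f (x', y') := by
  have h1 : ∀ z : FreeProP p g × FreeProP p g, ∃ M : PIndex p g, ∀ w,
      levelProj M w.1 = levelProj M z.1 → levelProj M w.2 = levelProj M z.2 → f w = f z := by
    intro z
    obtain ⟨U, hU, hzU, hconst⟩ := IsLocallyConstant.iff_exists_open f |>.mp hf z
    obtain ⟨V, W, hV, hW, hzV, hzW, hsub⟩ := isOpen_prod_iff.mp hU z.1 z.2 hzU
    obtain ⟨M, hM⟩ := exists_level_subset hV hzV
    obtain ⟨N, hN⟩ := exists_level_subset hW hzW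
    refine ⟨M.inf N, fun w hw1 hw2 => hconst w (hsub ⟨hM _ ?_, hN _ ?_⟩)⟩
    · rw [← w.1.2 (M.inf N) M inf_le_left, ← z.1.2 (M.inf N) M inf_le_left]
      exact congrArg _ hw1
    · rw [← w.2.2 (M.inf N) N inf_le_right, ← z.2.2 (M.inf N) N inf_le_right]
      exact congrArg _ hw2
  choose M hM using h1
  let V : FreeProP p g × FreeProP p g → Set (FreeProP p g × FreeProP p g) := fun z =>
    {w | levelProj (M z) w.1 = levelProj (M z) z.1 ∧ levelProj (M z) w.2 = levelProj (M z) z.2}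
  have hV : ∀ z, IsOpen (V z) := by
    intro z
    have hc := (levelProj (M z)).continuous_toFun
    exact ((isOpen_discrete {levelProj (M z) z.1}).preimage (hc.comp continuous_fst)).inter
      ((isOpen_discrete {levelProj (M z) z.2}).preimage (hc.comp continuous_snd))
  obtain ⟨t, -, ht⟩ := isCompact_univ.elim_nhds_subcover V
    fun z _ => (hV z).mem_nhds ⟨rfl, rfl⟩
  classical
  obtain ⟨N, hN⟩ := exists_pIndex_le (t.image M)
  refine ⟨N, fun x y x' y' hx hy => ?_⟩
  obtain ⟨z, hz, hxz, hyz⟩ : ∃ z ∈ t, (x, y) ∈ V z := by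
    simpa using ht (Set.mem_univ (x, y))
  have hle := hN _ (Finset.mem_image_of_mem M hz)
  have key : ∀ a b : FreeProP p g, levelProj N a = levelProj N b →
      levelProj (M z) a = levelProj (M z) b := by
    intro a b hab
    change a.1 (M z) = b.1 (M z)
    rw [← a.2 N (M z) hle, ← b.2 N (M z) hle]
    exact congrArg _ hab
  rw [hM z (x, y) hxz hyz, hM z (x', y') ((key _ _ hx).symm.trans hxz)
    ((key _ _ hy).symm.trans hyz)]

/-- `H²` of a free pro-`p` group vanishes: a cocycle comes from a finite quotient, and by the
universal property the corresponding finite central extension is split over the free group. -/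
theorem Z2_le_B2_freeProP [Fact p.Prime] : Z2 p (FreeProP p g) ≤ B2 p (FreeProP p g) := by
  rintro f ⟨hf, hcoc⟩
  obtain ⟨M, hM⟩ := exists_level_factor hf
  let s : Level M → FreeProP p g := Function.surjInv (levelProj_surjective M)
  have hs : ∀ y, levelProj M (s y) = y := Function.surjInv_eq (levelProj_surjective M)
  let f' : Level M × Level M → ZMod p := fun z => f (s z.1, s z.2)
  have hf' : ∀ x y, f (x, y) = f' (levelProj M x, levelProj M y) := fun x y =>
    hM _ _ _ _ (hs _).symm (hs _).symm
  have hcoc' : ∀ x y z, f' (y, z) - f' (x * y, z) + f' (x, y * z) - f' (x, y) = 0 := by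
    intro x y z
    have := hcoc (s x) (s y) (s z)
    simpa only [hf', map_mul, hs] using this
  let _ : Group (TwistedProd p f') := TwistedProd.group hcoc'
  let _ : TopologicalSpace (TwistedProd p f') := ⊥
  have : DiscreteTopology (TwistedProd p f') := ⟨rfl⟩
  have : Finite (TwistedProd p f') := Finite.of_equiv _ (TwistedProd.equivProd p f').symm
  have hcard : IsPGroup p (TwistedProd p f') := by
    obtain ⟨k, hk⟩ := M.index_eq
    have hk' : Nat.card (Level M) = p ^ k := hk
    refine IsPGroup.of_card (n := k + 1) ?_
    rw [Nat.card_congr (TwistedProd.equivProd p f'), Nat.card_prod, Nat.card_zmod, hk', pow_succ,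
      mul_comm]
  obtain ⟨φ, hφ⟩ := exists_freeProP_hom hcard
    (fun i : Fin g => (⟨0, levelProj M (freeGen p g i)⟩ : TwistedProd p f'))
  let π : TwistedProd p f' →ₜ* Level M :=
    { toFun := fun u => u.snd
      map_one' := rfl
      map_mul' := fun u v => rfl
      continuous_toFun := continuous_of_discreteTopology }
  have hπ : π.comp φ = levelProj M := freeProP_hom_ext fun i => by
    change (φ (freeGen p g i)).snd = _
    rw [hφ]
  have hsnd : ∀ x, (φ x).snd = levelProj M x := fun x => DFunLike.congr_fun hπ x
  refine ⟨fun x => -(φ x).fst, ?_, fun x y => ?_⟩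
  · exact (IsLocallyConstant.iff_continuous φ).mpr φ.continuous_toFun |>.comp
      (fun u : TwistedProd p f' => -u.fst)
  · have h1 : (φ (x * y)).fst = (φ x).fst + (φ y).fst + f' ((φ x).snd, (φ y).snd) := by
      rw [map_mul]; rfl
    rw [hsnd, hsnd, ← hf'] at h1
    beta_reduce
    rw [h1]; ring

/-! ### Generator and relation ranks of the presented groups -/

/-- A cocycle of the presented group whose splitting over the free group vanishes on the
relations is a coboundary: the splitting is an invariant homomorphism on the relation subgroup. -/
theorem mem_B2_of_split (r : Fin g → RelX p g)
    {z : presented r × presented r → ZMod p} {b : FreeProP p g → ZMod p}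
    (hb : IsLocallyConstant b)
    (h : ∀ x y : FreeProP p g, z ((x : FreeProP p g ⧸ relSubgroup r),
      (y : FreeProP p g ⧸ relSubgroup r)) = b y - b (x * y) + b x)
    (hr : ∀ i, b (r i).1 = b 1) : z ∈ B2 p (presented r) := by
  have hmk : ∀ n ∈ relSubgroup r, (n : FreeProP p g ⧸ relSubgroup r) = (1 : FreeProP p g) :=
    fun n hn => (QuotientGroup.eq_one_iff n).mpr hn
  have hright : ∀ x, ∀ n ∈ relSubgroup r, b (x * n) = b x + b n - b 1 := by
    intro x n hn
    have h1 := h x n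
    have h2 := h x 1
    rw [hmk n hn] at h1
    rw [mul_one] at h2
    linear_combination h1 - h2
  have hleft : ∀ x, ∀ n ∈ relSubgroup r, b (n * x) = b x + b n - b 1 := by
    intro x n hn
    have h1 := h n x
    have h2 := h 1 x
    rw [hmk n hn] at h1
    rw [one_mul] at h2
    linear_combination h1 - h2
  let N : Subgroup (FreeProP p g) :=
    { carrier := {n | n ∈ relSubgroup r ∧ b n = b 1}
      one_mem' := ⟨Subgroup.one_mem _, rfl⟩
      mul_mem' := fun {m n} hm hn => ⟨mul_mem hm.1 hn.1, by
        rw [hright _ _ hn.1, hm.2, hn.2]; ring⟩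
      inv_mem' := fun {n} hn => ⟨inv_mem hn.1, by
        have := hright n⁻¹ n hn.1
        rw [inv_mul_cancel, hn.2] at this
        linear_combination -this⟩ }
  have hN : N.Normal := by
    refine ⟨fun n hn x => ?_⟩
    have hc : x * n * x⁻¹ ∈ relSubgroup r := Subgroup.Normal.conj_mem inferInstance n hn.1 x
    refine ⟨hc, ?_⟩
    have h1 := hleft x _ hc
    rw [inv_mul_cancel_right, hright x n hn.1, hn.2] at h1
    linear_combination -h1
  have hNc : IsClosed (N : Set (FreeProP p g)) :=
    (isClosed_relSubgroup r).inter (hb.isClosed_fiber (b 1))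
  have hle : relSubgroup r ≤ N := relSubgroup_le r N hNc fun i => ⟨rel_mem_relSubgroup r i, hr i⟩
  have hinv : ∀ x y : FreeProP p g, (QuotientGroup.leftRel (relSubgroup r)) x y → b x = b y := by
    intro x y hxy
    rw [QuotientGroup.leftRel_apply] at hxy
    have h1 := hright x _ hxy
    rw [(hle hxy).2, mul_inv_cancel_left] at h1
    linear_combination -h1
  refine ⟨Quotient.lift b hinv, fun s => ?_, fun x y => ?_⟩
  · exact (QuotientGroup.isQuotientMap_mk (relSubgroup r)).isOpen_preimage.mp (hb s)
  · obtain ⟨x, rfl⟩ := QuotientGroup.mk_surjective (s := relSubgroup r) x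
    obtain ⟨y, rfl⟩ := QuotientGroup.mk_surjective (s := relSubgroup r) y
    exact h x y

/-- The relation rank is at most the number of relations. -/
theorem exists_H2_injective [Fact p.Prime] (r : Fin g → RelX p g) :
    ∃ f : H2 p (presented r) → Fin g → ZMod p, Function.Injective f := by
  let mk : FreeProP p g →ₜ* presented r := quotMk (relSubgroup r)
  have hsplit : ∀ z : Z2 p (presented r), ∃ b : FreeProP p g → ZMod p, IsLocallyConstant b ∧
      ∀ x y : FreeProP p g, z.1 (mk x, mk y) = b y - b (x * y) + b x := by
    intro z
    have hmem : (fun w : FreeProP p g × FreeProP p g => z.1 (mk w.1, mk w.2)) ∈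
        Z2 p (FreeProP p g) := by
      refine ⟨z.2.1.comp_continuous (Continuous.prodMk (mk.continuous_toFun.comp continuous_fst)
        (mk.continuous_toFun.comp continuous_snd)), fun x y w => ?_⟩
      simpa only [map_mul] using z.2.2 (mk x) (mk y) (mk w)
    obtain ⟨b, hb, hb'⟩ := Z2_le_B2_freeProP hmem
    exact ⟨b, hb, hb'⟩
  choose b hb hb' using hsplit
  refine ⟨fun c i => b c.out (r i).1 - b c.out 1, fun c c' hcc' => ?_⟩
  have h1 : (c.out - c'.out : Z2 p (presented r)) ∈
      (B2 p (presented r)).submoduleOf (Z2 p (presented r)) := by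
    refine mem_B2_of_split r (b := fun x => b c.out x - b c'.out x) ((hb _).sub (hb _)) ?_ ?_
    · intro x y
      have e1 := hb' c.out x y
      have e2 := hb' c'.out x y
      change c.out.1 (mk x, mk y) - c'.out.1 (mk x, mk y) = _
      rw [e1, e2]; ring
    · intro i
      have := congrFun hcc' i
      simp only at this
      linear_combination this
  have h2 := (Submodule.Quotient.eq _).mpr h1
  rwa [Submodule.Quotient.mk_out, Submodule.Quotient.mk_out] at h2

theorem lowerPSeries_one_eq_bot {p : ℕ} {A : Type*} [CommGroup A] [TopologicalSpace A]
    [DiscreteTopology A] (hA : ∀ x : A, x ^ p = 1) : lowerPSeries p A 1 = ⊥ := by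
  rw [lowerPSeries_discrete_succ, eq_bot_iff, Subgroup.closure_le]
  rintro _ (⟨a, b, -, rfl⟩ | ⟨b, -, rfl⟩)
  · simp
  · simp [hA]

/-- The presented group has generator rank `g`, since the relations lie in the Frattini
subgroup. -/
theorem exists_H1_injective [Fact p.Prime] (r : Fin g → RelX p g) :
    ∃ f : (Fin g → ZMod p) → H1 p (presented r), Function.Injective f := by
  let _ : TopologicalSpace (Multiplicative (ZMod p)) := ⊥
  have : DiscreteTopology (Multiplicative (ZMod p)) := ⟨rfl⟩
  have hexp : ∀ x : Multiplicative (ZMod p), x ^ p = 1 := fun x => by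
    change Multiplicative.ofAdd (p • x.toAdd) = 1
    simp
  have hP : IsPGroup p (Multiplicative (ZMod p)) := fun x => ⟨1, by simpa using hexp x⟩
  have hφ := fun v : Fin g → ZMod p =>
    exists_freeProP_hom hP fun i => Multiplicative.ofAdd (v i)
  choose φ hφ using hφ
  have hkill : ∀ v, ∀ x ∈ relSubgroup r, φ v x = 1 := fun v =>
    relSubgroup_le_ker r (φ v) fun i =>
      map_eq_one_of_mem_lowerPSeries (lowerPSeries_one_eq_bot hexp) (φ v) _ (r i).2.1
  let ψ : (Fin g → ZMod p) → presented r →ₜ* Multiplicative (ZMod p) := fun v =>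
    quotLift (relSubgroup r) (φ v) (hkill v)
  refine ⟨fun v => ⟨fun x => (ψ v x).toAdd, ?_, fun x y => ?_⟩, fun v v' h => funext fun i => ?_⟩
  · exact ((IsLocallyConstant.iff_continuous (ψ v)).mpr (ψ v).continuous_toFun).comp
      Multiplicative.toAdd
  · beta_reduce
    rw [map_mul]; rfl
  · have h1 := congrFun (congrArg Subtype.val h) (quotMk (relSubgroup r) (freeGen p g i))
    change (φ v (freeGen p g i)).toAdd = (φ v' (freeGen p g i)).toAdd at h1
    simpa [hφ] using h1

end

/-! ### The generator rank is at most the relation rank -/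

section Bockstein

variable (G : Type*) [Group G] [TopologicalSpace G] [IsTopologicalGroup G]

/-- The locally constant characters of `G` with values in the circle `ℝ/ℤ`. -/
def circleChar : AddSubgroup (G → AddCircle (1 : ℝ)) where
  carrier := {f | IsLocallyConstant f ∧ ∀ x y, f (x * y) = f x + f y}
  zero_mem' := ⟨IsLocallyConstant.const 0, by simp⟩
  add_mem' := by
    rintro f g ⟨hf, hf'⟩ ⟨hg, hg'⟩
    refine ⟨hf.add hg, fun x y => ?_⟩
    simp only [Pi.add_apply, hf', hg']; abel
  neg_mem' := by
    rintro f ⟨hf, hf'⟩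
    refine ⟨hf.neg, fun x y => ?_⟩
    simp only [Pi.neg_apply, hf']; abel

variable {G}

/-- A circle character as a homomorphism. -/
def circleCharHom (f : circleChar G) : G →* Multiplicative (AddCircle (1 : ℝ)) :=
  MonoidHom.mk' (fun x => Multiplicative.ofAdd (f.1 x)) fun x y =>
    congrArg Multiplicative.ofAdd (f.2.2 x y)

theorem circleChar_eq_of_mk_eq (f : circleChar G) {x y : G}
    (h : (x : G ⧸ (commutator G).topologicalClosure) = y) : f.1 x = f.1 y := by
  have hle : (commutator G).topologicalClosure ≤ (circleCharHom f).ker := by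
    refine Subgroup.topologicalClosure_minimal _ (Abelianization.commutator_subset_ker _) ?_
    have : ((circleCharHom f).ker : Set G) = f.1 ⁻¹' {0} := rfl
    rw [this]
    exact f.2.1.isClosed_fiber 0
  have h1 := hle (QuotientGroup.eq.mp h)
  rw [MonoidHom.mem_ker, map_mul, map_inv, inv_mul_eq_one] at h1
  exact h1

theorem finite_circleChar [Finite (G ⧸ (commutator G).topologicalClosure)] :
    Finite (circleChar G) := by
  set A := G ⧸ (commutator G).topologicalClosure
  have hn : 0 < Nat.card A := Nat.card_pos
  have hfin : Finite {t : AddCircle (1 : ℝ) // Nat.card A • t = 0} :=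
    AddCircle.finite_torsion (1 : ℝ) hn
  have hpow : ∀ (f : circleChar G) (x : G), Nat.card A • f.1 x = 0 := by
    intro f x
    have h1 : ((x ^ Nat.card A : G) : A) = ((1 : G) : A) := by
      change (x : A) ^ Nat.card A = 1
      exact pow_card_eq_one'
    have h2 := circleChar_eq_of_mk_eq f h1
    have h3 : circleCharHom f (x ^ Nat.card A) = circleCharHom f 1 :=
      congrArg Multiplicative.ofAdd h2
    rw [map_pow, map_one] at h3
    exact h3
  refine Finite.of_injective (β := A → {t : AddCircle (1 : ℝ) // Nat.card A • t = 0})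
    (fun f a => ⟨f.1 a.out, hpow f _⟩) fun f f' h => Subtype.ext (funext fun x => ?_)
  have h1 : f.1 (x : A).out = f'.1 (x : A).out :=
    congrArg Subtype.val (congrFun h (x : A))
  rw [circleChar_eq_of_mk_eq f (QuotientGroup.out_eq' (x : A)),
    circleChar_eq_of_mk_eq f' (QuotientGroup.out_eq' (x : A))] at h1
  exact h1

theorem card_ker_eq_card_coker {A : Type*} [AddCommGroup A] [Finite A] (f : A →+ A) :
    Nat.card f.ker = Nat.card (A ⧸ f.range) := by
  have h1 := f.ker.card_eq_card_quotient_mul_card_addSubgroup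
  have h2 := f.range.card_eq_card_quotient_mul_card_addSubgroup
  have h3 := Nat.card_congr (QuotientAddGroup.quotientKerEquivRange f).toEquiv
  rw [h3, mul_comm] at h1
  exact Nat.eq_of_mul_eq_mul_right (Nat.card_pos (α := f.range)) (h1.symm.trans h2)

theorem exists_toAddCircle_eq {p : ℕ} [NeZero p] {t : AddCircle (1 : ℝ)} (ht : p • t = 0) :
    ∃ a : ZMod p, ZMod.toAddCircle a = t := by
  induction t using QuotientAddGroup.induction_on with
  | H x =>
    have h1 : ((p • x : ℝ) : AddCircle (1 : ℝ)) = 0 := ht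
    obtain ⟨n, hn⟩ := (AddCircle.coe_eq_zero_iff (1 : ℝ)).mp h1
    refine ⟨(n : ZMod p), ?_⟩
    rw [ZMod.toAddCircle_intCast]
    congr 1
    have hp : (p : ℝ) ≠ 0 := Nat.cast_ne_zero.mpr (NeZero.ne p)
    field_simp
    simpa [mul_comm] using hn

/-- For a group with finite abelianization, the connecting map of
`0 → ℤ/p → ℝ/ℤ → ℝ/ℤ → 0` embeds the cokernel of `p` on the characters, which has as many
elements as its kernel `H¹`, in `H²`. -/
theorem card_H1_le_card_H2 {p : ℕ} [Fact p.Prime]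
    [Finite (G ⧸ (commutator G).topologicalClosure)] [Finite (H2 p G)] :
    Nat.card (H1 p G) ≤ Nat.card (H2 p G) := by
  have hfin := finite_circleChar (G := G)
  let ι : ZMod p →+ AddCircle (1 : ℝ) := ZMod.toAddCircle
  have hι : Function.Injective ι := ZMod.toAddCircle_injective p
  let m : circleChar G →+ circleChar G := nsmulAddMonoidHom p
  have hpι : ∀ a, p • ι a = 0 := fun a => by rw [← map_nsmul]; simp
  have e1 : Nat.card (H1 p G) ≤ Nat.card m.ker := by
    refine Nat.card_le_card_of_injective
      (fun f => ⟨⟨fun x => ι (f.1 x), f.2.1.comp ι, fun x y => by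
        beta_reduce
        rw [f.2.2, map_add]⟩, ?_⟩)
      fun f f' h => Subtype.ext (funext fun x => hι ?_)
    · exact Subtype.ext (funext fun x => hpι _)
    · exact congrFun (congrArg Subtype.val (congrArg Subtype.val h)) x
  rw [card_ker_eq_card_coker] at e1
  refine e1.trans ?_
  have hdiv : ∀ t : AddCircle (1 : ℝ), ∃ u, p • u = t := by
    intro t
    induction t using QuotientAddGroup.induction_on with
    | H x =>
      refine ⟨((x / p : ℝ) : AddCircle (1 : ℝ)), ?_⟩
      rw [← AddCircle.coe_nsmul]
      congr 1
      have hp : (p : ℝ) ≠ 0 := Nat.cast_ne_zero.mpr (NeZero.ne p)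
      simp only [nsmul_eq_mul]
      field_simp
  choose d hd using hdiv
  let j : AddCircle (1 : ℝ) → ZMod p := Function.invFun ι
  have hj : ∀ t, p • t = 0 → ι (j t) = t := fun t ht =>
    Function.invFun_eq (exists_toAddCircle_eq ht)
  -- the cocycle attached to a character `f`, by means of the set-theoretic lift `d ∘ f`
  let δ : (G → AddCircle (1 : ℝ)) → G × G → AddCircle (1 : ℝ) := fun f z =>
    d (f z.2) - d (f (z.1 * z.2)) + d (f z.1)
  have hδ : ∀ (f : circleChar G) (z : G × G), ι (j (δ f.1 z)) = δ f.1 z := by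
    intro f z
    refine hj _ ?_
    simp only [δ, smul_add, smul_sub, hd, f.2.2]
    abel
  have hZ : ∀ f : circleChar G, (fun z => j (δ f.1 z)) ∈ Z2 p G := by
    intro f
    refine ⟨?_, fun x y z => hι ?_⟩
    · have h2 : IsLocallyConstant fun z : G × G => d (f.1 z.2) :=
        (f.2.1.comp d).comp_continuous continuous_snd
      have h1 : IsLocallyConstant fun z : G × G => d (f.1 z.1) :=
        (f.2.1.comp d).comp_continuous continuous_fst
      have h3 : IsLocallyConstant fun z : G × G => d (f.1 (z.1 * z.2)) :=
        (f.2.1.comp d).comp_continuous continuous_mul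
      exact ((h2.sub h3).add h1).comp j
    · simp only [map_sub, map_add, map_zero, hδ]
      simp only [δ, mul_assoc]
      abel
  refine Nat.card_le_card_of_injective
    (fun c : circleChar G ⧸ m.range =>
      (Submodule.Quotient.mk ⟨_, hZ c.out⟩ : H2 p G)) fun c c' h => ?_
  obtain ⟨b, hb, hb'⟩ := (Submodule.Quotient.eq _).mp h
  have hu : (fun x => d (c.out.1 x) - d (c'.out.1 x) - ι (b x)) ∈ circleChar G := by
    refine ⟨((c.out.2.1.comp d).sub (c'.out.2.1.comp d)).sub (hb.comp ι), fun x y => ?_⟩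
    have h1 : j (δ c.out.1 (x, y)) - j (δ c'.out.1 (x, y)) = b y - b (x * y) + b x := hb' x y
    have h2 := congrArg ι h1
    simp only [map_sub, map_add, hδ] at h2
    simp only [δ] at h2
    rw [← sub_eq_zero] at h2 ⊢
    beta_reduce
    rw [← neg_eq_zero, ← h2]
    abel
  have hmem : c.out - c'.out ∈ m.range := by
    refine ⟨⟨_, hu⟩, Subtype.ext (funext fun x => ?_)⟩
    change p • (d (c.out.1 x) - d (c'.out.1 x) - ι (b x)) = c.out.1 x - c'.out.1 x
    rw [smul_sub, smul_sub, hd, hd, hpι, sub_zero]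
  have h4 := (QuotientAddGroup.eq_iff_sub_mem).mpr hmem
  rwa [QuotientAddGroup.out_eq', QuotientAddGroup.out_eq'] at h4

end Bockstein

/-- The presented group is a Schur `σ`-group as soon as its abelianization is finite. -/
theorem isSchurSigma_presented {p g : ℕ} [Fact p.Prime] (r : Fin g → RelX p g)
    (hfin : Finite (presented r ⧸ (commutator (presented r)).topologicalClosure)) :
    IsSchurSigma p (presented r) := by
  refine ⟨isProP_presented r, fg_presented r, hfin, ?_, ⟨_, isGI_presentedSigma r⟩⟩
  obtain ⟨f, hf⟩ := exists_H2_injective r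
  obtain ⟨e, he⟩ := exists_H1_injective r
  have fin2 : Finite (H2 p (presented r)) := Finite.of_injective f hf
  have hcirc := finite_circleChar (G := presented r)
  have fin1 : Finite (H1 p (presented r)) := by
    refine Finite.of_injective (β := circleChar (presented r)) (fun f =>
      ⟨fun x => (ZMod.toAddCircle (f.1 x) : AddCircle (1 : ℝ)), f.2.1.comp _,
        fun x y => by
        beta_reduce
        rw [f.2.2, map_add]⟩) fun f f' h => Subtype.ext (funext fun x => ?_)
    exact ZMod.toAddCircle_injective p (congrFun (congrArg Subtype.val h) x)
  have h1 := card_H1_le_card_H2 (G := presented r) (p := p)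
  have h2 := Nat.card_le_card_of_injective f hf
  have h3 := Nat.card_le_card_of_injective e he
  have hcard : Nat.card (H1 p (presented r)) = Nat.card (H2 p (presented r)) := by omega
  rw [Module.natCard_eq_pow_finrank (K := ZMod p) (V := H1 p (presented r)),
    Module.natCard_eq_pow_finrank (K := ZMod p) (V := H2 p (presented r)), Nat.card_zmod] at hcard
  have hfr := Nat.pow_right_injective (Fact.out : p.Prime).two_le hcard
  have : Module.Finite (ZMod p) (H1 p (presented r)) := Module.Finite.of_finite
  have : Module.Finite (ZMod p) (H2 p (presented r)) := Module.Finite.of_finite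
  rw [← Module.finrank_eq_rank, ← Module.finrank_eq_rank, hfr]

/-! ### The uniform measure on the relations -/

/-- The homomorphism induced on the terms of the lower `p`-central series. -/
def lowerPSeriesMap (p : ℕ) {G G' : Type*} [Group G] [TopologicalSpace G] [IsTopologicalGroup G]
    [Group G'] [TopologicalSpace G'] [IsTopologicalGroup G'] (f : G →ₜ* G') (n : ℕ) :
    lowerPSeries p G n →* lowerPSeries p G' n :=
  ((f : G →* G').comp (lowerPSeries p G n).subtype).codRestrict _
    fun x => lowerPSeries_le_comap p G f n x.2

@[simp] theorem lowerPSeriesMap_coe (p : ℕ) {G G' : Type*} [Group G] [TopologicalSpace G]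
    [IsTopologicalGroup G] [Group G'] [TopologicalSpace G'] [IsTopologicalGroup G']
    (f : G →ₜ* G') (n : ℕ) (x : lowerPSeries p G n) :
    (lowerPSeriesMap p f n x : G') = f x := rfl

theorem lowerPSeriesMap_surjective (p : ℕ) {G E : Type*} [Group G] [TopologicalSpace G]
    [IsTopologicalGroup G] [Group E] [TopologicalSpace E] [DiscreteTopology E] (f : G →ₜ* E)
    (hf : Function.Surjective f) (n : ℕ) : Function.Surjective (lowerPSeriesMap p f n) := by
  intro y
  obtain ⟨x, hx, hxy⟩ := lowerPSeries_le_map p (f : G →* E) hf n y.2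
  exact ⟨⟨x, hx⟩, Subtype.ext hxy⟩

section

variable {p g : ℕ}

theorem qMap_sigma_qMap_sigma (c : ℕ) (x : Q p (FreeProP p g) c) :
    qMap p (sigmaFree p g) c (qMap p (sigmaFree p g) c x) = x := by
  obtain ⟨x, rfl⟩ := QuotientGroup.mk_surjective x
  simp [sigmaFree_sigmaFree]

/-- The set `X_c`, as the set of inverted elements of the group `P_1(Q_c)`. -/
def relXcEquiv (c : ℕ) : RelXc p g c ≃
    {k : lowerPSeries p (Q p (FreeProP p g) c) 1 //
      lowerPSeriesMap p (qMap p (sigmaFree p g) c) 1 k = k⁻¹} where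
  toFun s := ⟨⟨s.1, s.2.1⟩, Subtype.ext s.2.2⟩
  invFun k := ⟨k.1.1, k.1.2, congrArg Subtype.val k.2⟩
  left_inv _ := rfl
  right_inv _ := rfl

theorem mk_mem_relXc (c : ℕ) (x : RelX p g) : (x.1 : Q p (FreeProP p g) c) ∈ RelXc p g c := by
  refine ⟨lowerPSeries_le_comap p _ (quotMk (lowerPSeries p (FreeProP p g) c)) 1 x.2.1, ?_⟩
  exact congrArg QuotientGroup.mk x.2.2

/-- The map `x ↦ x σ(x)⁻¹` from the Frattini subgroup to the set of relations. -/
def twist (x : lowerPSeries p (FreeProP p g) 1) : RelX p g :=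
  ⟨x.1 * (sigmaFree p g x.1)⁻¹,
    mul_mem x.2 (inv_mem (lowerPSeries_le_comap p _ (sigmaFree p g) 1 x.2)), by
    rw [map_mul, map_inv, sigmaFree_sigmaFree, mul_inv_rev, inv_inv]⟩

theorem isClosed_twist_preimage (c : ℕ) (s : Q p (FreeProP p g) c) :
    IsClosed (twist ⁻¹' relFibre p g c s) := by
  have : T1Space (Q p (FreeProP p g) c) :=
    QuotientGroup.t1Space_iff.mpr (lowerPSeries_isClosed p _ c)
  have hcont : Continuous fun x : lowerPSeries p (FreeProP p g) 1 =>
      ((x.1 * (sigmaFree p g x.1)⁻¹ : FreeProP p g) : Q p (FreeProP p g) c) :=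
    QuotientGroup.continuous_mk.comp (continuous_subtype_val.mul
      ((sigmaFree p g).continuous_toFun.comp continuous_subtype_val).inv)
  exact isClosed_singleton.preimage hcont

/-- The uniform limit measure exists: it is the image of the Haar measure of the Frattini subgroup
under `x ↦ x σ(x)⁻¹`, whose fibres over the inverted elements of a finite quotient are
translates of one another. -/
theorem exists_isUniformLimit [Fact p.Prime] (hp : Odd p) :
    ∃ μ : Measure (RelX p g), IsUniformLimit μ := by
  classical
  let K := lowerPSeries p (FreeProP p g) 1
  have : CompactSpace K := isCompact_iff_compactSpace.mp (lowerPSeries_isClosed p _ 1).isCompact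
  let _ : MeasurableSpace K := borel K
  have : BorelSpace K := ⟨rfl⟩
  let K₀ : TopologicalSpace.PositiveCompacts K :=
    ⟨⟨Set.univ, isCompact_univ⟩, by simp⟩
  let ν : Measure K := Measure.haarMeasure K₀
  have hν : ν Set.univ = 1 := Measure.haarMeasure_self (K₀ := K₀)
  have hmeas : ∀ c s, MeasurableSet ((twist : K → RelX p g) ⁻¹' relFibre p g c s) :=
    fun c s => (isClosed_twist_preimage c s).measurableSet
  have htw : Measurable (twist : K → RelX p g) := measurable_generateFrom fun t ht => by
    obtain ⟨c, s, rfl⟩ := ht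
    exact hmeas c s
  refine ⟨ν.map twist, fun c s hs => ?_⟩
  have hmeas' : ∀ s, MeasurableSet (relFibre p g c s) :=
    fun s => MeasurableSpace.measurableSet_generateFrom ⟨c, s, rfl⟩
  rw [Measure.map_apply htw (hmeas' s)]
  let A : Q p (FreeProP p g) c → Set K := fun s => twist ⁻¹' relFibre p g c s
  have hodd := odd_card_of_isPGroup hp (isPGroup_Q p (G := FreeProP p g) c)
  obtain ⟨m, hm⟩ := exists_half hodd
  -- the fibre over `s = z * z` is the translate of the fibre over `1` by an element over `z`
  have hA : ∀ s ∈ RelXc p g c, ν (A s) = ν (A 1) := by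
    intro s hs
    obtain ⟨n, hn⟩ := lowerPSeriesMap_surjective p (quotMk (lowerPSeries p (FreeProP p g) c))
      (quotMk_surjective _) 1 ⟨s ^ m, pow_mem hs.1 m⟩
    have hn' : (n.1 : Q p (FreeProP p g) c) = s ^ m := congrArg Subtype.val hn
    have hσ : ((sigmaFree p g n.1 : FreeProP p g) : Q p (FreeProP p g) c) = (s ^ m)⁻¹ := by
      have h1 : Q.map p (sigmaFree p g) c (n.1 : Q p (FreeProP p g) c) = (s ^ m)⁻¹ := by
        rw [hn', map_pow, hs.2, inv_pow]
      exact h1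
    rw [← measure_preimage_mul ν n (A s)]
    congr 1
    ext x
    change ((n.1 * x.1 * (sigmaFree p g (n.1 * x.1))⁻¹ : FreeProP p g) :
        Q p (FreeProP p g) c) = s ↔
      ((x.1 * (sigmaFree p g x.1)⁻¹ : FreeProP p g) : Q p (FreeProP p g) c) = 1
    have h2 : ((n.1 * x.1 * (sigmaFree p g (n.1 * x.1))⁻¹ : FreeProP p g) :
        Q p (FreeProP p g) c) = s ^ m *
          ((x.1 * (sigmaFree p g x.1)⁻¹ : FreeProP p g) : Q p (FreeProP p g) c) * s ^ m := by
      rw [map_mul, mul_inv_rev]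
      simp only [QuotientGroup.mk_mul, QuotientGroup.mk_inv, hn', hσ, inv_inv, mul_assoc]
    rw [h2]
    constructor
    · intro h
      nth_rewrite 3 [← hm s] at h
      have h3 := mul_right_cancel h
      exact mul_eq_left.mp h3
    · intro h
      rw [h, mul_one, hm]
  have hfin : (RelXc p g c).Finite := Set.toFinite _
  have hsum : ∑ b ∈ hfin.toFinset, ν ((fun x : K => ((twist x).1 : Q p (FreeProP p g) c)) ⁻¹' {b}) =
      1 := by
    rw [sum_measure_preimage_singleton _ fun y _ => hmeas c y, ← hν]
    congr 1
    ext x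
    simpa using mk_mem_relXc c (twist x)
  have hsum2 : ∑ b ∈ hfin.toFinset, ν (A 1) = 1 := by
    rw [← hsum]
    refine Finset.sum_congr rfl fun b hb => ?_
    exact (hA b (hfin.mem_toFinset.mp hb)).symm
  rw [Finset.sum_const, nsmul_eq_mul, ← Nat.card_eq_card_finite_toFinset hfin] at hsum2
  change ν (A s) = _
  rw [hA s hs]
  exact ENNReal.eq_inv_of_mul_eq_one_left (by rw [mul_comm]; exact hsum2)

theorem relMeasure_isUniformLimit [Fact p.Prime] (hp : Odd p) :
    IsUniformLimit (relMeasure p g) := by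
  have h := exists_isUniformLimit (p := p) (g := g) hp
  unfold relMeasure
  rw [dif_pos h]
  exact h.choose_spec

theorem measurableSet_relFibre (c : ℕ) (s : Q p (FreeProP p g) c) :
    MeasurableSet (relFibre p g c s) :=
  MeasurableSpace.measurableSet_generateFrom ⟨c, s, rfl⟩

/-- The relations whose class in `Q_c` satisfies a condition: their measure is the proportion
of the elements of `X_c` that satisfy it. -/
theorem relMeasure_mk [Fact p.Prime] (hp : Odd p) (c : ℕ) (T : Set (Q p (FreeProP p g) c)) :
    MeasurableSet {x : RelX p g | (x.1 : Q p (FreeProP p g) c) ∈ T} ∧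
    relMeasure p g {x | (x.1 : Q p (FreeProP p g) c) ∈ T} =
      (Nat.card {s : RelXc p g c // s.1 ∈ T} : ℝ≥0∞) * (Nat.card (RelXc p g c) : ℝ≥0∞)⁻¹ := by
  classical
  have hfin : (RelXc p g c ∩ T).Finite := Set.toFinite _
  have hset : {x : RelX p g | (x.1 : Q p (FreeProP p g) c) ∈ T} =
      (fun x : RelX p g => (x.1 : Q p (FreeProP p g) c)) ⁻¹' hfin.toFinset := by
    ext x
    simp [mk_mem_relXc]
  constructor
  · have : {x : RelX p g | (x.1 : Q p (FreeProP p g) c) ∈ T} = ⋃ s ∈ T, relFibre p g c s := by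
      ext x
      simp [relFibre]
    rw [this]
    exact MeasurableSet.biUnion (Set.to_countable _) fun s _ => measurableSet_relFibre c s
  · rw [hset, ← sum_measure_preimage_singleton _ fun y _ => measurableSet_relFibre c y]
    have h1 : ∀ b ∈ hfin.toFinset,
        relMeasure p g ((fun x : RelX p g => (x.1 : Q p (FreeProP p g) c)) ⁻¹' {b}) =
          (Nat.card (RelXc p g c) : ℝ≥0∞)⁻¹ := fun b hb =>
      relMeasure_isUniformLimit hp c b (hfin.mem_toFinset.mp hb).1
    rw [Finset.sum_congr rfl h1, Finset.sum_const, nsmul_eq_mul,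
      ← Nat.card_eq_card_finite_toFinset hfin]
    congr 2
    exact Nat.card_congr
      { toFun := fun s => ⟨⟨s.1, s.2.1⟩, s.2.2⟩
        invFun := fun s => ⟨s.1.1, s.1.2, s.2⟩
        left_inv := fun _ => rfl
        right_inv := fun _ => rfl }

theorem isProbabilityMeasure_relMeasure [Fact p.Prime] (hp : Odd p) :
    IsProbabilityMeasure (relMeasure p g) := by
  constructor
  have h := (relMeasure_mk (g := g) hp 0 Set.univ).2
  have h1 : {x : RelX p g | (x.1 : Q p (FreeProP p g) 0) ∈ Set.univ} = Set.univ := by simp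
  rw [h1] at h
  have hne : Nonempty (RelXc p g 0) := ⟨⟨1, Subgroup.one_mem _, by rw [map_one, inv_one]⟩⟩
  rw [h, Nat.card_congr (Equiv.subtypeUnivEquiv fun s => Set.mem_univ _)]
  exact ENNReal.mul_inv_cancel (by exact_mod_cast Nat.card_pos.ne') (ENNReal.natCast_ne_top _)

/-! ### The expected number of equivariant surjections -/

/-- The number of elements of the Frattini subgroup inverted by `σ`. -/
noncomputable def frattiniInverted (p : ℕ) {H : Type*} [Group H] [TopologicalSpace H]
    [IsTopologicalGroup H] (σ : H ≃ₜ* H) : ℕ :=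
  Nat.card {k : H // k ∈ lowerPSeries p H 1 ∧ σ k = k⁻¹}

theorem frattiniInverted_ne_zero {H : Type*} [Group H] [TopologicalSpace H]
    [IsTopologicalGroup H] [Finite H] (σ : H ≃ₜ* H) : frattiniInverted p σ ≠ 0 := by
  have : Nonempty {k : H // k ∈ lowerPSeries p H 1 ∧ σ k = k⁻¹} :=
    ⟨⟨1, Subgroup.one_mem _, by simp⟩⟩
  exact Nat.card_pos.ne'

/-- An equivariant surjection of the free pro-`p` group kills a random relation with the
probability that a uniform inverted element of the Frattini subgroup of `H` is trivial. -/
theorem relMeasure_kill [Fact p.Prime] (hp : Odd p) {H : Type*} [Group H] [TopologicalSpace H]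
    [DiscreteTopology H] [Finite H] (hH : IsPGroup p H) {c : ℕ} (hc : lowerPSeries p H c = ⊥)
    (σ : H ≃ₜ* H) (φ : SurSigma (sigmaEquiv p g) σ) :
    MeasurableSet {x : RelX p g | φ.1 x.1 = 1} ∧
    relMeasure p g {x | φ.1 x.1 = 1} = (frattiniInverted p σ : ℝ≥0∞)⁻¹ := by
  let φ' : Q p (FreeProP p g) c →ₜ* H :=
    quotLift _ φ.1 (map_eq_one_of_mem_lowerPSeries hc φ.1)
  have hsurj : Function.Surjective φ' := fun y => by
    obtain ⟨x, hx⟩ := φ.2.1 y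
    exact ⟨(x : Q p (FreeProP p g) c), hx⟩
  have hset : {x : RelX p g | φ.1 x.1 = 1} =
      {x : RelX p g | (x.1 : Q p (FreeProP p g) c) ∈ {s | φ' s = 1}} := rfl
  obtain ⟨h1, h2⟩ := relMeasure_mk (g := g) hp c {s | φ' s = 1}
  rw [hset]
  refine ⟨h1, ?_⟩
  rw [h2]
  have hcard := card_inverted_eq_mul (odd_card_of_isPGroup hp (hH.to_subgroup (lowerPSeries p H 1)))
    (lowerPSeriesMap p (qMap p (sigmaFree p g) c) 1)
    (fun k => Subtype.ext (qMap_sigma_qMap_sigma c k.1))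
    (lowerPSeriesMap p (σ : H →ₜ* H) 1) (lowerPSeriesMap p φ' 1)
    (lowerPSeriesMap_surjective p φ' hsurj 1) (fun k => Subtype.ext (by
      obtain ⟨x, hx⟩ := QuotientGroup.mk_surjective k.1
      simp only [lowerPSeriesMap_coe, ← hx]
      exact φ.2.2 x))
  rw [← Nat.card_congr (relXcEquiv c)] at hcard
  have e1 : Nat.card {l // lowerPSeriesMap p (σ : H →ₜ* H) 1 l = l⁻¹} = frattiniInverted p σ :=
    Nat.card_congr
      { toFun := fun k => ⟨k.1.1, k.1.2, congrArg Subtype.val k.2⟩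
        invFun := fun k => ⟨⟨k.1, k.2.1⟩, Subtype.ext k.2.2⟩
        left_inv := fun _ => rfl
        right_inv := fun _ => rfl }
  have e2 : Nat.card {s : RelXc p g c // s.1 ∈ {s | φ' s = 1}} =
      Nat.card {k // lowerPSeriesMap p (qMap p (sigmaFree p g) c) 1 k = k⁻¹ ∧
        lowerPSeriesMap p φ' 1 k = 1} :=
    Nat.card_congr
      { toFun := fun s => ⟨⟨s.1.1, s.1.2.1⟩, Subtype.ext s.1.2.2, Subtype.ext s.2⟩
        invFun := fun k => ⟨⟨k.1.1, k.1.2, congrArg Subtype.val k.2.1⟩, congrArg Subtype.val k.2.2⟩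
        left_inv := fun _ => rfl
        right_inv := fun _ => rfl }
  rw [e1, ← e2] at hcard
  have hne : Nonempty (RelXc p g c) := ⟨⟨1, Subgroup.one_mem _, by rw [map_one, inv_one]⟩⟩
  have hpos : Nat.card (RelXc p g c) ≠ 0 := Nat.card_pos.ne'
  have hy := frattiniInverted_ne_zero (p := p) σ
  set a := Nat.card {s : RelXc p g c // s.1 ∈ {s | φ' s = 1}}
  have ha : a ≠ 0 := fun h => hpos (by rw [hcard, h, mul_zero])
  rw [hcard]
  push_cast
  rw [ENNReal.mul_inv (Or.inr (ENNReal.natCast_ne_top _)) (Or.inl (ENNReal.natCast_ne_top _)),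
    mul_comm, mul_assoc, ENNReal.inv_mul_cancel (by exact_mod_cast ha) (ENNReal.natCast_ne_top _),
    mul_one]

/-- Equivariant surjections of the free pro-`p` group are generating tuples of inverted
elements. -/
theorem card_surSigma_free [Fact p.Prime] {H : Type*} [Group H] [TopologicalSpace H]
    [DiscreteTopology H] [Finite H] (hH : IsPGroup p H) (σ : H ≃ₜ* H) :
    Nonempty (SurSigma (sigmaEquiv p g) σ ≃
      {f : Fin g → H // (∀ i, σ (f i) = (f i)⁻¹) ∧ Subgroup.closure (Set.range f) = ⊤}) := by
  have hex := fun f : Fin g → H => exists_freeProP_hom hH f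
  choose Φ hΦ using hex
  refine ⟨{ toFun := fun φ => ⟨fun i => φ.1 (freeGen p g i), fun i => ?_, ?_⟩
            invFun := fun f => ⟨Φ f.1, ?_, ?_⟩
            left_inv := fun φ => Subtype.ext (freeProP_hom_ext fun i => hΦ _ i)
            right_inv := fun f => Subtype.ext (funext fun i => hΦ f.1 i) }⟩
  · rw [← φ.2.2, ← map_inv]
    exact congrArg φ.1 (sigmaFree_gen p g i)
  · have h1 := (topGenerates_freeGen (p := p) (g := g)).image (φ.1 : FreeProP p g →* H)
      φ.1.continuous_toFun φ.2.1
    rw [← Set.range_comp] at h1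
    exact isGI_closure_eq_top h1
  · have h1 : Subgroup.closure (Set.range f.1) ≤ (Φ f.1 : FreeProP p g →* H).range := by
      rw [Subgroup.closure_le]
      rintro _ ⟨i, rfl⟩
      exact ⟨_, hΦ f.1 i⟩
    rw [f.2.2, top_le_iff] at h1
    exact MonoidHom.range_eq_top.mp h1
  · have h1 : (Φ f.1).comp (sigmaFree p g) = (σ : H →ₜ* H).comp (Φ f.1) :=
      freeProP_hom_ext fun i => by
        change Φ f.1 (sigmaFree p g (ofWord p g (FreeGroup.of i))) = σ (Φ f.1 (freeGen p g i))
        rw [sigmaFree_gen, map_inv]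
        change (Φ f.1 (freeGen p g i))⁻¹ = _
        rw [hΦ, f.2.1]
    exact fun x => DFunLike.congr_fun h1 x

/-- The number of equivariant surjections of the free pro-`p` group. -/
theorem card_surSigma_free_eq [Fact p.Prime] (hp : Odd p) {H : Type*} [Group H]
    [TopologicalSpace H] [DiscreteTopology H] [Finite H] (hH : IsPGroup p H) {σ : H ≃ₜ* H}
    (hσ : IsGI σ) : Finite (SurSigma (sigmaEquiv p g) σ) ∧
    Nat.card (SurSigma (sigmaEquiv p g) σ) =
      frattiniInverted p σ ^ g * numGen g (H ⧸ lowerPSeries p H 1) := by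
  classical
  obtain ⟨e⟩ := card_surSigma_free (g := g) hH σ
  refine ⟨Finite.of_equiv _ e.symm, ?_⟩
  rw [Nat.card_congr e]
  set N := lowerPSeries p H 1
  let S := {f : Fin g → H ⧸ N // Subgroup.closure (Set.range f) = ⊤}
  let q : {f : Fin g → H // (∀ i, σ (f i) = (f i)⁻¹) ∧ Subgroup.closure (Set.range f) = ⊤} → S :=
    fun f => ⟨fun i => (f.1 i : H ⧸ N), (closure_range_eq_top_iff hH f.1).mp f.2.2⟩
  have : Fintype S := Fintype.ofFinite S
  rw [← Nat.card_congr (Equiv.sigmaFiberEquiv q), Nat.card_sigma]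
  let β : H ⧸ N →* H ⧸ N := qMap p (σ : H →ₜ* H) 1
  have hβ : ∀ v : H ⧸ N, β v = v⁻¹ := by
    intro v
    obtain ⟨x, rfl⟩ := QuotientGroup.mk_surjective v
    refine eq_inv_of_mul_eq_one_left ?_
    exact (QuotientGroup.eq_one_iff _).mpr (hσ.mul_mem x)
  have hfib : ∀ v : S, Nat.card {f // q f = v} = frattiniInverted p σ ^ g := by
    intro v
    have e1 : {f // q f = v} ≃ ∀ i : Fin g, {k : H // (σ : H →* H) k = k⁻¹ ∧
        QuotientGroup.mk' N k = v.1 i} :=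
      { toFun := fun f i => ⟨f.1.1 i, f.1.2.1 i, congrFun (congrArg Subtype.val f.2) i⟩
        invFun := fun f => ⟨⟨fun i => (f i).1, fun i => (f i).2.1,
          (closure_range_eq_top_iff hH _).mpr (by
            have h1 : (fun i => ((f i).1 : H ⧸ N)) = v.1 := funext fun i => (f i).2.2
            rw [h1]; exact v.2)⟩, Subtype.ext (funext fun i => (f i).2.2)⟩
        left_inv := fun f => rfl
        right_inv := fun f => rfl }
    rw [Nat.card_congr e1, Nat.card_pi]
    have e2 : ∀ i, Nat.card {k : H // (σ : H →* H) k = k⁻¹ ∧ QuotientGroup.mk' N k = v.1 i} =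
        frattiniInverted p σ := by
      intro i
      rw [card_inverted_fibre (odd_card_of_isPGroup hp (hH.to_quotient N)) (σ : H →* H)
        hσ.involutive β (QuotientGroup.mk' N) (QuotientGroup.mk'_surjective N) (fun k => rfl)
        (v.1 i) (hβ _)]
      refine Nat.card_congr (Equiv.subtypeEquivRight fun k => ?_)
      rw [and_comm]
      exact and_congr_left fun _ => QuotientGroup.eq_one_iff k
    rw [Finset.prod_congr rfl fun i _ => e2 i, Finset.prod_const, Finset.card_univ,
      Fintype.card_fin]
  simp only [hfib, Finset.sum_const, Finset.card_univ, smul_eq_mul]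
  rw [mul_comm, ← Nat.card_eq_fintype_card (α := S)]
  rfl

end

section

variable {p g : ℕ}

/-- The expected number of equivariant surjections from the presented group onto `H` is the
number of generating `g`-tuples of the Frattini quotient of `H`: each equivariant surjection of the
free group survives with the probability by whose inverse their number exceeds this count. -/
theorem lintegral_surCount_presented [Fact p.Prime] (hp : Odd p) {H : Type*} [Group H]
    [TopologicalSpace H] [DiscreteTopology H] [Finite H] (hH : IsPGroup p H) {c : ℕ}
    (hc : lowerPSeries p H c = ⊥) {σ : H ≃ₜ* H} (hσ : IsGI σ) :
    (Measurable fun r : Fin g → RelX p g => surCount (presentedSigma r) σ) ∧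
    ∫⁻ r, surCount (presentedSigma r) σ ∂(Measure.pi fun _ : Fin g => relMeasure p g) =
      numGen g (H ⧸ lowerPSeries p H 1) := by
  classical
  obtain ⟨hfin, hcard⟩ := card_surSigma_free_eq (g := g) hp hH hσ
  have : Fintype (SurSigma (sigmaEquiv p g) σ) := Fintype.ofFinite _
  have := isProbabilityMeasure_relMeasure (g := g) hp
  let T : SurSigma (sigmaEquiv p g) σ → Set (Fin g → RelX p g) := fun φ =>
    Set.univ.pi fun _ => {x : RelX p g | φ.1 x.1 = 1}
  have hT : ∀ φ, MeasurableSet (T φ) := fun φ =>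
    MeasurableSet.univ_pi fun _ => (relMeasure_kill hp hH hc σ φ).1
  have hfun : (fun r : Fin g → RelX p g => surCount (presentedSigma r) σ) =
      fun r => ∑ φ, (T φ).indicator 1 r := by
    funext r
    rw [surCount_presentedSigma, ENat.card_eq_coe_natCard, ENat.toENNReal_coe,
      Nat.card_eq_fintype_card, Fintype.card_subtype, Finset.card_filter]
    push_cast
    refine Finset.sum_congr rfl fun φ _ => ?_
    simp only [Set.indicator_apply, T, Set.mem_univ_pi, Set.mem_ofPred_eq, Pi.one_apply]
  have hmeas : ∀ φ, Measurable ((T φ).indicator (1 : (Fin g → RelX p g) → ℝ≥0∞)) :=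
    fun φ => measurable_one.indicator (hT φ)
  rw [hfun]
  refine ⟨Finset.measurable_fun_sum _ fun φ _ => hmeas φ, ?_⟩
  rw [lintegral_finsetSum _ fun φ _ => hmeas φ]
  have hμ : ∀ φ, ∫⁻ r, (T φ).indicator 1 r ∂(Measure.pi fun _ : Fin g => relMeasure p g) =
      ((frattiniInverted p σ : ℝ≥0∞) ^ g)⁻¹ := by
    intro φ
    rw [lintegral_indicator_one (hT φ), Measure.pi_pi]
    simp [(relMeasure_kill hp hH hc σ φ).2, ENNReal.inv_pow]
  simp only [hμ, Finset.sum_const, Finset.card_univ, nsmul_eq_mul]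
  rw [← Nat.card_eq_fintype_card, hcard]
  push_cast
  have hy := frattiniInverted_ne_zero (p := p) σ
  rw [mul_comm, ← mul_assoc, ENNReal.inv_mul_cancel, one_mul]
  · exact pow_ne_zero _ (by exact_mod_cast hy)
  · exact ENNReal.pow_ne_top (ENNReal.natCast_ne_top _)

/-! ### Finiteness of the abelianization of a random group -/

theorem exists_surjective_zmod_pow [Fact p.Prime] {B : Type*} [CommGroup B] [Finite B]
    (hB : IsPGroup p B) (m : ℕ) {b : B} (hb : b ^ p ^ m ≠ 1) :
    ∃ f : B →* Multiplicative (ZMod (p ^ (m + 1))), Function.Surjective f := by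
  obtain ⟨ι, _, n, hn, ⟨e⟩⟩ := CommGroup.equiv_prod_multiplicative_zmod_of_finite B
  have h1 : e b ^ p ^ m ≠ 1 := fun h => hb (e.injective (by rw [map_pow, h, map_one]))
  obtain ⟨i, hi⟩ : ∃ i, e b i ^ p ^ m ≠ 1 := by
    by_contra! h
    exact h1 (funext h)
  let q : B →* Multiplicative (ZMod (n i)) := 
    (Pi.evalMonoidHom (fun i => Multiplicative (ZMod (n i))) i).comp e.toMonoidHom
  have hq : Function.Surjective q := fun y => by
    classical
    refine ⟨e.symm (Pi.mulSingle i y), ?_⟩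
    change e (e.symm _) i = y
    simp
  have hP : IsPGroup p (Multiplicative (ZMod (n i))) := hB.of_surjective q hq
  have : NeZero (n i) := ⟨by have := hn i; omega⟩
  obtain ⟨k, hk⟩ := hP.exists_card_eq
  have hk' : n i = p ^ k := by rw [← hk]; exact (Nat.card_zmod (n i)).symm
  have hmk : m < k := by
    by_contra hle
    apply hi
    have h2 : e b i ^ Nat.card (Multiplicative (ZMod (n i))) = 1 := pow_card_eq_one'
    rw [hk] at h2
    rw [← Nat.sub_add_cancel (not_lt.mp hle), Nat.add_comm, pow_add, pow_mul, h2, one_pow]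
  have hdvd : p ^ (m + 1) ∣ n i := hk' ▸ pow_dvd_pow p hmk
  refine ⟨(AddMonoidHom.toMultiplicative
    (ZMod.castHom hdvd (ZMod (p ^ (m + 1)))).toAddMonoidHom).comp q, ?_⟩
  exact (ZMod.castHom_surjective hdvd).comp hq

open scoped commutatorElement in
/-- A finitely generated pro-`p` group with infinite abelianization maps onto every `ℤ/p^m`. -/
theorem exists_hom_zmod_of_infinite [Fact p.Prime] {G : Type*} [Group G] [TopologicalSpace G]
    [IsTopologicalGroup G] (hG : IsProP p G) {S : Set G} (hS : S.Finite) (hgen : TopGenerates S)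
    (hinf : ¬ Finite (G ⧸ (commutator G).topologicalClosure)) (m : ℕ)
    [TopologicalSpace (Multiplicative (ZMod (p ^ (m + 1))))]
    [DiscreteTopology (Multiplicative (ZMod (p ^ (m + 1))))] :
    ∃ f : G →ₜ* Multiplicative (ZMod (p ^ (m + 1))), Function.Surjective f := by
  by_contra hno
  apply hinf
  set C := (commutator G).topologicalClosure with hC
  have hCn : C.Normal := inferInstance
  have hCc : IsClosed (C : Set G) := Subgroup.isClosed_topologicalClosure _
  have hA : IsProP p (G ⧸ C) := hG.quotient C hCc
  have := hA.compact
  have := hA.t2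
  have := hA.totallyDisconnected
  have hcomm : ∀ x y : G ⧸ C, x * y = y * x := by
    intro x y
    obtain ⟨x, rfl⟩ := QuotientGroup.mk_surjective x
    obtain ⟨y, rfl⟩ := QuotientGroup.mk_surjective y
    have h1 : (y * x)⁻¹ * (x * y) ∈ C := by
      refine Subgroup.le_topologicalClosure _ ?_
      have : (y * x)⁻¹ * (x * y) = ⁅x⁻¹, y⁻¹⁆ := by rw [commutatorElement_def]; group
      rw [this]
      exact Subgroup.commutator_mem_commutator (Subgroup.mem_top _) (Subgroup.mem_top _)
    exact (QuotientGroup.eq.mpr h1).symm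
  have hpow : ∀ a : G ⧸ C, a ^ p ^ m = 1 := by
    intro a
    by_contra ha
    obtain ⟨U, hU⟩ := ProfiniteGrp.exist_openNormalSubgroup_sub_open_nhds_of_one
      (isOpen_compl_singleton (x := a ^ p ^ m)) (by simpa using Ne.symm ha)
    have hUo : IsOpen (U.toSubgroup : Set (G ⧸ C)) := U.isOpen'
    obtain ⟨k, hk⟩ := hA.index U.toSubgroup inferInstance hUo
    let B := (G ⧸ C) ⧸ U.toSubgroup
    let _ : CommGroup B :=
      { (inferInstance : Group B) with
        mul_comm := fun x y => by
          obtain ⟨x, rfl⟩ := QuotientGroup.mk_surjective x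
          obtain ⟨y, rfl⟩ := QuotientGroup.mk_surjective y
          exact congrArg QuotientGroup.mk (hcomm x y) }
    have hcard : Nat.card B = p ^ k := hk
    have : Finite B := Nat.finite_of_card_ne_zero (by
      rw [hcard]; exact pow_ne_zero _ (Fact.out : p.Prime).ne_zero)
    have hb : ((a : G ⧸ C) : B) ^ p ^ m ≠ 1 := by
      intro h
      have h1 : a ^ p ^ m ∈ U.toSubgroup := (QuotientGroup.eq_one_iff _).mp h
      exact hU h1 rfl
    obtain ⟨f, hf⟩ := exists_surjective_zmod_pow (IsPGroup.of_card hcard) m hb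
    have : DiscreteTopology B := QuotientGroup.discreteTopology hUo
    refine hno ⟨(ContinuousMonoidHom.mk f continuous_of_discreteTopology).comp
      ((quotMk U.toSubgroup).comp (quotMk C)), ?_⟩
    exact hf.comp ((quotMk_surjective _).comp (quotMk_surjective _))
  -- a dense finitely generated subgroup of finite exponent is finite
  let _ : CommGroup (G ⧸ C) := { (inferInstance : Group (G ⧸ C)) with mul_comm := hcomm }
  have hgen' : TopGenerates (quotMk C '' S) :=
    hgen.image (quotMk C : G →* G ⧸ C) (quotMk C).continuous_toFun (quotMk_surjective C)
  have hfinS : Finite (quotMk C '' S) := (hS.image _)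
  have hFG : Group.FG (Subgroup.closure (quotMk C '' S)) := Group.closure_finite_fg _
  have hfin : Finite (Subgroup.closure (quotMk C '' S)) := by
    refine CommGroup.finite_of_fg_isMulTorsion _ fun x => ?_
    exact isOfFinOrder_iff_pow_eq_one.mpr ⟨p ^ m, pow_pos (Fact.out : p.Prime).pos _,
      Subtype.ext (hpow x)⟩
  have hset : (Subgroup.closure (quotMk C '' S) : Set (G ⧸ C)).Finite := hfin
  have huniv : (Subgroup.closure (quotMk C '' S) : Set (G ⧸ C)) = Set.univ := by
    rw [← Dense.closure_eq hgen', hset.isClosed.closure_eq]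
  exact Set.finite_univ_iff.mp (huniv ▸ hset)

theorem lowerPSeries_zmod_eq_bot {A : Type*} [CommGroup A] [TopologicalSpace A]
    [DiscreteTopology A] {n : ℕ} (hA : ∀ x : A, x ^ p ^ n = 1) : lowerPSeries p A n = ⊥ := by
  have h : ∀ k, ∀ x ∈ lowerPSeries p A k, ∃ y : A, x = y ^ p ^ k := by
    intro k
    induction k with
    | zero => exact fun x _ => ⟨x, by simp⟩
    | succ k ih =>
      intro x hx
      rw [lowerPSeries_discrete_succ] at hx
      induction hx using Subgroup.closure_induction with
      | mem x hx =>
        rcases hx with ⟨a, b, -, rfl⟩ | ⟨b, hb, rfl⟩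
        · exact ⟨1, by simp⟩
        · obtain ⟨y, rfl⟩ := ih b hb
          exact ⟨y, by rw [← pow_mul, pow_succ]⟩
      | one => exact ⟨1, by simp⟩
      | mul x y _ _ hx hy =>
        obtain ⟨a, rfl⟩ := hx
        obtain ⟨b, rfl⟩ := hy
        exact ⟨a * b, (mul_pow _ _ _).symm⟩
      | inv x _ hx =>
        obtain ⟨a, rfl⟩ := hx
        exact ⟨a⁻¹, (inv_pow _ _).symm⟩
  rw [eq_bot_iff]
  intro x hx
  obtain ⟨y, rfl⟩ := h n x hx
  exact hA y

theorem le_card_units_zmod_pow [Fact p.Prime] (m : ℕ) :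
    m ≤ Nat.card (ZMod (p ^ (m + 1)))ˣ := by
  have hpp : p.Prime := Fact.out
  rw [Nat.card_eq_fintype_card, ZMod.card_units_eq_totient, Nat.totient_prime_pow_succ hpp]
  have h1 : m < p ^ m := Nat.lt_pow_self hpp.one_lt
  have h2 : 1 ≤ p - 1 := by have := hpp.two_le; omega
  nlinarith

/-- With probability one the presented group has finite abelianization: otherwise it maps onto
every `ℤ/p^m`, and, composing with the automorphisms, in many ways, but the expected number of
such maps is bounded independently of `m`. -/
theorem measure_compl_schurRel [Fact p.Prime] (hp : Odd p) :
    (Measure.pi fun _ : Fin g => relMeasure p g) (SchurRel p g)ᶜ = 0 := by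
  set μ := Measure.pi fun _ : Fin g => relMeasure p g
  have hbound : ∀ m : ℕ, (m : ℝ≥0∞) * μ (SchurRel p g)ᶜ ≤ (p ^ g : ℕ) := by
    intro m
    let A := Multiplicative (ZMod (p ^ (m + 1)))
    let _ : TopologicalSpace A := ⊥
    have : DiscreteTopology A := ⟨rfl⟩
    have hcardA : Nat.card A = p ^ (m + 1) := Nat.card_zmod _
    have hP : IsPGroup p A := IsPGroup.of_card hcardA
    have hexp : ∀ x : A, x ^ p ^ (m + 1) = 1 := fun x => by
      have h := pow_card_eq_one' (x := x)
      rwa [hcardA] at h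
    have hbot : lowerPSeries p A (m + 1) = ⊥ := lowerPSeries_zmod_eq_bot hexp
    let σ : A ≃ₜ* A := ⟨MulEquiv.inv A, continuous_of_discreteTopology,
      continuous_of_discreteTopology⟩
    have hσ : IsGI σ := ⟨Set.univ, by
      rw [TopGenerates, Subgroup.closure_univ]; exact dense_univ, fun x _ => rfl⟩
    obtain ⟨hmeas, hint⟩ := lintegral_surCount_presented (g := g) hp hP hbot hσ
    have hsub : (SchurRel p g)ᶜ ⊆ {r | (m : ℝ≥0∞) ≤ surCount (presentedSigma r) σ} := by
      intro r hr
      have hinf : ¬ Finite (presented r ⧸ (commutator (presented r)).topologicalClosure) :=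
        fun h => hr (isSchurSigma_presented r h)
      obtain ⟨S, hS, hgen⟩ := fg_presented r
      obtain ⟨f, hf⟩ := exists_hom_zmod_of_infinite (isProP_presented r) hS hgen hinf m
      have hequiv : ∀ (f : presented r →ₜ* A) (x : presented r),
          f (presentedSigma r x) = σ (f x) := by
        intro f x
        obtain ⟨T, hT, hinv⟩ := isGI_presentedSigma r
        have hcl : IsClosed {x | f (presentedSigma r x) = σ (f x)} :=
          isClosed_eq (f.continuous_toFun.comp (presentedSigma r).continuous)
            (σ.continuous.comp f.continuous_toFun)
        have hle : (Subgroup.closure T : Set (presented r)) ⊆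
            {x | f (presentedSigma r x) = σ (f x)} := by
          intro y hy
          induction hy using Subgroup.closure_induction with
          | mem y hy => simp only [Set.mem_ofPred_eq]; rw [hinv y hy, map_inv]; rfl
          | one => simp
          | mul a b _ _ ha hb =>
            simp only [Set.mem_ofPred_eq] at *
            rw [map_mul, map_mul, map_mul, map_mul, ha, hb]
          | inv a _ ha =>
            simp only [Set.mem_ofPred_eq] at *
            rw [map_inv, map_inv, map_inv, map_inv, ha]
        exact hcl.closure_subset_iff.mpr hle (hT x)
      let M : (ZMod (p ^ (m + 1)))ˣ → A →ₜ* A := fun u =>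
        ⟨AddMonoidHom.toMultiplicative (AddMonoidHom.mulLeft (u : ZMod (p ^ (m + 1)))),
          continuous_of_discreteTopology⟩
      have hM : ∀ u, Function.Surjective (M u) := fun u y =>
        ⟨Multiplicative.ofAdd (((u⁻¹ : (ZMod (p ^ (m + 1)))ˣ) : ZMod (p ^ (m + 1))) * y.toAdd), by
          change Multiplicative.ofAdd ((u : ZMod (p ^ (m + 1))) * (_ * y.toAdd)) = y
          simp⟩
      let Ψ : (ZMod (p ^ (m + 1)))ˣ → SurSigma (presentedSigma r) σ := fun u =>
        ⟨(M u).comp f, (hM u).comp hf, hequiv _⟩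
      have hΨ : Function.Injective Ψ := by
        intro u v huv
        obtain ⟨x, hx⟩ := hf (Multiplicative.ofAdd 1)
        have h1 := DFunLike.congr_fun (congrArg Subtype.val huv) x
        change Multiplicative.ofAdd ((u : ZMod (p ^ (m + 1))) * (f x).toAdd) =
          Multiplicative.ofAdd ((v : ZMod (p ^ (m + 1))) * (f x).toAdd) at h1
        rw [hx] at h1
        simpa [Units.ext_iff] using h1
      have h1 := ENat.card_le_card_of_injective hΨ
      rw [ENat.card_eq_coe_natCard] at h1
      have h2 : ((Nat.card (ZMod (p ^ (m + 1)))ˣ : ℕ∞) : ℝ≥0∞) ≤ surCount (presentedSigma r) σ :=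
        ENat.toENNReal_le.mpr h1
      refine le_trans ?_ h2
      rw [ENat.toENNReal_coe]
      exact_mod_cast le_card_units_zmod_pow m
    have hmarkov := mul_meas_ge_le_lintegral (μ := μ) hmeas (m : ℝ≥0∞)
    refine (mul_le_mul_right (measure_mono hsub) _).trans (hmarkov.trans ?_)
    rw [hint]
    obtain ⟨d, hd, hgen⟩ := exists_numGen_frattiniQuotient (p := p) (P := A)
    rw [hgen]
    have hd1 : d ≤ 1 := by
      have hcyc : IsCyclic (A ⧸ lowerPSeries p A 1) :=
        isCyclic_of_surjective (QuotientGroup.mk' (lowerPSeries p A 1))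
          (QuotientGroup.mk'_surjective _)
      obtain ⟨a, ha⟩ := hcyc.exists_ofOrder_eq_natCard
      have h1 : Nat.card (A ⧸ lowerPSeries p A 1) ∣ p := by
        rw [← ha]; exact orderOf_dvd_of_pow_eq_one (frattiniQuotient_pow a)
      rw [hd] at h1
      have h2 := Nat.le_of_dvd (Fact.out : p.Prime).pos h1
      by_contra hlt
      have h3 : p ^ 1 < p ^ d := Nat.pow_lt_pow_right (Fact.out : p.Prime).one_lt (by omega)
      rw [pow_one] at h3
      omega
    refine Nat.cast_le.mpr ?_
    interval_cases d
    · simpa [numSurj] using Nat.one_le_pow _ _ (Fact.out : p.Prime).pos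
    · simp [numSurj]
  by_contra hne
  have htop : ∀ m : ℕ, (m : ℝ≥0∞) ≤ (p ^ g : ℕ) / μ (SchurRel p g)ᶜ := fun m => by
    rw [ENNReal.le_div_iff_mul_le (Or.inl hne) (Or.inr (ENNReal.natCast_ne_top _))]
    exact hbound m
  have hlt : ((p ^ g : ℕ) : ℝ≥0∞) / μ (SchurRel p g)ᶜ < ⊤ :=
    ENNReal.div_lt_top (ENNReal.natCast_ne_top _) hne
  obtain ⟨m, hm⟩ := ENNReal.exists_nat_gt hlt.ne
  exact absurd (htop m) (not_le.mpr hm)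

end

/-! ### Two identities of Durfee type -/

section QSeries

/-- The `q`-Pochhammer symbol `(1 - q) ⋯ (1 - q ^ n)`. -/
noncomputable def qPoch (q : ℝ) (n : ℕ) : ℝ := ∏ i ∈ Finset.range n, (1 - q ^ (i + 1))

variable {q : ℝ}

@[simp] theorem qPoch_zero : qPoch q 0 = 1 := by simp [qPoch]

theorem qPoch_succ (n : ℕ) : qPoch q (n + 1) = qPoch q n * (1 - q ^ (n + 1)) :=
  Finset.prod_range_succ _ _

theorem one_sub_pow_pos (h0 : 0 ≤ q) (h1 : q < 1) (n : ℕ) : 0 < 1 - q ^ (n + 1) :=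
  sub_pos.mpr (pow_lt_one₀ h0 h1 (Nat.succ_ne_zero n))

theorem qPoch_pos (h0 : 0 ≤ q) (h1 : q < 1) (n : ℕ) : 0 < qPoch q n :=
  Finset.prod_pos fun i _ => one_sub_pow_pos h0 h1 i

theorem half_le_qPoch (h0 : 0 ≤ q) (h1 : q ≤ 1 / 3) (n : ℕ) : 1 / 2 + q ^ n / 2 ≤ qPoch q n := by
  induction n with
  | zero => norm_num
  | succ n ih =>
    rw [qPoch_succ]
    have hq : 0 ≤ q ^ n := pow_nonneg h0 n
    have hq1 : q ^ n ≤ 1 := pow_le_one₀ h0 (by linarith)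
    have hs : q ^ (n + 1) = q ^ n * q := pow_succ q n
    have hs1 : 0 ≤ 1 - q ^ (n + 1) := (one_sub_pow_pos h0 (by linarith) n).le
    nlinarith [mul_le_mul_of_nonneg_right ih hs1, mul_nonneg hq (sub_nonneg.mpr h1),
      mul_nonneg hq h0, mul_nonneg (mul_nonneg hq h0) (sub_nonneg.mpr hq1)]

/-- Gaussian binomial coefficients. -/
noncomputable def gaussBinom (q : ℝ) : ℕ → ℕ → ℝ
  | _, 0 => 1
  | 0, _ + 1 => 0
  | n + 1, k + 1 => gaussBinom q n k + q ^ (k + 1) * gaussBinom q n (k + 1)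

@[simp] theorem gaussBinom_zero_right (n : ℕ) : gaussBinom q n 0 = 1 := by
  cases n <;> rfl

theorem gaussBinom_eq_zero {n k : ℕ} (h : n < k) : gaussBinom q n k = 0 := by
  induction n generalizing k with
  | zero => obtain ⟨k, rfl⟩ := Nat.exists_eq_succ_of_ne_zero (by omega : k ≠ 0); rfl
  | succ n ih =>
    obtain ⟨k, rfl⟩ := Nat.exists_eq_succ_of_ne_zero (by omega : k ≠ 0)
    rw [gaussBinom, ih (by omega), ih (by omega)]; ring

theorem gaussBinom_mul (a b : ℕ) :
    gaussBinom q (a + b) a * (qPoch q a * qPoch q b) = qPoch q (a + b) := by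
  induction a generalizing b with
  | zero => simp
  | succ a iha =>
    induction b with
    | zero =>
      have h := iha 0
      rw [add_zero] at h
      rw [add_zero, gaussBinom, gaussBinom_eq_zero (Nat.lt_succ_self a), qPoch_succ]
      linear_combination (1 - q ^ (a + 1)) * h
    | succ b ihb =>
      have h1 := iha (b + 1)
      rw [show a + 1 + (b + 1) = (a + 1 + b) + 1 by ring, gaussBinom, qPoch_succ (a + 1 + b)]
      rw [show a + (b + 1) = a + 1 + b by ring] at h1
      rw [qPoch_succ b] at h1 ⊢
      rw [qPoch_succ a] at ihb ⊢
      have e : q ^ (a + 1 + b + 1) = q ^ (a + 1) * q ^ (b + 1) := by ring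
      rw [e]
      linear_combination (1 - q ^ (a + 1)) * h1 + q ^ (a + 1) * (1 - q ^ (b + 1)) * ihb

/-- The Durfee rectangle identity with finitely many terms, by Pascal's rule. -/
theorem sum_gaussBinom_div_qPoch (h0 : 0 ≤ q) (h1 : q < 1) (n h : ℕ) :
    ∑ k ∈ Finset.range (n + 1), q ^ (k * (k + h)) * gaussBinom q n k / qPoch q (k + h) =
      1 / qPoch q (n + h) := by
  induction n generalizing h with
  | zero => simp
  | succ n ih =>
    have hne : ∀ m, qPoch q m ≠ 0 := fun m => (qPoch_pos h0 h1 m).ne'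
    have hne' : ∀ m, 1 - q ^ (m + 1) ≠ 0 := fun m => (one_sub_pow_pos h0 h1 m).ne'
    rw [show n + 1 + h = n + (h + 1) by ring, ← ih (h + 1)]
    -- by Pascal's rule the sum is that of the terms `X k + Y k`, with `Z k = X k + Y (k + 1)`
    let X : ℕ → ℝ := fun k =>
      q ^ (k * (k + h)) * (q ^ k * gaussBinom q n k) / qPoch q (k + h)
    let Y : ℕ → ℝ := fun k => q ^ ((k + 1) * (k + 1 + h)) * gaussBinom q n k / qPoch q (k + 1 + h)
    have hZ : ∀ k, q ^ (k * (k + (h + 1))) * gaussBinom q n k / qPoch q (k + (h + 1)) =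
        X k + Y k := by
      intro k
      simp only [X, Y]
      rw [show k + 1 + h = k + (h + 1) by ring, show k + (h + 1) = (k + h) + 1 by ring,
        qPoch_succ]
      have a1 := hne (k + h)
      have a2 := hne' (k + h)
      field_simp
      ring
    have hP : ∀ k, q ^ ((k + 1) * (k + 1 + h)) * gaussBinom q (n + 1) (k + 1) /
        qPoch q (k + 1 + h) = Y k + X (k + 1) := by
      intro k
      simp only [X, Y, gaussBinom]
      ring
    rw [Finset.sum_congr rfl fun k _ => hZ k, Finset.sum_range_succ', Finset.sum_congr rfl
      fun k _ => hP k, Finset.sum_add_distrib, Finset.sum_add_distrib]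
    have hX : ∑ k ∈ Finset.range (n + 1), X (k + 1) + X 0 = ∑ k ∈ Finset.range (n + 1), X k := by
      rw [← Finset.sum_range_succ' X (n + 1), Finset.sum_range_succ X (n + 1)]
      simp [X, gaussBinom_eq_zero (Nat.lt_succ_self n)]
    have hX0 : q ^ (0 * (0 + h)) * gaussBinom q (n + 1) 0 / qPoch q (0 + h) = X 0 := by simp [X]
    rw [hX0, ← hX]
    ring

/-- The terms of the Durfee rectangle series. -/
noncomputable def durfee (q : ℝ) (h k : ℕ) : ℝ := q ^ (k * (k + h)) / (qPoch q (k + h) * qPoch q k)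

/-- The Durfee rectangle series does not depend on the shape of the rectangle. -/
theorem tsum_durfee_succ (h0 : 0 ≤ q) (h1 : q < 1) (h : ℕ) :
    ∑' k, ENNReal.ofReal (durfee q h k) = ∑' k, ENNReal.ofReal (durfee q (h + 1) k) := by
  have hp : ∀ m, 0 < qPoch q m := qPoch_pos h0 h1
  have hp' : ∀ m, 0 < 1 - q ^ (m + 1) := one_sub_pow_pos h0 h1
  let A : ℕ → ℝ := fun k => q ^ (k * (k + h)) * (1 - q ^ k) / (qPoch q (k + h) * qPoch q k)
  let B : ℕ → ℝ := fun k => q ^ (k * (k + h) + k) / (qPoch q (k + h) * qPoch q k)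
  let E : ℕ → ℝ := fun k => q ^ ((k + 1) * (k + 1 + h)) / (qPoch q (k + 1 + h) * qPoch q k)
  have hA : ∀ k, 0 ≤ A k := fun k =>
    div_nonneg (mul_nonneg (pow_nonneg h0 _) (sub_nonneg.mpr (pow_le_one₀ h0 h1.le)))
      (mul_pos (hp _) (hp _)).le
  have hB : ∀ k, 0 ≤ B k := fun k => div_nonneg (pow_nonneg h0 _) (mul_pos (hp _) (hp _)).le
  have hE : ∀ k, 0 ≤ E k := fun k => div_nonneg (pow_nonneg h0 _) (mul_pos (hp _) (hp _)).le
  have e1 : ∀ k, durfee q h k = A k + B k := fun k => by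
    simp only [durfee, A, B]
    rw [← add_div]
    congr 1
    ring
  have e2 : ∀ k, durfee q (h + 1) k = E k + B k := fun k => by
    simp only [durfee, E, B]
    rw [show k + 1 + h = k + (h + 1) by ring, show k + (h + 1) = (k + h) + 1 by ring, qPoch_succ]
    have a1 := (hp (k + h)).ne'
    have a2 := (hp' (k + h)).ne'
    have a3 := (hp k).ne'
    field_simp
    ring
  have e3 : ∀ k, A (k + 1) = E k := fun k => by
    simp only [A, E]
    rw [qPoch_succ k]
    have a1 := (hp (k + 1 + h)).ne'
    have a2 := (hp' k).ne'
    have a3 := (hp k).ne'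
    field_simp
  have e4 : A 0 = 0 := by simp [A]
  calc ∑' k, ENNReal.ofReal (durfee q h k)
      = ∑' k, ENNReal.ofReal (A k) + ∑' k, ENNReal.ofReal (B k) := by
        rw [← ENNReal.tsum_add]
        exact tsum_congr fun k => by rw [e1, ENNReal.ofReal_add (hA k) (hB k)]
    _ = ∑' k, ENNReal.ofReal (E k) + ∑' k, ENNReal.ofReal (B k) := by
        congr 1
        rw [tsum_eq_zero_add' ENNReal.summable, e4, ENNReal.ofReal_zero, zero_add]
        exact tsum_congr fun k => by rw [e3]
    _ = ∑' k, ENNReal.ofReal (durfee q (h + 1) k) := by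
        rw [← ENNReal.tsum_add]
        exact tsum_congr fun k => by rw [e2, ENNReal.ofReal_add (hE k) (hB k)]

theorem tsum_durfee_eq (h0 : 0 ≤ q) (h1 : q < 1) (h : ℕ) :
    ∑' k, ENNReal.ofReal (durfee q h k) = ∑' k, ENNReal.ofReal (durfee q 0 k) := by
  induction h with
  | zero => rfl
  | succ h ih => rw [← tsum_durfee_succ h0 h1, ih]

theorem tsum_durfee_ne_top (h0 : 0 ≤ q) (h1 : q ≤ 1 / 3) :
    ∑' k, ENNReal.ofReal (durfee q 0 k) ≠ ⊤ := by
  have hle : ∀ k, durfee q 0 k ≤ 4 * q ^ k := by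
    intro k
    have hq : 0 ≤ q ^ k := pow_nonneg h0 k
    have hk := half_le_qPoch h0 h1 k
    have hk2 : 1 / 2 ≤ qPoch q k := by linarith
    have hexp : q ^ (k * (k + 0)) ≤ q ^ k := by
      refine pow_le_pow_of_le_one h0 (by linarith) ?_
      rw [add_zero]
      exact Nat.le_mul_self k
    rw [durfee, add_zero, div_le_iff₀ (by positivity)]
    rw [add_zero] at hexp
    nlinarith [mul_le_mul hk2 hk2 (by norm_num) (by linarith), mul_nonneg hq
      (sub_nonneg.mpr (mul_le_mul hk2 hk2 (by norm_num) (by linarith)))]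
  have hs : Summable fun k => 4 * q ^ k :=
    (summable_geometric_of_lt_one h0 (by linarith)).mul_left 4
  refine ne_top_of_le_ne_top hs.tsum_ofReal_ne_top ?_
  exact ENNReal.tsum_le_tsum fun k => ENNReal.ofReal_le_ofReal (hle k)

end QSeries

/-- The number of surjections `𝔽_p^(h + k) → 𝔽_p^h` in terms of Pochhammer symbols. -/
theorem numSurj_add {p : ℕ} (hp : 0 < p) (h k : ℕ) :
    (numSurj p (h + k) h : ℝ) * qPoch (p : ℝ)⁻¹ k =
      (p : ℝ) ^ ((h + k) * h) * qPoch (p : ℝ)⁻¹ (h + k) := by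
  have hp' : (p : ℝ) ≠ 0 := by exact_mod_cast hp.ne'
  induction h generalizing k with
  | zero => simp [numSurj]
  | succ h ih =>
    have h1 := ih (k + 1)
    rw [show h + (k + 1) = h + 1 + k by ring, qPoch_succ] at h1
    have h2 : ((p ^ (h + 1 + k) - p ^ h : ℕ) : ℝ) =
        (p : ℝ) ^ (h + 1 + k) * (1 - (p : ℝ)⁻¹ ^ (k + 1)) := by
      rw [Nat.cast_sub (Nat.pow_le_pow_right hp (by omega)), inv_pow,
        show h + 1 + k = h + (k + 1) by ring, pow_add]
      push_cast
      field_simp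
      ring
    have h3 : numSurj p (h + 1 + k) (h + 1) =
        numSurj p (h + 1 + k) h * (p ^ (h + 1 + k) - p ^ h) := Finset.prod_range_succ _ _
    rw [h3, Nat.cast_mul, h2]
    rw [mul_add (h + 1 + k) h 1, pow_add, mul_one]
    linear_combination (p : ℝ) ^ (h + 1 + k) * h1

theorem numSurj_eq_zero {p g d : ℕ} (h : g < d) : numSurj p g d = 0 :=
  Finset.prod_eq_zero (Finset.mem_range.mpr h) (by simp)

/-- The weight `q ^ (g ^ 2) / ((1 - q) ⋯ (1 - q ^ g)) ^ 2` of the groups of rank `g`. -/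
noncomputable def rankWeight (p g : ℕ) : ℝ := (p : ℝ)⁻¹ ^ (g * g) / qPoch (p : ℝ)⁻¹ g ^ 2

section

variable {p : ℕ} [Fact p.Prime]

theorem inv_prime_lt_one : (p : ℝ)⁻¹ < 1 :=
  inv_lt_one_of_one_lt₀ (by exact_mod_cast (Fact.out : p.Prime).one_lt)

theorem rankWeight_pos (g : ℕ) : 0 < rankWeight p g :=
  div_pos (pow_pos (inv_pos.mpr (by exact_mod_cast (Fact.out : p.Prime).pos)) _)
    (pow_pos (qPoch_pos (by positivity) inv_prime_lt_one g) 2)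

/-- The recursion satisfied by the weights, a form of the finite Durfee identity. -/
theorem rankWeight_recursion (g : ℕ) :
    rankWeight p g * numSurj p g g =
      ∑ k ∈ Finset.range (g + 1), rankWeight p k * (numSurj p g k * (p : ℝ)⁻¹ ^ (g * k)) := by
  have h0 : (0 : ℝ) ≤ (p : ℝ)⁻¹ := by positivity
  have hpp : 0 < p := (Fact.out : p.Prime).pos
  have hpR : (p : ℝ) ≠ 0 := by exact_mod_cast hpp.ne'
  have hP : ∀ m, qPoch (p : ℝ)⁻¹ m ≠ 0 := fun m => (qPoch_pos h0 inv_prime_lt_one m).ne'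
  have hd := sum_gaussBinom_div_qPoch h0 (inv_prime_lt_one (p := p)) g 0
  have hk : ∀ k ∈ Finset.range (g + 1),
      rankWeight p k * (numSurj p g k * (p : ℝ)⁻¹ ^ (g * k)) =
        (p : ℝ)⁻¹ ^ (k * (k + 0)) * gaussBinom (p : ℝ)⁻¹ g k / qPoch (p : ℝ)⁻¹ (k + 0) := by
    intro k hk
    obtain ⟨m, rfl⟩ := Nat.exists_eq_add_of_le (Nat.lt_succ_iff.mp (Finset.mem_range.mp hk))
    have h1 := numSurj_add hpp k m
    have h2 := gaussBinom_mul (q := (p : ℝ)⁻¹) k m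
    have h3 : (p : ℝ) ^ ((k + m) * k) * (p : ℝ)⁻¹ ^ ((k + m) * k) = 1 := by
      rw [inv_pow]; exact mul_inv_cancel₀ (pow_ne_zero _ hpR)
    have h4 : (numSurj p (k + m) k : ℝ) * (p : ℝ)⁻¹ ^ ((k + m) * k) =
        gaussBinom (p : ℝ)⁻¹ (k + m) k * qPoch (p : ℝ)⁻¹ k := by
      apply mul_right_cancel₀ (hP m)
      linear_combination (p : ℝ)⁻¹ ^ ((k + m) * k) * h1 - h2 + qPoch (p : ℝ)⁻¹ (k + m) * h3
    rw [h4, rankWeight, add_zero]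
    have := hP k
    field_simp
  rw [Finset.sum_congr rfl hk, hd, add_zero, rankWeight]
  have h1 := numSurj_add hpp g 0
  rw [add_zero, qPoch_zero, mul_one] at h1
  rw [h1]
  have := hP g
  have h3 : (p : ℝ)⁻¹ ^ (g * g) * (p : ℝ) ^ (g * g) = 1 := by
    rw [inv_pow]; exact inv_mul_cancel₀ (pow_ne_zero _ hpR)
  rw [div_mul_eq_mul_div, ← mul_assoc, h3, one_mul, sq, div_mul_cancel_left₀ this, one_div]

/-- The weighted moments do not depend on `h`: they are Durfee rectangle series. -/
theorem tsum_rankWeight_mul_numSurj (h : ℕ) :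
    ∑' g, ENNReal.ofReal (rankWeight p g) * numSurj p g h =
      ∑' k, ENNReal.ofReal (durfee (p : ℝ)⁻¹ 0 k) := by
  have h0 : (0 : ℝ) ≤ (p : ℝ)⁻¹ := by positivity
  have hpp : 0 < p := (Fact.out : p.Prime).pos
  have hpR : (p : ℝ) ≠ 0 := by exact_mod_cast hpp.ne'
  have hP : ∀ m, qPoch (p : ℝ)⁻¹ m ≠ 0 := fun m => (qPoch_pos h0 inv_prime_lt_one m).ne'
  rw [← tsum_durfee_eq h0 inv_prime_lt_one h, ← ENNReal.summable.sum_add_tsum_nat_add' (k := h)]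
  rw [Finset.sum_eq_zero fun g hg => by
    rw [numSurj_eq_zero (Finset.mem_range.mp hg), Nat.cast_zero, mul_zero], zero_add]
  refine tsum_congr fun k => ?_
  rw [← ENNReal.ofReal_natCast, ← ENNReal.ofReal_mul (rankWeight_pos _).le]
  congr 1
  have h1 := numSurj_add hpp h k
  have h3 : (p : ℝ)⁻¹ ^ ((h + k) * h) * (p : ℝ) ^ ((h + k) * h) = 1 := by
    rw [inv_pow]; exact inv_mul_cancel₀ (pow_ne_zero _ hpR)
  have h5 : (p : ℝ)⁻¹ ^ ((k + h) * (k + h)) =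
      (p : ℝ)⁻¹ ^ (k * (k + h)) * (p : ℝ)⁻¹ ^ ((h + k) * h) := by
    rw [← pow_add]; congr 1; ring
  rw [rankWeight, durfee, add_comm k h] at *
  rw [h5]
  have a1 := hP k
  have a2 := hP (h + k)
  rw [div_mul_eq_mul_div, div_eq_div_iff (pow_ne_zero 2 a2) (mul_ne_zero a2 a1)]
  linear_combination (p : ℝ)⁻¹ ^ (k * (h + k)) * (p : ℝ)⁻¹ ^ ((h + k) * h) *
    qPoch (p : ℝ)⁻¹ (h + k) * h1 + (p : ℝ)⁻¹ ^ (k * (h + k)) * qPoch (p : ℝ)⁻¹ (h + k) ^ 2 * h3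

end

/-! ### Subgroups of finite `p`-power index of `ℤ^g` -/

theorem numSurj_self_ne_zero {p : ℕ} [Fact p.Prime] (d : ℕ) : numSurj p d d ≠ 0 := by
  refine Finset.prod_ne_zero_iff.mpr fun i hi => ?_
  have := Nat.pow_lt_pow_right (Fact.out : p.Prime).one_lt (Finset.mem_range.mp hi)
  omega

/-- Burnside's basis theorem for a finite abelian `p`-group, in counting form. -/
theorem numGen_abelian {p : ℕ} [Fact p.Prime] {A : Type*} [CommGroup A] [Finite A]
    (hA : IsPGroup p A) :
    Nat.card A = Nat.card (powMonoidHom p : A →* A).range * p ^ Group.rank A ∧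
      ∀ g, numGen g A =
        Nat.card (powMonoidHom p : A →* A).range ^ g * numSurj p g (Group.rank A) := by
  let _ : TopologicalSpace A := ⊥
  have : DiscreteTopology A := ⟨rfl⟩
  have hD : lowerPSeries p A 1 = (powMonoidHom p : A →* A).range := by
    rw [lowerPSeries_discrete_succ]
    refine le_antisymm ((Subgroup.closure_le _).mpr ?_) ?_
    · rintro _ (⟨a, b, -, rfl⟩ | ⟨b, -, rfl⟩)
      · exact ⟨1, by simp⟩
      · exact ⟨b, rfl⟩
    · rintro _ ⟨b, rfl⟩
      exact Subgroup.subset_closure (Or.inr ⟨b, Subgroup.mem_top _, rfl⟩)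
  obtain ⟨d, hd, hgen⟩ := exists_numGen_frattiniQuotient (p := p) (P := A)
  have hnum : ∀ g, numGen g A =
      Nat.card (powMonoidHom p : A →* A).range ^ g * numSurj p g d := fun g => by
    rw [numGen_eq_mul g hA, hgen, hD]
  have hpos : Nat.card (powMonoidHom p : A →* A).range ≠ 0 := Nat.card_pos.ne'
  have hrank : Group.rank A = d := by
    apply le_antisymm
    · have h1 : numGen d A ≠ 0 := by
        rw [hnum]
        exact mul_ne_zero (pow_ne_zero _ hpos) (numSurj_self_ne_zero d)
      obtain ⟨f, hf⟩ := (Nat.card_ne_zero.mp h1).1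
      classical
      refine (Group.rank_le (S := Finset.univ.image f) (by simpa using hf)).trans ?_
      exact Finset.card_image_le.trans (by simp)
    · obtain ⟨S, hS, hcl⟩ := Group.rank_spec A
      by_contra hlt
      have h0 : numGen (Group.rank A) A = 0 := by
        rw [hnum, numSurj_eq_zero (not_le.mp hlt), mul_zero]
      have hne : numGen (Group.rank A) A ≠ 0 := by
        refine Nat.card_ne_zero.mpr ⟨⟨⟨fun i => (S.equivFinOfCardEq hS).symm i, ?_⟩⟩, inferInstance⟩
        rw [← hcl]
        congr 1
        ext x
        constructor
        · rintro ⟨i, rfl⟩; exact Subtype.prop _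
        · intro hx; exact ⟨S.equivFinOfCardEq hS ⟨x, hx⟩, by simp⟩
      exact hne h0
  rw [hrank]
  refine ⟨?_, hnum⟩
  rw [← hd, ← hD, mul_comm]
  exact Subgroup.card_eq_card_quotient_mul_card_subgroup _

/-- The free abelian group of rank `g`, written multiplicatively. -/
abbrev FreeAb (g : ℕ) : Type := Multiplicative (Fin g → ℤ)

/-- The basis of the free abelian group. -/
def FreeAb.gen {g : ℕ} (i : Fin g) : FreeAb g := Multiplicative.ofAdd (Pi.single i 1)

theorem FreeAb.prod_gen {g : ℕ} (x : FreeAb g) :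
    ∏ i, FreeAb.gen i ^ (x.toAdd i) = x := by
  apply Multiplicative.toAdd.injective
  rw [toAdd_prod]
  funext j
  simp [FreeAb.gen, Finset.sum_apply, Pi.single_apply]

/-- Homomorphisms from the free abelian group are tuples. -/
def FreeAb.homEquiv {g : ℕ} {A : Type*} [CommGroup A] : (FreeAb g →* A) ≃ (Fin g → A) where
  toFun φ i := φ (FreeAb.gen i)
  invFun f := MonoidHom.mk' (fun x => ∏ i, f i ^ (x.toAdd i)) fun x y => by
    simp [zpow_add, Finset.prod_mul_distrib]
  left_inv φ := by
    refine MonoidHom.ext fun x => ?_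
    change ∏ i, φ (FreeAb.gen i) ^ (x.toAdd i) = φ x
    conv_rhs => rw [← FreeAb.prod_gen x]
    simp [map_prod]
  right_inv f := by
    funext j
    change ∏ i, f i ^ ((FreeAb.gen j).toAdd i) = f j
    rw [Finset.prod_eq_single j]
    · simp [FreeAb.gen]
    · intro i _ hij
      simp [FreeAb.gen, hij]
    · simp

theorem FreeAb.surjective_iff {g : ℕ} {A : Type*} [CommGroup A] (φ : FreeAb g →* A) :
    Function.Surjective φ ↔ Subgroup.closure (Set.range (FreeAb.homEquiv φ)) = ⊤ := by
  have h : Subgroup.closure (Set.range (FreeAb.homEquiv φ)) = φ.range := by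
    apply le_antisymm
    · rw [Subgroup.closure_le]
      rintro _ ⟨i, rfl⟩
      exact ⟨FreeAb.gen i, rfl⟩
    · rintro _ ⟨x, rfl⟩
      rw [← FreeAb.prod_gen x, map_prod]
      refine Subgroup.prod_mem _ fun i _ => ?_
      rw [map_zpow]
      exact Subgroup.zpow_mem _ (Subgroup.subset_closure (Set.mem_range_self i)) _
  rw [h, MonoidHom.range_eq_top]

theorem card_surjective_freeAb (g : ℕ) (A : Type*) [CommGroup A] :
    Nat.card {φ : FreeAb g →* A // Function.Surjective φ} = numGen g A :=
  Nat.card_congr (Equiv.subtypeEquiv FreeAb.homEquiv FreeAb.surjective_iff)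

theorem FreeAb.pow_injective {p : ℕ} (hp : p ≠ 0) (g : ℕ) :
    Function.Injective (powMonoidHom p : FreeAb g →* FreeAb g) := by
  intro x y h
  have h' : p • x.toAdd = p • y.toAdd := h
  apply Multiplicative.toAdd.injective
  funext i
  have := congrFun h' i
  simp only [Pi.smul_apply, nsmul_eq_mul] at this
  exact mul_left_cancel₀ (by exact_mod_cast hp) this

theorem FreeAb.index_pow {p : ℕ} [NeZero p] (g : ℕ) :
    (powMonoidHom p : FreeAb g →* FreeAb g).range.index = p ^ g := by
  let r : FreeAb g →* Multiplicative (Fin g → ZMod p) :=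
    AddMonoidHom.toMultiplicative
      ((Int.castAddHom (ZMod p)).compLeft (Fin g))
  have hr : Function.Surjective r := by
    intro y
    refine ⟨Multiplicative.ofAdd fun i => ((y.toAdd i).val : ℤ), ?_⟩
    apply Multiplicative.toAdd.injective
    funext i
    change (((y.toAdd i).val : ℤ) : ZMod p) = y.toAdd i
    simp
  have hk : (powMonoidHom p : FreeAb g →* FreeAb g).range = r.ker := by
    ext x
    rw [MonoidHom.mem_ker]
    constructor
    · rintro ⟨y, rfl⟩
      apply Multiplicative.toAdd.injective
      funext i
      change ((p • y.toAdd i : ℤ) : ZMod p) = 0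
      simp
    · intro hx
      have h1 : ∀ i, (p : ℤ) ∣ x.toAdd i := fun i => by
        rw [← ZMod.intCast_zmod_eq_zero_iff_dvd]
        exact congrFun (congrArg Multiplicative.toAdd hx) i
      choose y hy using h1
      refine ⟨Multiplicative.ofAdd y, ?_⟩
      apply Multiplicative.toAdd.injective
      funext i
      change p • y i = x.toAdd i
      rw [hy, nsmul_eq_mul]
  rw [hk, Subgroup.index_ker, MonoidHom.range_eq_top.mpr hr, Subgroup.card_top]
  change Nat.card (Fin g → ZMod p) = _
  rw [Nat.card_fun, Nat.card_zmod, Nat.card_eq_fintype_card, Fintype.card_fin]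

/-- The subgroups of the free abelian group whose quotient is a finite `p`-group. -/
structure PSub (p g : ℕ) where
  /-- The subgroup. -/
  toSubgroup : Subgroup (FreeAb g)
  finite : Finite (FreeAb g ⧸ toSubgroup)
  isPGroup : IsPGroup p (FreeAb g ⧸ toSubgroup)

namespace PSub

variable {p g : ℕ}

@[ext] theorem ext {M N : PSub p g} (h : M.toSubgroup = N.toSubgroup) : M = N := by
  cases M; cases N; congr

instance (M : PSub p g) : Finite (FreeAb g ⧸ M.toSubgroup) := M.finite

/-- The quotient by a subgroup. -/
@[reducible] def quot (M : PSub p g) : FinAbPGrp p where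
  carrier := FreeAb g ⧸ M.toSubgroup
  isPGroup := M.isPGroup

/-- The isomorphism class of the quotient. -/
def cls (M : PSub p g) : FinAbClass p := Quotient.mk _ M.quot

theorem nonempty_rep_equiv (M : PSub p g) :
    Nonempty (M.cls.rep.carrier ≃* (FreeAb g ⧸ M.toSubgroup)) :=
  Quotient.exact (Quotient.out_eq M.cls)

end PSub

/-- The surjections with a given kernel are a torsor under the automorphism group. -/
theorem card_surjective_with_kernel {G A : Type*} [Group G] [Group A] (M : Subgroup G) [M.Normal]
    (e : (G ⧸ M) ≃* A) :
    Nat.card {φ : G →* A // Function.Surjective φ ∧ φ.ker = M} = Nat.card (MulAut A) := by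
  let E : {φ : G →* A // Function.Surjective φ ∧ φ.ker = M} ≃ ((G ⧸ M) ≃* A) :=
    { toFun := fun φ => MulEquiv.ofBijective
        (QuotientGroup.lift M φ.1 fun x hx => (φ.2.2.ge hx : x ∈ φ.1.ker))
        ⟨by
          rw [injective_iff_map_eq_one]
          intro y hy
          obtain ⟨x, rfl⟩ := QuotientGroup.mk_surjective y
          have hx : x ∈ φ.1.ker := hy
          rw [φ.2.2] at hx
          exact (QuotientGroup.eq_one_iff x).mpr hx, fun y => by
          obtain ⟨x, hx⟩ := φ.2.1 y
          exact ⟨(x : G ⧸ M), hx⟩⟩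
      invFun := fun e => ⟨(e : G ⧸ M →* A).comp (QuotientGroup.mk' M),
        e.surjective.comp (QuotientGroup.mk'_surjective M), by
          ext x
          rw [MonoidHom.mem_ker]
          change e (x : G ⧸ M) = 1 ↔ _
          rw [map_eq_one_iff e e.injective, QuotientGroup.eq_one_iff]⟩
      left_inv := fun φ => rfl
      right_inv := fun e => by
        ext y
        obtain ⟨x, rfl⟩ := QuotientGroup.mk_surjective y
        rfl }
  rw [Nat.card_congr E]
  exact Nat.card_congr
    { toFun := fun f => e.symm.trans f
      invFun := fun f => e.trans f
      left_inv := fun f => by ext; simp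
      right_inv := fun f => by ext; simp }

section

variable {p : ℕ}

/-- The number of subgroups with quotient of a given isomorphism class. -/
theorem card_cls_fibre (g : ℕ) (A : FinAbClass p) :
    Finite {M : PSub p g // M.cls = A} ∧
    Nat.card {M : PSub p g // M.cls = A} * Nat.card (MulAut A.rep.carrier) =
      numGen g A.rep.carrier := by
  classical
  let X := {φ : FreeAb g →* A.rep.carrier // Function.Surjective φ}
  let e : ∀ φ : X, (FreeAb g ⧸ φ.1.ker) ≃* A.rep.carrier := fun φ =>
    QuotientGroup.quotientKerEquivOfSurjective φ.1 φ.2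
  let κ : X → {M : PSub p g // M.cls = A} := fun φ =>
    ⟨⟨φ.1.ker, Finite.of_equiv _ (e φ).symm.toEquiv, A.rep.isPGroup.of_equiv (e φ).symm⟩,  by
      refine Eq.trans (b := Quotient.mk (finAbSetoid p) A.rep) ?_ (Quotient.out_eq A)
      exact Quotient.sound (show Nonempty _ from ⟨e φ⟩)⟩
  have hfinX : Finite X := by
    have : Finite (FreeAb g →* A.rep.carrier) := Finite.of_equiv _ FreeAb.homEquiv.symm
    infer_instance
  have hiso : ∀ M : {M : PSub p g // M.cls = A},
      Nonempty ((FreeAb g ⧸ M.1.toSubgroup) ≃* A.rep.carrier) := fun M => by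
    obtain ⟨f⟩ := M.1.nonempty_rep_equiv
    rw [M.2] at f
    exact ⟨f.symm⟩
  have hfib : ∀ M, Nat.card {φ // κ φ = M} = Nat.card (MulAut A.rep.carrier) := by
    intro M
    obtain ⟨f⟩ := hiso M
    rw [← card_surjective_with_kernel M.1.toSubgroup f]
    exact Nat.card_congr
      { toFun := fun φ => ⟨φ.1.1, φ.1.2, congrArg (fun M => M.1.toSubgroup) φ.2⟩
        invFun := fun φ => ⟨⟨φ.1, φ.2.1⟩, Subtype.ext (PSub.ext φ.2.2)⟩
        left_inv := fun _ => rfl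
        right_inv := fun _ => rfl }
  have hsurj : Function.Surjective κ := fun M => by
    have h1 : Nat.card {φ // κ φ = M} ≠ 0 := by
      rw [hfib M]
      have : Finite (MulAut A.rep.carrier) :=
        Finite.of_injective (fun f : MulAut A.rep.carrier => (f : A.rep.carrier → A.rep.carrier))
          DFunLike.coe_injective
      exact Nat.card_pos.ne'
    obtain ⟨φ, hφ⟩ := (Nat.card_ne_zero.mp h1).1
    exact ⟨φ, hφ⟩
  have hfin : Finite {M : PSub p g // M.cls = A} := Finite.of_surjective κ hsurj
  refine ⟨hfin, ?_⟩
  have : Fintype {M : PSub p g // M.cls = A} := Fintype.ofFinite _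
  rw [← card_surjective_freeAb, ← Nat.card_congr (Equiv.sigmaFiberEquiv κ), Nat.card_sigma]
  simp only [hfib, Finset.sum_const, Finset.card_univ, smul_eq_mul, Nat.card_eq_fintype_card]

theorem card_mulAut_ne_zero (A : FinAbClass p) : Nat.card (MulAut A.rep.carrier) ≠ 0 := by
  have : Finite (MulAut A.rep.carrier) :=
    Finite.of_injective (fun f : MulAut A.rep.carrier => (f : A.rep.carrier → A.rep.carrier))
      DFunLike.coe_injective
  exact Nat.card_pos.ne'

/-- A sum over subgroups, arranged by the isomorphism class of the quotient. -/
theorem tsum_psub (g : ℕ) (F : FinAbClass p → ℝ≥0∞) :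
    ∑' M : PSub p g, F M.cls = ∑' A : FinAbClass p, autWeight A * numGen g A.rep.carrier * F A := by
  rw [← (Equiv.sigmaFiberEquiv (PSub.cls : PSub p g → FinAbClass p)).tsum_eq]
  have h1 : ∀ x : Σ A : FinAbClass p, {M : PSub p g // M.cls = A},
      F (Equiv.sigmaFiberEquiv (PSub.cls : PSub p g → FinAbClass p) x).cls = F x.1 := fun x => by
    rw [← x.2.2]; rfl
  rw [tsum_congr h1, ENNReal.tsum_sigma (fun (A : FinAbClass p)
    (_ : {M : PSub p g // M.cls = A}) => F A)]
  refine tsum_congr fun A => ?_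
  obtain ⟨hfin, hcard⟩ := card_cls_fibre g A
  rw [ENNReal.tsum_const, ENat.card_eq_coe_natCard, ENat.toENNReal_coe, ← hcard, autWeight]
  congr 1
  push_cast
  have h0 := card_mulAut_ne_zero A
  rw [mul_comm, mul_assoc, ENNReal.mul_inv_cancel (by exact_mod_cast h0)
    (ENNReal.natCast_ne_top _), mul_one]

/-- The rank of an isomorphism class. -/
noncomputable def clsRank (A : FinAbClass p) : ℕ := Group.rank A.rep.carrier

/-- The order of the subgroup of `p`-th powers. -/
noncomputable def clsPow (A : FinAbClass p) : ℕ :=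
  Nat.card (powMonoidHom p : A.rep.carrier →* A.rep.carrier).range

theorem clsPow_cls {g : ℕ} (M : PSub p g) :
    clsPow M.cls = (M.toSubgroup.comap (powMonoidHom p)).index := by
  obtain ⟨e⟩ := M.nonempty_rep_equiv
  have h1 : clsPow M.cls = Nat.card (powMonoidHom p :
      (FreeAb g ⧸ M.toSubgroup) →* (FreeAb g ⧸ M.toSubgroup)).range := by
    refine Nat.card_congr (e.toEquiv.subtypeEquiv fun a => ?_)
    constructor
    · rintro ⟨b, rfl⟩
      exact ⟨e b, by simp⟩
    · rintro ⟨b, hb⟩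
      refine ⟨e.symm b, e.injective ?_⟩
      change e ((e.symm b) ^ p) = e a
      rw [map_pow, e.apply_symm_apply]
      exact hb
  let f : FreeAb g →* (FreeAb g ⧸ M.toSubgroup) :=
    (QuotientGroup.mk' M.toSubgroup).comp (powMonoidHom p)
  have hk : M.toSubgroup.comap (powMonoidHom p) = f.ker := by
    ext x
    rw [MonoidHom.mem_ker]
    exact (QuotientGroup.eq_one_iff (x ^ p)).symm
  have hrange : f.range = (powMonoidHom p :
      (FreeAb g ⧸ M.toSubgroup) →* (FreeAb g ⧸ M.toSubgroup)).range := by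
    ext y
    constructor
    · rintro ⟨x, rfl⟩; exact ⟨(x : FreeAb g ⧸ M.toSubgroup), rfl⟩
    · rintro ⟨z, rfl⟩
      obtain ⟨x, rfl⟩ := QuotientGroup.mk_surjective z
      exact ⟨x, rfl⟩
  rw [h1, hk, Subgroup.index_ker, hrange]

theorem card_cls {g : ℕ} (M : PSub p g) :
    Nat.card M.cls.rep.carrier = M.toSubgroup.index :=
  Nat.card_congr M.nonempty_rep_equiv.some.toEquiv

variable [Fact p.Prime]

theorem card_rep (A : FinAbClass p) :
    Nat.card A.rep.carrier = clsPow A * p ^ clsRank A :=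
  (numGen_abelian A.rep.isPGroup).1

/-- The quotient has full rank exactly when the subgroup consists of `p`-th powers. -/
theorem clsRank_cls_eq_iff {g : ℕ} (M : PSub p g) :
    clsRank M.cls = g ↔
      M.toSubgroup ≤ (powMonoidHom p : FreeAb g →* FreeAb g).range := by
  have hpp : p.Prime := Fact.out
  have : NeZero p := ⟨hpp.ne_zero⟩
  have h1 := card_rep M.cls
  rw [card_cls, clsPow_cls, Subgroup.index_comap] at h1
  have h2 : M.toSubgroup.relIndex (powMonoidHom p : FreeAb g →* FreeAb g).range * p ^ g =
      (M.toSubgroup ⊓ (powMonoidHom p : FreeAb g →* FreeAb g).range).index := by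
    rw [← Subgroup.relIndex_mul_index (inf_le_right : M.toSubgroup ⊓ _ ≤ _),
      Subgroup.inf_relIndex_right, FreeAb.index_pow]
  have h3 := Subgroup.relIndex_mul_index
    (inf_le_left : M.toSubgroup ⊓ (powMonoidHom p : FreeAb g →* FreeAb g).range ≤ _)
  have hidx : M.toSubgroup.index ≠ 0 := Subgroup.index_ne_zero_of_finite
  have hrel : M.toSubgroup.relIndex (powMonoidHom p : FreeAb g →* FreeAb g).range ≠ 0 :=
    fun h => hidx (by rw [h1, h, zero_mul])
  rw [← h2] at h3
  constructor
  · intro h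
    rw [h] at h1
    rw [← h1] at h3
    have h4 : (M.toSubgroup ⊓ (powMonoidHom p : FreeAb g →* FreeAb g).range).relIndex
        M.toSubgroup = 1 := Nat.eq_of_mul_eq_mul_right (Nat.pos_of_ne_zero hidx) (by rw [h3, one_mul])
    exact (Subgroup.relIndex_eq_one.mp h4).trans inf_le_right
  · intro h
    rw [inf_eq_left.mpr h, Subgroup.relIndex_self, one_mul, h1] at h3
    have h4 := Nat.eq_of_mul_eq_mul_left (Nat.pos_of_ne_zero hrel) h3
    exact Nat.pow_right_injective hpp.two_le h4

/-- Taking preimages under the `p`-th power map, from the subgroups of `p`-th powers to all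
subgroups. -/
noncomputable def psubEquiv (p g : ℕ) [Fact p.Prime] :
    {M : PSub p g // clsRank M.cls = g} ≃ PSub p g where
  toFun M :=
    { toSubgroup := M.1.toSubgroup.comap (powMonoidHom p)
      finite := by
        have : (M.1.toSubgroup.comap (powMonoidHom p)).FiniteIndex := ⟨by
          rw [← clsPow_cls]
          exact Nat.card_pos.ne'⟩
        exact Subgroup.finite_quotient_of_finiteIndex
      isPGroup := fun x => by
        obtain ⟨x, rfl⟩ := QuotientGroup.mk_surjective x
        obtain ⟨k, hk⟩ := M.1.isPGroup (x : FreeAb g ⧸ M.1.toSubgroup)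
        refine ⟨k, (QuotientGroup.eq_one_iff _).mpr ?_⟩
        have h1 : x ^ p ^ k ∈ M.1.toSubgroup := (QuotientGroup.eq_one_iff _).mp hk
        exact Subgroup.pow_mem _ h1 p }
  invFun N := by
    have hpp : p.Prime := Fact.out
    have : NeZero p := ⟨hpp.ne_zero⟩
    have hidx : (N.toSubgroup.map (powMonoidHom p)).index ≠ 0 := by
      rw [Subgroup.index_map_of_injective _ (FreeAb.pow_injective hpp.ne_zero g),
        FreeAb.index_pow]
      exact mul_ne_zero (Subgroup.index_ne_zero_of_finite) (pow_ne_zero _ hpp.ne_zero)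
    let M : PSub p g :=
      { toSubgroup := N.toSubgroup.map (powMonoidHom p)
        finite := by
          have : (N.toSubgroup.map (powMonoidHom p)).FiniteIndex := ⟨hidx⟩
          exact Subgroup.finite_quotient_of_finiteIndex
        isPGroup := fun x => by
          obtain ⟨x, rfl⟩ := QuotientGroup.mk_surjective x
          obtain ⟨k, hk⟩ := N.isPGroup (x : FreeAb g ⧸ N.toSubgroup)
          refine ⟨k + 1, (QuotientGroup.eq_one_iff _).mpr ⟨x ^ p ^ k, ?_, ?_⟩⟩
          · exact (QuotientGroup.eq_one_iff _).mp hk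
          · change (x ^ p ^ k) ^ p = x ^ p ^ (k + 1)
            rw [pow_succ, pow_mul] }
    exact ⟨M, (clsRank_cls_eq_iff M).mpr (Subgroup.map_le_range _ _)⟩
  left_inv M := Subtype.ext (PSub.ext (by
    change (M.1.toSubgroup.comap (powMonoidHom p)).map (powMonoidHom p) = M.1.toSubgroup
    rw [Subgroup.map_comap_eq, inf_eq_right.mpr ((clsRank_cls_eq_iff M.1).mp M.2)]))
  right_inv N := PSub.ext (by
    change (N.toSubgroup.map (powMonoidHom p)).comap (powMonoidHom p) = N.toSubgroup
    exact Subgroup.comap_map_eq_self_of_injective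
      (FreeAb.pow_injective (Fact.out : p.Prime).ne_zero g) _)

end

/-! ### The moments of the Cohen–Lenstra measure -/

section

variable {p : ℕ}

open Classical in
/-- The sum of `χ(A) / |Aut A|` over the groups `A` of rank `g`. -/
noncomputable def rankSum (χ : FinAbClass p → ℝ≥0∞) (g : ℕ) : ℝ≥0∞ :=
  ∑' A : FinAbClass p, if clsRank A = g then autWeight A * χ A else 0

theorem tsum_rankSum_mul (χ : FinAbClass p → ℝ≥0∞) (c : ℕ → ℝ≥0∞) :
    ∑' g, rankSum χ g * c g = ∑' A : FinAbClass p, autWeight A * χ A * c (clsRank A) := by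
  classical
  simp only [rankSum, ← ENNReal.tsum_mul_right]
  rw [ENNReal.tsum_comm]
  refine tsum_congr fun A => ?_
  rw [tsum_eq_single (clsRank A)]
  · simp
  · intro g hg
    rw [if_neg (Ne.symm hg), zero_mul]

open Classical in
/-- The indicator function of the groups killed by `p ^ n`. -/
noncomputable def killed (n : ℕ) (A : FinAbClass p) : ℝ≥0∞ :=
  if ∀ x : A.rep.carrier, x ^ p ^ n = 1 then 1 else 0

theorem killed_le_one (n : ℕ) (A : FinAbClass p) : killed n A ≤ 1 := by
  unfold killed; split_ifs <;> simp

/-- The class of the trivial group. -/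
def trivialClass (p : ℕ) : FinAbClass p :=
  Quotient.mk _ { carrier := Unit, isPGroup := fun _ => ⟨0, rfl⟩ }

theorem eq_trivialClass (A : FinAbClass p) (hA : Subsingleton A.rep.carrier) :
    A = trivialClass p := by
  have h1 : A.rep.carrier ≃* Unit :=
    { toFun := fun _ => (), invFun := fun _ => 1, left_inv := fun x => Subsingleton.elim _ _,
      right_inv := fun _ => rfl, map_mul' := fun _ _ => rfl }
  rw [← Quotient.out_eq A]
  exact Quotient.sound (show Nonempty _ from ⟨h1⟩)

theorem subsingleton_trivialClass : Subsingleton (trivialClass p).rep.carrier := by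
  have h : Nonempty ((trivialClass p).rep.carrier ≃* Unit) :=
    Quotient.exact (Quotient.out_eq (trivialClass p))
  obtain ⟨e⟩ := h
  exact e.toEquiv.subsingleton

theorem clsRank_eq_zero_iff (A : FinAbClass p) : clsRank A = 0 ↔ A = trivialClass p := by
  constructor
  · intro h
    obtain ⟨S, hS, hcl⟩ := Group.rank_spec A.rep.carrier
    have h0 : S = ∅ := Finset.card_eq_zero.mp (hS.trans h)
    rw [h0, Finset.coe_empty, Subgroup.closure_empty] at hcl
    exact eq_trivialClass A ((Subgroup.subsingleton_iff).mp (subsingleton_of_bot_eq_top hcl))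
  · rintro rfl
    have := subsingleton_trivialClass (p := p)
    exact Nat.le_zero.mp (Group.rank_le (S := ∅) (Subsingleton.elim _ _))

theorem rankSum_zero (χ : FinAbClass p → ℝ≥0∞) : rankSum χ 0 = χ (trivialClass p) := by
  have := subsingleton_trivialClass (p := p)
  unfold rankSum
  rw [tsum_eq_single (trivialClass p)]
  · rw [if_pos ((clsRank_eq_zero_iff _).mpr rfl), autWeight]
    have h1 : Nat.card (MulAut (trivialClass p).rep.carrier) = 1 := by
      have : Subsingleton (MulAut (trivialClass p).rep.carrier) :=
        ⟨fun f g => MulEquiv.ext fun x => Subsingleton.elim _ _⟩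
      exact Nat.card_unique
    rw [h1]; simp
  · intro A hA
    rw [if_neg fun h => hA ((clsRank_eq_zero_iff A).mp h)]

variable [Fact p.Prime]

/-- The recursion for the weights: a subgroup of `p`-th powers is the image of its preimage under
the `p`-th power map, so marked groups of rank `g` correspond to arbitrary marked groups. -/
theorem rankSum_recursion {χ χ' : FinAbClass p → ℝ≥0∞} (g : ℕ)
    (h : ∀ M : {M : PSub p g // clsRank M.cls = g}, χ M.1.cls = χ' (psubEquiv p g M).cls) :
    rankSum χ g * numSurj p g g =
      ∑ k ∈ Finset.range (g + 1), rankSum χ' k * (numSurj p g k * ((p : ℝ≥0∞) ^ (g * k))⁻¹) := by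
  classical
  have hp0 : (p : ℝ≥0∞) ≠ 0 := by exact_mod_cast (Fact.out : p.Prime).ne_zero
  have hpos : ∀ A : FinAbClass p, (clsPow A : ℝ≥0∞) ≠ 0 := fun A => by
    exact_mod_cast Nat.card_pos.ne'
  have hcancel : ∀ A : FinAbClass p, (clsPow A : ℝ≥0∞) ^ g * ((clsPow A : ℝ≥0∞) ^ g)⁻¹ = 1 :=
    fun A => ENNReal.mul_inv_cancel (pow_ne_zero _ (hpos A))
      (ENNReal.pow_ne_top (ENNReal.natCast_ne_top _))
  have hnum : ∀ A : FinAbClass p, (numGen g A.rep.carrier : ℝ≥0∞) =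
      (clsPow A : ℝ≥0∞) ^ g * numSurj p g (clsRank A) := fun A => by
    rw [(numGen_abelian A.rep.isPGroup).2 g]
    push_cast
    rfl
  let F : FinAbClass p → ℝ≥0∞ := fun A =>
    if clsRank A = g then χ A * ((clsPow A : ℝ≥0∞) ^ g)⁻¹ else 0
  let F' : FinAbClass p → ℝ≥0∞ := fun A => χ' A * ((Nat.card A.rep.carrier : ℝ≥0∞) ^ g)⁻¹
  have e1 : ∑' M : PSub p g, F M.cls = rankSum χ g * numSurj p g g := by
    rw [tsum_psub, rankSum, ← ENNReal.tsum_mul_right]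
    refine tsum_congr fun A => ?_
    by_cases hA : clsRank A = g
    · simp only [F, if_pos hA]
      rw [hnum, hA]
      calc autWeight A * ((clsPow A : ℝ≥0∞) ^ g * numSurj p g g) *
            (χ A * ((clsPow A : ℝ≥0∞) ^ g)⁻¹)
          = autWeight A * χ A * numSurj p g g *
            ((clsPow A : ℝ≥0∞) ^ g * ((clsPow A : ℝ≥0∞) ^ g)⁻¹) := by ring
        _ = _ := by rw [hcancel, mul_one]
    · simp [F, if_neg hA]
  have e2 : ∑' M : PSub p g, F' M.cls =
      ∑' A, autWeight A * χ' A * (numSurj p g (clsRank A) *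
        ((p : ℝ≥0∞) ^ (g * clsRank A))⁻¹) := by
    rw [tsum_psub]
    refine tsum_congr fun A => ?_
    simp only [F']
    rw [hnum, card_rep]
    push_cast
    rw [mul_pow, ← pow_mul, mul_comm (clsRank A) g, ENNReal.mul_inv
      (Or.inl (pow_ne_zero _ (hpos A))) (Or.inl (ENNReal.pow_ne_top (ENNReal.natCast_ne_top _)))]
    calc autWeight A * ((clsPow A : ℝ≥0∞) ^ g * numSurj p g (clsRank A)) *
          (χ' A * (((clsPow A : ℝ≥0∞) ^ g)⁻¹ * ((p : ℝ≥0∞) ^ (g * clsRank A))⁻¹))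
        = autWeight A * χ' A * (numSurj p g (clsRank A) * ((p : ℝ≥0∞) ^ (g * clsRank A))⁻¹) *
          ((clsPow A : ℝ≥0∞) ^ g * ((clsPow A : ℝ≥0∞) ^ g)⁻¹) := by ring
      _ = _ := by rw [hcancel, mul_one]
  have e3 : ∑' M : PSub p g, F M.cls = ∑' M : PSub p g, F' M.cls := by
    have h1 : ∀ M : PSub p g, F M.cls =
        Set.indicator {M : PSub p g | clsRank M.cls = g}
          (fun M => χ M.cls * ((clsPow M.cls : ℝ≥0∞) ^ g)⁻¹) M := fun M => by
      simp only [F, Set.indicator_apply, Set.mem_ofPred_eq]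
    rw [tsum_congr h1, ← tsum_subtype, ← (psubEquiv p g).tsum_eq]
    refine tsum_congr fun M => ?_
    have h2 : Nat.card (psubEquiv p g M).cls.rep.carrier = clsPow M.1.cls := by
      rw [card_cls, clsPow_cls]; rfl
    simp only [F']
    rw [h2, ← h M]
  rw [← e1, e3, e2, ← tsum_rankSum_mul χ' fun k =>
    (numSurj p g k : ℝ≥0∞) * ((p : ℝ≥0∞) ^ (g * k))⁻¹]
  refine tsum_eq_sum fun k hk => ?_
  rw [numSurj_eq_zero (by simpa using hk)]
  simp

theorem killed_psubEquiv {g : ℕ} (n : ℕ) (M : {M : PSub p g // clsRank M.cls = g}) :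
    killed (n + 1) M.1.cls = killed n (psubEquiv p g M).cls := by
  have key : ∀ (M : PSub p g) (n : ℕ), (∀ x : M.cls.rep.carrier, x ^ p ^ n = 1) ↔
      ∀ x : FreeAb g, x ^ p ^ n ∈ M.toSubgroup := by
    intro M n
    obtain ⟨e⟩ := M.nonempty_rep_equiv
    constructor
    · intro h x
      have h1 := congrArg e (h (e.symm (x : FreeAb g ⧸ M.toSubgroup)))
      rw [map_pow, e.apply_symm_apply, map_one] at h1
      exact (QuotientGroup.eq_one_iff _).mp h1
    · intro h y
      apply e.injective
      obtain ⟨x, hx⟩ := QuotientGroup.mk_surjective (e y)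
      rw [map_pow, map_one, ← hx]
      exact (QuotientGroup.eq_one_iff _).mpr (h x)
  unfold killed
  congr 1
  rw [key, key, eq_iff_iff]
  refine forall_congr' fun x => ?_
  change _ ↔ (x ^ p ^ n) ^ p ∈ M.1.toSubgroup
  rw [← pow_mul, pow_succ]

theorem ofReal_rankWeight_recursion (g : ℕ) :
    ENNReal.ofReal (rankWeight p g) * numSurj p g g =
      ∑ k ∈ Finset.range (g + 1), ENNReal.ofReal (rankWeight p k) *
        (numSurj p g k * ((p : ℝ≥0∞) ^ (g * k))⁻¹) := by
  have hpos : (0 : ℝ) < p := by exact_mod_cast (Fact.out : p.Prime).pos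
  have h1 : ∀ k, ENNReal.ofReal (rankWeight p k) * (numSurj p g k * ((p : ℝ≥0∞) ^ (g * k))⁻¹) =
      ENNReal.ofReal (rankWeight p k * (numSurj p g k * (p : ℝ)⁻¹ ^ (g * k))) := by
    intro k
    rw [ENNReal.ofReal_mul (rankWeight_pos k).le, ENNReal.ofReal_mul (Nat.cast_nonneg _),
      ENNReal.ofReal_natCast, ENNReal.ofReal_pow (inv_pos.mpr hpos).le,
      ENNReal.ofReal_inv_of_pos hpos, ENNReal.ofReal_natCast, ENNReal.inv_pow]
  simp only [h1]
  rw [← ENNReal.ofReal_natCast, ← ENNReal.ofReal_mul (rankWeight_pos g).le, rankWeight_recursion,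
    ENNReal.ofReal_sum_of_nonneg]
  intro k _
  have := (rankWeight_pos (p := p) k).le
  positivity

theorem rankSum_killed_le (n g : ℕ) :
    rankSum (killed (p := p) n) g ≤ ENNReal.ofReal (rankWeight p g) := by
  induction n generalizing g with
  | zero =>
    rcases Nat.eq_zero_or_pos g with rfl | hg
    · rw [rankSum_zero]
      simpa [rankWeight] using killed_le_one 0 _
    · have h0 : rankSum (killed (p := p) 0) g = 0 := by
        refine ENNReal.tsum_eq_zero.mpr fun A => ?_
        split_ifs with h
        · have hne : ¬ ∀ x : A.rep.carrier, x ^ p ^ 0 = 1 := fun hx => by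
            have hs : Subsingleton A.rep.carrier := ⟨fun a b => by
              have ha := hx a
              have hb := hx b
              rw [pow_zero, pow_one] at ha hb
              rw [ha, hb]⟩
            have := (clsRank_eq_zero_iff A).mpr (eq_trivialClass A hs)
            omega
          rw [killed, if_neg hne, mul_zero]
        · rfl
      rw [h0]; exact zero_le
  | succ n ih =>
    have h1 := rankSum_recursion (p := p) g (killed_psubEquiv (g := g) n)
    have h2 := ofReal_rankWeight_recursion (p := p) g
    have hs : (numSurj p g g : ℝ≥0∞) ≠ 0 := by exact_mod_cast numSurj_self_ne_zero g
    rw [← ENNReal.mul_le_mul_iff_left hs (ENNReal.natCast_ne_top _), h1, h2]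
    exact Finset.sum_le_sum fun k _ => mul_le_mul_left (ih k) _

theorem rankSum_one_le (g : ℕ) :
    rankSum (fun _ : FinAbClass p => 1) g ≤ ENNReal.ofReal (rankWeight p g) := by
  classical
  rw [rankSum, ENNReal.tsum_eq_iSup_sum]
  refine iSup_le fun S => ?_
  have hexp : ∀ A : FinAbClass p, ∃ n, ∀ m ≥ n, killed m A = 1 := by
    intro A
    obtain ⟨n, hn⟩ := A.rep.isPGroup.exists_card_eq
    refine ⟨n, fun m hm => if_pos fun x => ?_⟩
    obtain ⟨k, rfl⟩ := Nat.exists_eq_add_of_le hm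
    rw [pow_add, pow_mul, ← hn, pow_card_eq_one', one_pow]
  choose N hN using hexp
  refine le_trans ?_ (rankSum_killed_le (S.sup N) g)
  refine le_trans (Finset.sum_le_sum fun A hA => ?_) (ENNReal.sum_le_tsum S)
  rw [hN A _ (Finset.le_sup hA)]

/-- The total weight of the groups of rank `g`. -/
theorem rankSum_one_eq (g : ℕ) :
    rankSum (fun _ : FinAbClass p => 1) g = ENNReal.ofReal (rankWeight p g) := by
  induction g using Nat.strong_induction_on with
  | _ g ih =>
    rcases Nat.eq_zero_or_pos g with rfl | hg
    · rw [rankSum_zero]; simp [rankWeight]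
    have h1 := rankSum_recursion (p := p) (χ := fun _ => 1) (χ' := fun _ => 1) g fun _ => rfl
    have h2 := ofReal_rankWeight_recursion (p := p) g
    rw [Finset.sum_range_succ] at h1 h2
    rw [Finset.sum_congr rfl fun k hk => by rw [ih k (Finset.mem_range.mp hk)]] at h1
    set R := ∑ k ∈ Finset.range g, ENNReal.ofReal (rankWeight p k) *
      (numSurj p g k * ((p : ℝ≥0∞) ^ (g * k))⁻¹)
    have hw := rankSum_one_le (p := p) g
    set w := rankSum (fun _ : FinAbClass p => 1) g
    set v := ENNReal.ofReal (rankWeight p g)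
    have hv : v ≠ ⊤ := ENNReal.ofReal_ne_top
    set s : ℝ≥0∞ := (numSurj p g g : ℝ≥0∞) with hs_def
    have hs0 : s ≠ 0 := by rw [hs_def]; exact_mod_cast numSurj_self_ne_zero g
    have hst : s ≠ ⊤ := ENNReal.natCast_ne_top _
    set t : ℝ≥0∞ := ((p : ℝ≥0∞) ^ (g * g))⁻¹
    have ht1 : t < 1 := by
      rw [ENNReal.inv_lt_one]
      have h3 : 1 < p ^ (g * g) :=
        Nat.one_lt_pow (by positivity) (Fact.out : p.Prime).one_lt
      exact_mod_cast h3
    have htt : t ≠ ⊤ := (ht1.trans ENNReal.one_lt_top).ne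
    have hwt : w ≠ ⊤ := ne_top_of_le_ne_top hv hw
    have hR : R ≠ ⊤ := by
      intro h
      rw [h, top_add] at h2
      exact (ENNReal.mul_ne_top hv hst) h2
    -- subtract the two instances of the recursion, whose terms of index below `g` agree
    rw [← ENNReal.toReal_eq_toReal_iff' hwt hv]
    have r1 := congrArg ENNReal.toReal h1
    have r2 := congrArg ENNReal.toReal h2
    rw [ENNReal.toReal_add hR (by finiteness)] at r1 r2
    simp only [ENNReal.toReal_mul] at r1 r2
    have hs' : 0 < s.toReal := ENNReal.toReal_pos hs0 hst
    have ht' : t.toReal < 1 := by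
      rw [← ENNReal.toReal_one]; exact (ENNReal.toReal_lt_toReal htt ENNReal.one_ne_top).mpr ht1
    have h5 : (w.toReal - v.toReal) * (s.toReal * (1 - t.toReal)) = 0 := by
      linear_combination r1 - r2
    have h6 : s.toReal * (1 - t.toReal) ≠ 0 := (mul_pos hs' (by linarith)).ne'
    have := (mul_eq_zero.mp h5).resolve_right h6
    linarith

/-- The moments of the Cohen–Lenstra measure at elementary abelian groups are one. -/
theorem tsum_muCLRank_mul_numSurj (hp : Odd p) (d : ℕ) :
    ∑' g, muCLRank p g * numSurj p g d = 1 := by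
  classical
  set Z : ℝ≥0∞ := ∑' B : FinAbClass p, autWeight B with hZ
  have hZ' : ∀ h, ∑' g, rankSum (fun _ : FinAbClass p => 1) g * numSurj p g h =
      ∑' k, ENNReal.ofReal (durfee (p : ℝ)⁻¹ 0 k) := fun h => by
    simp only [rankSum_one_eq]
    exact tsum_rankWeight_mul_numSurj h
  have hZ0 : Z = ∑' k, ENNReal.ofReal (durfee (p : ℝ)⁻¹ 0 k) := by
    rw [← hZ' 0]
    simp only [numSurj, Finset.range_zero, Finset.prod_empty, Nat.cast_one]
    rw [tsum_rankSum_mul (fun _ : FinAbClass p => 1) fun _ => 1]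
    simp [hZ]
  have hp3 : 3 ≤ p := by
    have h2 := (Fact.out : p.Prime).two_le
    obtain ⟨m, hm⟩ := hp
    omega
  have hZt : Z ≠ ⊤ := by
    rw [hZ0]
    refine tsum_durfee_ne_top (by positivity) ?_
    rw [one_div]
    exact inv_anti₀ (by norm_num) (by exact_mod_cast hp3)
  have hZn : Z ≠ 0 := by
    intro h
    rw [hZ] at h
    have h1 := ENNReal.tsum_eq_zero.mp h (trivialClass p)
    rw [autWeight, ENNReal.inv_eq_zero] at h1
    exact ENNReal.natCast_ne_top _ h1
  have hmu : ∀ g, muCLRank p g = rankSum (fun _ : FinAbClass p => 1) g * Z⁻¹ := by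
    intro g
    unfold muCLRank rankSum
    rw [← ENNReal.tsum_mul_right]
    change ∑' A : {A : FinAbClass p | clsRank A = g}, muCL A.1 = _
    rw [tsum_subtype {A : FinAbClass p | clsRank A = g} muCL]
    refine tsum_congr fun A => ?_
    simp only [Set.indicator_apply, Set.mem_ofPred_eq]
    split_ifs
    · rw [muCL, mul_one, div_eq_mul_inv]
    · rw [zero_mul]
  have h1 : ∀ g, muCLRank p g * numSurj p g d =
      rankSum (fun _ : FinAbClass p => 1) g * numSurj p g d * Z⁻¹ := fun g => by
    rw [hmu]; ring
  rw [tsum_congr h1, ENNReal.tsum_mul_right, hZ' d, ← hZ0, ENNReal.mul_inv_cancel hZn hZt]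

end

/-! ### Isomorphism classes of finite quotients -/

theorem IsoClass.rep_spec {P : TopGrp → Prop} (A : IsoClass P) : P A.rep :=
  (Quotient.out (s := isoSetoid P) A).2

theorem IsoClass.mk_rep {P : TopGrp → Prop} (A : IsoClass P) : IsoClass.mk A.rep A.rep_spec = A :=
  Quotient.out_eq (s := isoSetoid P) A

theorem IsoClass.mk_eq_iff {P : TopGrp → Prop} {G G' : TopGrp} (h : P G) (h' : P G') :
    IsoClass.mk G h = IsoClass.mk G' h' ↔ Nonempty (G ≃ₜ* G') :=
  Quotient.eq (r := isoSetoid P)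

theorem IsoClass.nonempty_rep_mk {P : TopGrp → Prop} {G : TopGrp} (h : P G) :
    Nonempty ((IsoClass.mk G h).rep ≃ₜ* G) :=
  (IsoClass.mk_eq_iff _ h).mp (IsoClass.mk G h).mk_rep

theorem mem_quotientSet_iff {p c : ℕ} {P : TopGrp} (A : SchurClass p) :
    A ∈ quotientSet p c P ↔ Nonempty (Q p A.rep c ≃ₜ* P) := by
  constructor
  · rintro ⟨G, h, rfl, ⟨e⟩⟩
    obtain ⟨f⟩ := IsoClass.nonempty_rep_mk (P := fun G => IsSchurSigma p G) h
    exact ⟨(qEquiv p f c).trans e⟩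
  · exact fun h => ⟨A.rep, A.rep_spec, A.mk_rep.symm, h⟩

/-- The quotient `Q_c(G)` as a bundled topological group. -/
def topGrpQ (p c : ℕ) (G : TopGrp) : TopGrp where
  carrier := Q p G c

/-- `t` is the multiplication table of the finite group `P` for some numbering of its elements. -/
def IsTable (P : Type*) [Mul P] (t : Σ n : ℕ, Fin n → Fin n → Fin n) : Prop :=
  ∃ e : P ≃ Fin t.1, ∀ x y, e (x * y) = t.2 (e x) (e y)

theorem exists_isTable (P : Type*) [Mul P] [Finite P] : ∃ t, IsTable P t := by
  obtain ⟨n, ⟨e⟩⟩ := Finite.exists_equiv_fin P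
  exact ⟨⟨n, fun a b => e (e.symm a * e.symm b)⟩, e, fun x y => by simp⟩

theorem IsTable.nonempty_equiv {P P' : Type*} [Group P] [TopologicalSpace P] [DiscreteTopology P]
    [Group P'] [TopologicalSpace P'] [DiscreteTopology P'] {t : Σ n : ℕ, Fin n → Fin n → Fin n}
    (h : IsTable P t) (h' : IsTable P' t) : Nonempty (P ≃ₜ* P') := by
  obtain ⟨e, he⟩ := h
  obtain ⟨e', he'⟩ := h'
  let f : P ≃* P' := MulEquiv.mk' (e.trans e'.symm) fun x y => e'.injective (by simp [he, he'])
  exact ⟨{ f with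
    continuous_toFun := continuous_of_discreteTopology
    continuous_invFun := continuous_of_discreteTopology }⟩

theorem measurable_presentedClass (p g : ℕ) : Measurable (presentedClass p g) :=
  measurable_iff_le_map.mpr (iInf_le _ g)

section

variable {p : ℕ} [Fact p.Prime]

theorem IsSchurSigma.finite_Q {G : TopGrp} (h : IsSchurSigma p G) (c : ℕ) : Finite (Q p G c) := by
  obtain ⟨S, hS, hgen⟩ := h.fg
  exact BBH.finite_Q hS hgen c

theorem IsAncestor.finite_discrete {P : TopGrp} (h : IsAncestor p P) :
    Finite P ∧ DiscreteTopology P ∧ IsPGroup p P ∧ ∃ s : P ≃ₜ* P, IsGI s := by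
  obtain ⟨G, n, hG, ⟨e⟩⟩ := h
  have := hG.finite_Q n
  have hd : DiscreteTopology (Q p G n) := discrete_Q n
  obtain ⟨s, hs⟩ := hG.gi
  obtain ⟨S, hS, hinv⟩ := hs.qEquiv (p := p) n
  refine ⟨Finite.of_equiv _ e.toEquiv.symm, e.toHomeomorph.symm.discreteTopology,
    (isPGroup_Q p n).of_equiv e.symm.toMulEquiv, (e.trans (qEquiv p s n)).trans e.symm,
    e.symm '' S, hS.image e.symm.toMulEquiv.toMonoidHom e.symm.continuous e.symm.surjective, ?_⟩
  rintro _ ⟨x, hx, rfl⟩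
  simp [hinv x hx]

theorem countable_ancestorClass (c : ℕ) : Countable (AncestorClass p c) := by
  have hfin : ∀ A : AncestorClass p c, Finite A.rep := fun A => A.rep_spec.1.finite_discrete.1
  choose t ht using fun A : AncestorClass p c =>
    have := hfin A
    exists_isTable A.rep
  refine Function.Injective.countable (f := t) fun A B hAB => ?_
  have hA := A.rep_spec.1.finite_discrete.2.1
  have hB := B.rep_spec.1.finite_discrete.2.1
  rw [← A.mk_rep, ← B.mk_rep, IsoClass.mk_eq_iff]
  exact (ht A).nonempty_equiv (hAB ▸ ht B)

theorem measurableSet_quotientSet_Q (c : ℕ) (A : SchurClass p) :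
    MeasurableSet[Omega p] (quotientSet p c (topGrpQ p c A.rep)) := by
  have hf : Finite (Q p A.rep c) := A.rep_spec.finite_Q c
  exact MeasurableSpace.measurableSet_generateFrom
    ⟨c, topGrpQ p c A.rep, hf, discrete_Q c, isPGroup_Q p c, rfl⟩

/-- A function that depends only on the isomorphism class of `Q_c(G)` is measurable: there are
countably many isomorphism classes of finite groups. -/
theorem measurable_of_factors {α : Type*} [MeasurableSpace α] (c : ℕ) (F : SchurClass p → α)
    (hF : ∀ A B : SchurClass p, Nonempty (Q p A.rep c ≃ₜ* Q p B.rep c) → F A = F B) :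
    Measurable[Omega p] F := by
  intro S _
  choose t ht using fun A : SchurClass p =>
    have := A.rep_spec.finite_Q c
    exists_isTable (Q p A.rep c)
  have key : F ⁻¹' S = ⋃ k ∈ {k | ∃ A, F A ∈ S ∧ t A = k}, t ⁻¹' {k} := by
    ext A
    simp only [Set.mem_preimage, Set.mem_iUnion, Set.mem_singleton_iff, exists_prop]
    constructor
    · exact fun h => ⟨t A, ⟨A, h, rfl⟩, rfl⟩
    · rintro ⟨k, ⟨B, hB, rfl⟩, hAB⟩
      have := A.rep_spec.finite_Q c
      have := B.rep_spec.finite_Q c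
      have hdA : DiscreteTopology (Q p A.rep c) := discrete_Q c
      have hdB : DiscreteTopology (Q p B.rep c) := discrete_Q c
      rwa [hF A B ((ht A).nonempty_equiv (hAB ▸ ht B))]
  have key' : F ⁻¹' S = ⋃ k ∈ {k | ∃ A, F A ∈ S ∧ t A = k},
      ⋃ h : ∃ A, F A ∈ S ∧ t A = k, quotientSet p c (topGrpQ p c h.choose.rep) := by
    rw [key]
    ext A
    simp only [Set.mem_iUnion, Set.mem_preimage, Set.mem_singleton_iff, exists_prop]
    constructor
    · rintro ⟨k, hk, rfl⟩
      refine ⟨t A, hk, hk, (mem_quotientSet_iff A).mpr ?_⟩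
      have hB := hk.choose_spec.2
      have := A.rep_spec.finite_Q c
      have := hk.choose.rep_spec.finite_Q c
      have hdA : DiscreteTopology (Q p A.rep c) := discrete_Q c
      have hdB : DiscreteTopology (Q p hk.choose.rep c) := discrete_Q c
      have htB := ht hk.choose
      rw [hB] at htB
      exact IsTable.nonempty_equiv (P' := Q p hk.choose.rep c) (ht A) htB
    · rintro ⟨k, hk, hk', hA⟩
      have := (mem_quotientSet_iff A).mp hA
      refine ⟨t A, ⟨A, ?_, rfl⟩, rfl⟩
      rw [hF A _ this]
      exact hk'.choose_spec.1
  rw [key']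
  exact MeasurableSet.biUnion (Set.to_countable _) fun k _ =>
    MeasurableSet.iUnion fun h => measurableSet_quotientSet_Q c _

theorem measurableSet_presented_quotient {g : ℕ} (c : ℕ) (P : TopGrp) :
    MeasurableSet {r : Fin g → RelX p g | Nonempty (Q p (presented r) c ≃ₜ* P)} := by
  let π : (Fin g → RelX p g) → Fin g → Q p (FreeProP p g) c := fun r i =>
    ((r i).1 : Q p (FreeProP p g) c)
  have key : {r : Fin g → RelX p g | Nonempty (Q p (presented r) c ≃ₜ* P)} =
      ⋃ y ∈ π '' {r | Nonempty (Q p (presented r) c ≃ₜ* P)},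
        ⋂ i, (fun r : Fin g → RelX p g => r i) ⁻¹' relFibre p g c (y i) := by
    ext r
    simp only [Set.mem_iUnion, Set.mem_iInter, exists_prop]
    constructor
    · exact fun h => ⟨π r, ⟨r, h, rfl⟩, fun i => rfl⟩
    · rintro ⟨_, ⟨r', ⟨e⟩, rfl⟩, h⟩
      obtain ⟨f⟩ := nonempty_qEquiv_of_rel_eq r r' h
      exact ⟨f.trans e⟩
  rw [key]
  exact MeasurableSet.biUnion (Set.to_countable _) fun y _ =>
    MeasurableSet.iInter fun i => measurable_pi_apply i (measurableSet_relFibre c _)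

/-- The sets in `Ω` are measurable for the Boston–Bush–Hajir measure. -/
theorem Omega_le : Omega p ≤ (inferInstance : MeasurableSpace (SchurClass p)) := by
  refine MeasurableSpace.generateFrom_le ?_
  rintro _ ⟨c, P, -, -, -, rfl⟩
  refine MeasurableSpace.measurableSet_iInf.mpr fun g => ?_
  refine ⟨_, measurableSet_presented_quotient (g := g) c P, ?_⟩
  ext r
  change _ ↔ presentedClass p g r ∈ quotientSet p c P
  rw [mem_quotientSet_iff]
  obtain ⟨f⟩ := IsoClass.nonempty_rep_mk (P := fun G => IsSchurSigma p G) r.2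
  constructor
  · rintro ⟨e⟩
    exact ⟨(qEquiv p f c).trans e⟩
  · rintro ⟨e⟩
    exact ⟨(qEquiv p f.symm c).trans e⟩

/-- The tuples that present Schur `σ`-groups are conull, so the restriction to them changes no
integral. -/
theorem lintegral_comap_schurRel (hp : Odd p) {g : ℕ} {f : (Fin g → RelX p g) → ℝ≥0∞}
    (hf : Measurable f) :
    ∫⁻ r : SchurRel p g, f r.1
        ∂((Measure.pi fun _ : Fin g => relMeasure p g).comap Subtype.val) =
      ∫⁻ r, f r ∂(Measure.pi fun _ : Fin g => relMeasure p g) := by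
  set μ := Measure.pi fun _ : Fin g => relMeasure p g
  have hnull : μ (SchurRel p g)ᶜ = 0 := measure_compl_schurRel hp
  have hS : NullMeasurableSet (SchurRel p g) μ :=
    (NullMeasurableSet.of_null hnull).of_compl
  rw [← lintegral_map hf measurable_subtype_coe]
  congr 1
  ext s hs
  rw [Measure.map_apply measurable_subtype_coe hs,
    Measure.comap_apply₀ _ _ Subtype.val_injective
      (fun t ht => Measure.MeasurableSet.nullMeasurableSet_subtype_coe hS ht)
      (measurable_subtype_coe hs).nullMeasurableSet,
    Subtype.image_preimage_coe]
  refine measure_congr ?_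
  have h1 : SchurRel p g =ᵐ[μ] Set.univ := ae_eq_univ.mpr hnull
  have h2 := h1.inter (ae_eq_refl s)
  rwa [Set.univ_inter] at h2

end

/-! ### The integral of the number of equivariant surjections -/

section

universe u

variable {p : ℕ} [Fact p.Prime] {H : Type u} [Group H] [TopologicalSpace H]
  [DiscreteTopology H] {c : ℕ} {τ : ∀ G : TopGrp, G ≃ₜ* G}

theorem surCount_rep_eq_of_equiv (hp : Odd p) (hH : lowerPSeries p H c = ⊥) (σ : H ≃ₜ* H)
    (hτ : ∀ G : TopGrp, (∃ s : G ≃ₜ* G, IsGI s) → IsGI (τ G)) {P : TopGrp} [Finite P]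
    [DiscreteTopology P] (hP : IsPGroup p P) {ρ : P ≃ₜ* P} (hρ : IsGI ρ) (A : SchurClass p)
    (e : Q p A.rep c ≃ₜ* P) : surCount (τ A.rep) σ = surCount ρ σ :=
  surCount_eq_of_equiv hp hP hH (hτ _ A.rep_spec.gi) hρ e σ

theorem surCount_rep_eq_quotient (hp : Odd p) (hH : lowerPSeries p H c = ⊥) (σ : H ≃ₜ* H)
    (hτ : ∀ G : TopGrp, (∃ s : G ≃ₜ* G, IsGI s) → IsGI (τ G)) (A B : SchurClass p)
    (h : Nonempty (Q p A.rep c ≃ₜ* Q p B.rep c)) :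
    surCount (τ A.rep) σ = surCount (τ B.rep) σ := by
  have := B.rep_spec.finite_Q c
  have hd : DiscreteTopology (Q p B.rep c) := discrete_Q c
  have hB := hτ _ B.rep_spec.gi
  obtain ⟨e⟩ := h
  rw [surCount_eq_of_equiv hp (isPGroup_Q p c) hH (hτ _ A.rep_spec.gi) (hB.qEquiv c) e σ,
    surCount_eq_of_equiv hp (isPGroup_Q p c) hH hB (hB.qEquiv c) (ContinuousMulEquiv.refl _) σ]

theorem surCount_rep_presentedClass (hp : Odd p) (hH : lowerPSeries p H c = ⊥) (σ : H ≃ₜ* H)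
    (hτ : ∀ G : TopGrp, (∃ s : G ≃ₜ* G, IsGI s) → IsGI (τ G)) {g : ℕ} (r : SchurRel p g) :
    surCount (τ (presentedClass p g r).rep) σ = surCount (presentedSigma r.1) σ := by
  obtain ⟨f⟩ := IsoClass.nonempty_rep_mk (P := fun G => IsSchurSigma p G) r.2
  have hB := isGI_presentedSigma r.1
  rw [surCount_eq_of_equiv hp (isPGroup_Q p c) hH
      (hτ _ (presentedClass p g r).rep_spec.gi) (hB.qEquiv c) (qEquiv p f c) σ,
    surCount_eq_of_equiv hp (isPGroup_Q p c) hH hB (hB.qEquiv c) (ContinuousMulEquiv.refl _) σ]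

/-- If `Q_c(G)` surjects onto a group of `p`-class `c`, then it has `p`-class `c`. -/
theorem hasPClass_Q_of_surCount_ne_zero (hp : Odd p) (hc : HasPClass p H c) (σ : H ≃ₜ* H)
    (hτ : ∀ G : TopGrp, (∃ s : G ≃ₜ* G, IsGI s) → IsGI (τ G)) (A : SchurClass p)
    (hA : surCount (τ A.rep) σ ≠ 0) : HasPClass p (Q p A.rep c) c := by
  have := A.rep_spec.finite_Q c
  have hd : DiscreteTopology (Q p A.rep c) := discrete_Q c
  have hB := hτ _ A.rep_spec.gi
  refine ⟨lowerPSeries_Q c, fun n hn => hc.2 ?_⟩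
  rw [surCount_eq_of_equiv hp (isPGroup_Q p c) hc.1 hB (hB.qEquiv c)
    (ContinuousMulEquiv.refl _) σ] at hA
  have hne : Nonempty (SurSigma (qEquiv p (τ A.rep) c) σ) := by
    by_contra h
    rw [not_nonempty_iff] at h
    exact hA (by rw [surCount, ENat.card_eq_zero_iff_empty _ |>.mpr h, ENat.toENNReal_zero])
  obtain ⟨φ, hφ, -⟩ := hne
  have h1 := lowerPSeries_le_map p (φ : Q p A.rep c →* H) hφ n
  have h2 : lowerPSeries p (Q p A.rep c) n = ⊥ := hn
  rw [h2, Subgroup.map_bot] at h1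
  exact le_bot_iff.mp h1

/-- The integral of the number of equivariant surjections, sorted by the isomorphism class of
`Q_c(G)`. -/
theorem lintegral_surCount_eq_tsum (hp : Odd p) (hc : HasPClass p H c) (σ : H ≃ₜ* H)
    (hτ : ∀ G : TopGrp, (∃ s : G ≃ₜ* G, IsGI s) → IsGI (τ G)) :
    ∫⁻ A : SchurClass p, surCount (τ A.rep) σ ∂(muBBH p) =
      ∑' P : AncestorClass p c, muBBHLevel p c P.rep * surCount (τ P.rep) σ := by
  have := countable_ancestorClass (p := p) c
  have hmeas : ∀ P : AncestorClass p c, MeasurableSet (quotientSet p c P.rep) := fun P => by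
    obtain ⟨h1, h2, h3, -⟩ := P.rep_spec.1.finite_discrete
    exact Omega_le _ (MeasurableSpace.measurableSet_generateFrom ⟨c, P.rep, h1, h2, h3, rfl⟩)
  have hdisj : Pairwise (Function.onFun Disjoint
      fun P : AncestorClass p c => quotientSet p c P.rep) := by
    intro P P' hne
    refine Set.disjoint_left.mpr fun A hA hA' => hne ?_
    obtain ⟨e⟩ := (mem_quotientSet_iff A).mp hA
    obtain ⟨e'⟩ := (mem_quotientSet_iff A).mp hA'
    rw [← P.mk_rep, ← P'.mk_rep, IsoClass.mk_eq_iff]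
    exact ⟨e.symm.trans e'⟩
  have hconst : ∀ (P : AncestorClass p c), ∀ A ∈ quotientSet p c P.rep,
      surCount (τ A.rep) σ = surCount (τ P.rep) σ := fun P A hA => by
    obtain ⟨h1, h2, h3, h4⟩ := P.rep_spec.1.finite_discrete
    obtain ⟨e⟩ := (mem_quotientSet_iff A).mp hA
    exact surCount_rep_eq_of_equiv hp hc.1 σ hτ h3 (hτ _ h4) A e
  have hsupp : ∀ A : SchurClass p, surCount (τ A.rep) σ ≠ 0 →
      A ∈ ⋃ P : AncestorClass p c, quotientSet p c P.rep := fun A hA => by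
    have h := hasPClass_Q_of_surCount_ne_zero hp hc σ hτ A hA
    have hQ : IsAncestor p (topGrpQ p c A.rep) ∧ HasPClass p (topGrpQ p c A.rep) c :=
      ⟨⟨A.rep, c, A.rep_spec, ⟨ContinuousMulEquiv.refl _⟩⟩, h⟩
    obtain ⟨f⟩ := IsoClass.nonempty_rep_mk
      (P := fun P => IsAncestor p P ∧ HasPClass p P c) hQ
    exact Set.mem_iUnion.mpr ⟨IsoClass.mk _ hQ, (mem_quotientSet_iff A).mpr ⟨f.symm⟩⟩
  rw [← setLIntegral_eq_of_support_subset (s := ⋃ P : AncestorClass p c, quotientSet p c P.rep)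
    hsupp, lintegral_iUnion hmeas hdisj]
  refine tsum_congr fun P => ?_
  rw [setLIntegral_congr_fun (hmeas P) (hconst P), setLIntegral_const, mul_comm]
  rfl

theorem lintegral_surCount_eq_one [Finite H] (hp : Odd p) (hH : IsPGroup p H) (hc : HasPClass p H c)
    {σ : H ≃ₜ* H} (hσ : IsGI σ)
    (hτ : ∀ G : TopGrp, (∃ s : G ≃ₜ* G, IsGI s) → IsGI (τ G)) :
    ∫⁻ A : SchurClass p, surCount (τ A.rep) σ ∂(muBBH p) = 1 := by
  have hF : Measurable fun A : SchurClass p => surCount (τ A.rep) σ :=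
    (measurable_of_factors c _ (surCount_rep_eq_quotient hp hc.1 σ hτ)).mono Omega_le le_rfl
  obtain ⟨d, -, hd⟩ := exists_numGen_frattiniQuotient (p := p) (P := H)
  rw [muBBH, lintegral_sum_measure, ← tsum_muCLRank_mul_numSurj (p := p) hp d]
  refine tsum_congr fun g => ?_
  obtain ⟨hm, hint⟩ := lintegral_surCount_presented (g := g) hp hH hc.1 hσ
  rw [lintegral_smul_measure, lintegral_map hF (measurable_presentedClass p g)]
  simp only [surCount_rep_presentedClass hp hc.1 σ hτ]
  rw [lintegral_comap_schurRel hp hm, hint, hd, smul_eq_mul]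

end

end BBH

theorem theorem4p1 (p : ℕ) [Fact p.Prime] (hp : Odd p)
    (H : Type*) [Group H] [Finite H] [TopologicalSpace H] [DiscreteTopology H]
    (hH : IsPGroup p H) (c : ℕ) (hc : BBH.HasPClass p H c)
    (σ : H ≃ₜ* H) (hσ : BBH.IsGI σ)
    -- an arbitrary choice of a generator-inverting automorphism of each group that has one
    (τ : ∀ G : BBH.TopGrp, G ≃ₜ* G)
    (hτ : ∀ G : BBH.TopGrp, (∃ s : G ≃ₜ* G, BBH.IsGI s) → BBH.IsGI (τ G)) :
    (BBH.Omega p ≤ (inferInstance : MeasurableSpace (BBH.SchurClass p)) ∧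
      Measurable[BBH.Omega p] fun A : BBH.SchurClass p => BBH.surCount (τ A.rep) σ) ∧
    ∫⁻ A : BBH.SchurClass p, BBH.surCount (τ A.rep) σ ∂(BBH.muBBH p) =
      ∑' P : BBH.AncestorClass p c, BBH.muBBHLevel p c P.rep * BBH.surCount (τ P.rep) σ ∧
    ∑' P : BBH.AncestorClass p c, BBH.muBBHLevel p c P.rep * BBH.surCount (τ P.rep) σ = 1 := by
  have h := BBH.lintegral_surCount_eq_tsum hp hc σ hτ
  exact ⟨⟨BBH.Omega_le,
    BBH.measurable_of_factors c _ (BBH.surCount_rep_eq_quotient hp hc.1 σ hτ)⟩, h,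
    h ▸ BBH.lintegral_surCount_eq_one hp hH hc hσ hτ⟩
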